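/- Let $p$ be a prime and let $A=\bigoplus_{n\ge 0}A_n$ be a connected ($A_0=\mathbb F_p$), graded-commutative and associative Hopf algebra of finite type over $\mathbb F_p$, that is, each $A_n$ is finite dimensional and $A$ carries a degree-preserving algebra map $A\to A\otimes A$ (Koszul sign convention on $A\otimes A$) for which the augmentation $A\to\mathbb F_p$ is a two-sided counit; coassociativity is not required. For an augmented graded-commutative $\mathbb F_p$-algebra $B$ let $I(B)$ be its augmentation ideal, $QB=I(B)/I(B)^2$ its graded vector space of indecomposables, and $G(B)=S(I(B))$ the free graded-commutative algebra on $I(B)$ (an ordinary symmetric algebra if $p=2$), with counit $\varepsilon_B\colon G(B)\to B$ induced by the inclusion $I(B)\subset B$. The André–Quillen homology $H^Q_n(A)$ is the $n$-th homology group of the complex $$\cdots\to Q\,G^3(A)\to Q\,G^2(A)\to Q\,G(A),\qquad d=\sum_{i=0}^{n}(-1)^i\,Q\bigl(G^i(\varepsilon_{G^{n-i}(A)})\bigr)\colon Q\,G^{n+1}(A)\to Q\,G^{n}(A),\quad n\ge 1,$$ in which $Q\,G^{n+1}(A)$ has homological degree $n$; it is a graded $\mathbb F_p$-vector space. Then the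 following hold. 1. As an algebra, $A$ is a tensor product of monogenic algebras on homogeneous generators of positive degree, each of which is a polynomial algebra $\mathbb F_p[y_j]$, a truncated polynomial algebra $\mathbb F_p[x_i]/(x_i^{p^{k_i}})$ with $0<k_i<\infty$, or, when $p$ is odd, an exterior algebra $\Lambda(z_l)$; for odd $p$ the degrees $|y_j|$ and $|x_i|$ are even and $|z_l|$ is odd. 2. The map $Q(\varepsilon_A)\colon Q\,G(A)\to QA$ induces an isomorphism $H^Q_0(A)\cong QA$ of graded vector spaces. 3. For every decomposition of $A$ as in 1, with truncated polynomial generators $x_i$ of height $p^{k_i}$, the elements $\xi^{k_i}x_i$ of $S(QA)$, i.e. the $p^{k_i}$-th powers in $S(QA)$ of the classes of the $x_i$ in $QA$, are linearly independent, and $H^Q_1(A)$ is isomorphic, as a graded vector space, to their linear span, where $\xi^{k_i}x_i$ has degree $p^{k_i}\cdot|x_i|$. 4. $H^Q_n(A)=0$ for all $n\ge 2$. -/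

import Mathlib

open CategoryTheory TensorProduct

universe u v

/-! ## Free graded-commutative algebras -/

/-- The defining relations of the free graded-commutative algebra on a graded vector space
`V = ⨁ 𝒱 i`:  `x y = (-1) ^ (i j) y x` for `x` of degree `i` and `y` of degree `j`. -/
inductive GrSymAlg.Rel {k : Type} [Field k] {V : Type u} [AddCommGroup V] [Module k V]
    (𝒱 : ℕ → Submodule k V) : TensorAlgebra k V → TensorAlgebra k V → Prop
  | comm {i j : ℕ} {x y : V} (hx : x ∈ 𝒱 i) (hy : y ∈ 𝒱 j) :
      GrSymAlg.Rel 𝒱 (TensorAlgebra.ι k x * TensorAlgebra.ι k y)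
        ((-1 : k) ^ (i * j) • (TensorAlgebra.ι k y * TensorAlgebra.ι k x))

/-- The (graded) symmetric algebra `S(V)`, i.e. the free graded-commutative algebra on the graded
vector space `V = ⨁ 𝒱 i`. In characteristic `2` this is the ordinary symmetric algebra; in other
characteristics it is polynomial on the even part tensor exterior on the odd part (the relations
force `x ^ 2 = 0` for `x` of odd degree). -/
def GrSymAlg {k : Type} [Field k] {V : Type u} [AddCommGroup V] [Module k V]
    (𝒱 : ℕ → Submodule k V) : Type u :=
  RingQuot (GrSymAlg.Rel 𝒱)

namespace GrSymAlg

section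

variable {k : Type} [Field k] {V W : Type u} [AddCommGroup V] [Module k V]
  [AddCommGroup W] [Module k W] (𝒱 : ℕ → Submodule k V) (𝒲 : ℕ → Submodule k W)

noncomputable instance instRing : Ring (GrSymAlg 𝒱) :=
  inferInstanceAs (Ring (RingQuot (GrSymAlg.Rel 𝒱)))

noncomputable instance instAlgebra : Algebra k (GrSymAlg 𝒱) :=
  inferInstanceAs (Algebra k (RingQuot (GrSymAlg.Rel 𝒱)))

/-- The inclusion of the generators `V → S(V)`. -/
noncomputable def ι : V →ₗ[k] GrSymAlg 𝒱 :=
  (RingQuot.mkAlgHom k (GrSymAlg.Rel 𝒱)).toLinearMap ∘ₗ TensorAlgebra.ι k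

theorem ι_mul_ι {i j : ℕ} {x y : V} (hx : x ∈ 𝒱 i) (hy : y ∈ 𝒱 j) :
    ι 𝒱 x * ι 𝒱 y = (-1 : k) ^ (i * j) • (ι 𝒱 y * ι 𝒱 x) := by
  have h := RingQuot.mkAlgHom_rel k (GrSymAlg.Rel.comm (𝒱 := 𝒱) hx hy)
  rw [map_smul, map_mul, map_mul] at h
  exact h

/-- The universal property of `S(V)`: a linear map `V → B` whose values on homogeneous elements
commute up to the sign extends to an algebra map `S(V) → B`. -/
noncomputable def lift {B : Type*} [Semiring B] [Algebra k B] (f : V →ₗ[k] B)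
    (hf : ∀ (i j : ℕ) (x y : V), x ∈ 𝒱 i → y ∈ 𝒱 j →
      f x * f y = (-1 : k) ^ (i * j) • (f y * f x)) : GrSymAlg 𝒱 →ₐ[k] B :=
  RingQuot.liftAlgHom k ⟨TensorAlgebra.lift k f, by
    rintro _ _ ⟨hx, hy⟩
    simpa using hf _ _ _ _ hx hy⟩

@[simp]
theorem lift_ι {B : Type*} [Semiring B] [Algebra k B] (f : V →ₗ[k] B)
    (hf : ∀ (i j : ℕ) (x y : V), x ∈ 𝒱 i → y ∈ 𝒱 j →
      f x * f y = (-1 : k) ^ (i * j) • (f y * f x)) (v : V) :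
    lift 𝒱 f hf (ι 𝒱 v) = f v := by
  have h : lift 𝒱 f hf (ι 𝒱 v) = TensorAlgebra.lift k f (TensorAlgebra.ι k v) :=
    RingQuot.liftAlgHom_mkAlgHom_apply k _ _ _
  simpa using h

theorem algHom_ext {B : Type*} [Semiring B] [Algebra k B] {f g : GrSymAlg 𝒱 →ₐ[k] B}
    (h : ∀ v, f (ι 𝒱 v) = g (ι 𝒱 v)) : f = g := by
  apply RingQuot.ringQuot_ext' k
  apply TensorAlgebra.hom_ext
  ext v
  exact h v

/-- The degree `n` part of `S(V)`: the span of the products of homogeneous elements of `V` whose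
degrees add up to `n`. -/
noncomputable def grading (n : ℕ) : Submodule k (GrSymAlg 𝒱) :=
  Submodule.span k {a | ∃ L : List (Σ i, 𝒱 i),
    (L.map fun v => v.1).sum = n ∧ (L.map fun v => ι 𝒱 (v.2 : V)).prod = a}

theorem prod_mem_grading (L : List (Σ i, 𝒱 i)) :
    (L.map fun v => ι 𝒱 (v.2 : V)).prod ∈ grading 𝒱 (L.map fun v => v.1).sum :=
  Submodule.subset_span ⟨L, rfl, rfl⟩

theorem ι_mem_grading {i : ℕ} {x : V} (hx : x ∈ 𝒱 i) : ι 𝒱 x ∈ grading 𝒱 i := by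
  simpa using prod_mem_grading 𝒱 [⟨i, ⟨x, hx⟩⟩]

instance instGradedMonoid : SetLike.GradedMonoid (grading 𝒱) where
  one_mem := by simpa using prod_mem_grading 𝒱 []
  mul_mem := by
    intro m n a b ha hb
    induction ha using Submodule.span_induction with
    | mem a ha =>
      obtain ⟨L, rfl, rfl⟩ := ha
      induction hb using Submodule.span_induction with
      | mem b hb =>
        obtain ⟨L', rfl, rfl⟩ := hb
        simpa using prod_mem_grading 𝒱 (L ++ L')
      | zero => simp
      | add x y _ _ hx hy => rw [mul_add]; exact add_mem hx hy
      | smul c x _ hx => rw [mul_smul_comm]; exact Submodule.smul_mem _ _ hx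
    | zero => simp
    | add x y _ _ hx hy => rw [add_mul]; exact add_mem hx hy
    | smul c x _ hx => rw [smul_mul_assoc]; exact Submodule.smul_mem _ _ hx

section Decomposition

variable [DirectSum.Decomposition 𝒱]

/-- Auxiliary map for the decomposition of `S(V)` into its homogeneous parts. -/
noncomputable def decomposeι : V →ₗ[k] DirectSum ℕ fun i => grading 𝒱 i :=
  DirectSum.toModule k ℕ _ (fun i =>
      DirectSum.lof k ℕ (fun i => grading 𝒱 i) i ∘ₗ
        ((ι 𝒱 ∘ₗ (𝒱 i).subtype).codRestrict (grading 𝒱 i) fun v => ι_mem_grading 𝒱 v.2)) ∘ₗ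
    (DirectSum.decomposeLinearEquiv 𝒱).toLinearMap

theorem decomposeι_of_mem {i : ℕ} {x : V} (hx : x ∈ 𝒱 i) :
    decomposeι 𝒱 x = DirectSum.of (fun i => grading 𝒱 i) i ⟨ι 𝒱 x, ι_mem_grading 𝒱 hx⟩ := by
  simp only [decomposeι, LinearMap.comp_apply, LinearEquiv.coe_coe,
    DirectSum.decomposeLinearEquiv_apply]
  rw [DirectSum.decompose_of_mem _ hx, ← DirectSum.lof_eq_of k, DirectSum.toModule_lof]
  rfl

theorem decomposeι_mul_decomposeι (i j : ℕ) (x y : V) (hx : x ∈ 𝒱 i) (hy : y ∈ 𝒱 j) :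
    decomposeι 𝒱 x * decomposeι 𝒱 y =
      (-1 : k) ^ (i * j) • (decomposeι 𝒱 y * decomposeι 𝒱 x) := by
  rw [decomposeι_of_mem 𝒱 hx, decomposeι_of_mem 𝒱 hy, DirectSum.of_mul_of, DirectSum.of_mul_of,
    ← DirectSum.lof_eq_of k, ← DirectSum.lof_eq_of k, ← map_smul, DirectSum.lof_eq_of,
    DirectSum.lof_eq_of]
  exact DirectSum.of_eq_of_gradedMonoid_eq
    (Sigma.subtype_ext (add_comm _ _) (ι_mul_ι 𝒱 hx hy))

/-- Auxiliary map for the decomposition of `S(V)` into its homogeneous parts. -/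
noncomputable def decomposeHom : GrSymAlg 𝒱 →ₐ[k] DirectSum ℕ fun i => grading 𝒱 i :=
  lift 𝒱 (decomposeι 𝒱) (decomposeι_mul_decomposeι 𝒱)

theorem decomposeHom_prod (L : List (Σ i, 𝒱 i)) :
    decomposeHom 𝒱 (L.map fun v => ι 𝒱 (v.2 : V)).prod =
      DirectSum.of (fun i => grading 𝒱 i) (L.map fun v => v.1).sum
        ⟨_, prod_mem_grading 𝒱 L⟩ := by
  induction L with
  | nil => simp only [List.map_nil, List.prod_nil, map_one]; rfl
  | cons v L ih =>
    simp only [List.map_cons, List.prod_cons, map_mul]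
    rw [ih, decomposeHom, lift_ι, decomposeι_of_mem 𝒱 v.2.2, DirectSum.of_mul_of]
    exact DirectSum.of_eq_of_gradedMonoid_eq (Sigma.subtype_ext rfl rfl)

noncomputable instance instGradedAlgebra : GradedAlgebra (grading 𝒱) :=
  GradedAlgebra.ofAlgHom _ (decomposeHom 𝒱)
    (by
      apply algHom_ext
      intro v
      induction v using DirectSum.Decomposition.inductionOn 𝒱 with
      | zero => simp
      | homogeneous x =>
        simp only [AlgHom.comp_apply, decomposeHom, lift_ι]
        rw [decomposeι_of_mem 𝒱 x.2, DirectSum.coeAlgHom_of]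
        rfl
      | add x y hx hy => rw [map_add, map_add, map_add, hx, hy])
    (by
      rintro i ⟨x, hx⟩
      induction hx using Submodule.span_induction with
      | mem a ha =>
        obtain ⟨L, rfl, rfl⟩ := ha
        exact decomposeHom_prod 𝒱 L
      | zero =>
        rw [map_zero]
        exact (map_zero (DirectSum.of (fun i => grading 𝒱 i) i)).symm
      | add x y hx hy hx' hy' =>
        rw [map_add, hx', hy', ← map_add]
        rfl
      | smul c x hx hx' =>
        rw [map_smul, hx', ← DirectSum.lof_eq_of k, ← map_smul]
        rfl)

end Decomposition

theorem ι_mul_prod {i : ℕ} {x : V} (hx : x ∈ 𝒱 i) (L : List (Σ i, 𝒱 i)) :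
    ι 𝒱 x * (L.map fun v => ι 𝒱 (v.2 : V)).prod =
      (-1 : k) ^ (i * (L.map fun v => v.1).sum) •
        ((L.map fun v => ι 𝒱 (v.2 : V)).prod * ι 𝒱 x) := by
  induction L with
  | nil => simp
  | cons v L ih =>
    simp only [List.map_cons, List.prod_cons, List.sum_cons]
    rw [← mul_assoc, ι_mul_ι 𝒱 hx v.2.2, smul_mul_assoc, mul_assoc, ih, mul_smul_comm, smul_smul,
      mul_add, pow_add, mul_assoc]

theorem prod_mul_prod (L L' : List (Σ i, 𝒱 i)) :
    (L.map fun v => ι 𝒱 (v.2 : V)).prod * (L'.map fun v => ι 𝒱 (v.2 : V)).prod =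
      (-1 : k) ^ ((L.map fun v => v.1).sum * (L'.map fun v => v.1).sum) •
        ((L'.map fun v => ι 𝒱 (v.2 : V)).prod * (L.map fun v => ι 𝒱 (v.2 : V)).prod) := by
  induction L with
  | nil => simp
  | cons v L ih =>
    simp only [List.map_cons, List.prod_cons, List.sum_cons]
    rw [mul_assoc, ih, mul_smul_comm, ← mul_assoc, ι_mul_prod 𝒱 v.2.2, smul_mul_assoc, smul_smul,
      mul_assoc, add_mul, add_comm, pow_add]

theorem graded_comm {m n : ℕ} {a b : GrSymAlg 𝒱} (ha : a ∈ grading 𝒱 m) (hb : b ∈ grading 𝒱 n) :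
    a * b = (-1 : k) ^ (m * n) • (b * a) := by
  induction ha using Submodule.span_induction with
  | mem a ha =>
    obtain ⟨L, rfl, rfl⟩ := ha
    induction hb using Submodule.span_induction with
    | mem b hb =>
      obtain ⟨L', rfl, rfl⟩ := hb
      exact prod_mul_prod 𝒱 L L'
    | zero => simp
    | add x y _ _ hx hy => rw [mul_add, add_mul, smul_add, hx, hy]
    | smul c x _ hx => rw [mul_smul_comm, smul_mul_assoc, hx, smul_comm]
  | zero => simp
  | add x y _ _ hx hy => rw [mul_add, add_mul, smul_add, hx, hy]
  | smul c x _ hx => rw [mul_smul_comm, smul_mul_assoc, hx, smul_comm]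

/-- The augmentation of `S(V)`, sending `V` to `0`. -/
noncomputable def aug : GrSymAlg 𝒱 →ₐ[k] k :=
  lift 𝒱 0 (by simp)

theorem aug_eq_zero {n : ℕ} (hn : n ≠ 0) {a : GrSymAlg 𝒱} (ha : a ∈ grading 𝒱 n) :
    aug 𝒱 a = 0 := by
  induction ha using Submodule.span_induction with
  | mem a ha =>
    obtain ⟨L, rfl, rfl⟩ := ha
    cases L with
    | nil => simp at hn
    | cons v L => simp [aug]
  | zero => simp
  | add x y _ _ hx hy => simp [hx, hy]
  | smul c x _ hx => simp [hx]

variable {𝒱 𝒲} in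
/-- A degree-preserving linear map `V → W` induces an algebra map `S(V) → S(W)`. -/
noncomputable def map (f : V →ₗ[k] W) (hf : ∀ n, ∀ x ∈ 𝒱 n, f x ∈ 𝒲 n) :
    GrSymAlg 𝒱 →ₐ[k] GrSymAlg 𝒲 :=
  lift 𝒱 (ι 𝒲 ∘ₗ f) fun _ _ _ _ hx hy => ι_mul_ι 𝒲 (hf _ _ hx) (hf _ _ hy)

@[simp]
theorem map_ι (f : V →ₗ[k] W) (hf : ∀ n, ∀ x ∈ 𝒱 n, f x ∈ 𝒲 n) (v : V) :
    map f hf (ι 𝒱 v) = ι 𝒲 (f v) := by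
  simp [map]

/-- An algebra map out of `S(V)` preserves degrees as soon as it does so on `V`. -/
theorem mem_of_ι_mem {B : Type*} [Semiring B] [Algebra k B] (ℬ : ℕ → Submodule k B)
    [SetLike.GradedMonoid ℬ] (f : GrSymAlg 𝒱 →ₐ[k] B) (hf : ∀ n, ∀ x ∈ 𝒱 n, f (ι 𝒱 x) ∈ ℬ n)
    {n : ℕ} {a : GrSymAlg 𝒱} (ha : a ∈ grading 𝒱 n) : f a ∈ ℬ n := by
  induction ha using Submodule.span_induction with
  | mem a ha =>
    obtain ⟨L, rfl, rfl⟩ := ha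
    induction L with
    | nil => simpa using SetLike.GradedOne.one_mem (A := ℬ)
    | cons v L ih =>
      simp only [List.map_cons, List.prod_cons, List.sum_cons, map_mul]
      exact SetLike.GradedMul.mul_mem (hf _ _ v.2.2) ih
  | zero => simp
  | add x y _ _ hx hy => rw [map_add]; exact add_mem hx hy
  | smul c x _ hx => rw [map_smul]; exact Submodule.smul_mem _ _ hx

end

end GrSymAlg

/-! ## Augmented graded-commutative algebras -/

/-- An augmented graded-commutative (unital, associative) `ℕ`-graded `k`-algebra. -/
structure AugGrAlg (k : Type) [Field k] : Type (u + 1) where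
  carrier : Type u
  [ring : Ring carrier]
  [algebra : Algebra k carrier]
  grading : ℕ → Submodule k carrier
  [gradedAlgebra : GradedAlgebra grading]
  graded_comm : ∀ {i j : ℕ} {a b : carrier}, a ∈ grading i → b ∈ grading j →
    a * b = (-1 : k) ^ (i * j) • (b * a)
  aug : carrier →ₐ[k] k
  aug_eq_zero : ∀ {n : ℕ} {a : carrier}, n ≠ 0 → a ∈ grading n → aug a = 0

namespace AugGrAlg

attribute [instance] AugGrAlg.ring AugGrAlg.algebra AugGrAlg.gradedAlgebra

section

variable {k : Type} [Field k]

/-- Morphisms: degree-preserving algebra maps compatible with the augmentations. -/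
@[ext]
structure Hom (A B : AugGrAlg.{u} k) : Type u where
  toAlgHom : A.carrier →ₐ[k] B.carrier
  map_mem : ∀ n, ∀ a ∈ A.grading n, toAlgHom a ∈ B.grading n
  aug_comp : ∀ a, B.aug (toAlgHom a) = A.aug a

instance instCategory : Category.{u} (AugGrAlg.{u} k) where
  Hom := Hom
  id A := ⟨AlgHom.id k _, fun _ _ h => h, fun _ => rfl⟩
  comp f g := ⟨g.toAlgHom.comp f.toAlgHom,
    fun n a h => g.map_mem n _ (f.map_mem n a h),
    fun a => (g.aug_comp _).trans (f.aug_comp a)⟩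

theorem hom_ext {A B : AugGrAlg.{u} k} {f g : A ⟶ B} (h : f.toAlgHom = g.toAlgHom) : f = g :=
  Hom.ext h

@[simp]
theorem id_toAlgHom (A : AugGrAlg.{u} k) : (𝟙 A : A ⟶ A).toAlgHom = AlgHom.id k _ := rfl

@[simp]
theorem comp_toAlgHom {A B C : AugGrAlg.{u} k} (f : A ⟶ B) (g : B ⟶ C) :
    (f ≫ g).toAlgHom = g.toAlgHom.comp f.toAlgHom := rfl

/-! ### The augmentation ideal as a graded vector space -/

/-- The augmentation ideal `I(A)`. -/
def augIdeal (A : AugGrAlg.{u} k) : Submodule k A.carrier :=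
  LinearMap.ker A.aug.toLinearMap

theorem mem_augIdeal {A : AugGrAlg.{u} k} {a : A.carrier} : a ∈ A.augIdeal ↔ A.aug a = 0 :=
  Iff.rfl

/-- The degree `n` part of the augmentation ideal. -/
def idealGrading (A : AugGrAlg.{u} k) (n : ℕ) : Submodule k A.augIdeal :=
  (A.grading n).comap A.augIdeal.subtype

/-- The linear projection `a ↦ a - ε(a) 1` of `A` onto its augmentation ideal. -/
def idealProj (A : AugGrAlg.{u} k) : A.carrier →ₗ[k] A.augIdeal :=
  (LinearMap.id - (Algebra.linearMap k A.carrier) ∘ₗ A.aug.toLinearMap).codRestrict A.augIdeal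
    fun a => by simp [mem_augIdeal]

theorem coe_idealProj (A : AugGrAlg.{u} k) (a : A.carrier) :
    (A.idealProj a : A.carrier) = a - algebraMap k _ (A.aug a) := rfl

theorem idealProj_mem (A : AugGrAlg.{u} k) {n : ℕ} {a : A.carrier} (ha : a ∈ A.grading n) :
    A.idealProj a ∈ A.idealGrading n := by
  change (A.idealProj a : A.carrier) ∈ A.grading n
  rw [coe_idealProj]
  by_cases hn : n = 0
  · subst hn
    exact sub_mem ha (SetLike.algebraMap_mem_graded A.grading _)
  · simpa [A.aug_eq_zero hn ha] using ha

theorem idealProj_coe (A : AugGrAlg.{u} k) (a : A.augIdeal) :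
    A.idealProj (a : A.carrier) = a := by
  ext
  rw [coe_idealProj, mem_augIdeal.mp a.2]
  simp

noncomputable instance instDecompositionIdeal (A : AugGrAlg.{u} k) :
    DirectSum.Decomposition A.idealGrading :=
  DirectSum.Decomposition.ofLinearMap A.idealGrading
    (DirectSum.toModule k ℕ _ (fun n =>
        DirectSum.lof k ℕ (fun n => A.idealGrading n) n ∘ₗ
          ((A.idealProj ∘ₗ (A.grading n).subtype).codRestrict (A.idealGrading n)
            fun a => A.idealProj_mem a.2)) ∘ₗ
      (DirectSum.decomposeLinearEquiv A.grading).toLinearMap ∘ₗ A.augIdeal.subtype)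
    (by
      have h : ∀ a : A.carrier,
          DirectSum.coeLinearMap A.idealGrading (DirectSum.toModule k ℕ _ (fun n =>
            DirectSum.lof k ℕ (fun n => A.idealGrading n) n ∘ₗ
              ((A.idealProj ∘ₗ (A.grading n).subtype).codRestrict (A.idealGrading n)
                fun a => A.idealProj_mem a.2)) (DirectSum.decompose A.grading a)) =
            A.idealProj a := by
        intro a
        induction a using DirectSum.Decomposition.inductionOn A.grading with
        | zero => simp
        | homogeneous a =>
          rw [DirectSum.decompose_coe, ← DirectSum.lof_eq_of k, DirectSum.toModule_lof,
            LinearMap.comp_apply, DirectSum.coeLinearMap_lof]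
          rfl
        | add a b ha hb => rw [DirectSum.decompose_add, map_add, map_add, map_add, ha, hb]
      ext1 a
      exact (h a).trans (A.idealProj_coe a))
    (by
      ext n a : 2
      have hmem : ((a : A.augIdeal) : A.carrier) ∈ A.grading n := a.2
      simp only [LinearMap.comp_apply, DirectSum.coeLinearMap_lof, LinearEquiv.coe_coe,
        DirectSum.decomposeLinearEquiv_apply, Submodule.subtype_apply, LinearMap.id_apply]
      rw [DirectSum.decompose_of_mem A.grading hmem, ← DirectSum.lof_eq_of k,
        DirectSum.toModule_lof, LinearMap.comp_apply]
      congr 1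
      ext1
      exact A.idealProj_coe a.1)

/-- A morphism restricts to the augmentation ideals. -/
def idealMap {A B : AugGrAlg.{u} k} (f : A ⟶ B) : A.augIdeal →ₗ[k] B.augIdeal :=
  f.toAlgHom.toLinearMap.restrict fun a ha => mem_augIdeal.mpr ((f.aug_comp a).trans ha)

@[simp]
theorem coe_idealMap {A B : AugGrAlg.{u} k} (f : A ⟶ B) (a : A.augIdeal) :
    (idealMap f a : B.carrier) = f.toAlgHom a := rfl

theorem idealMap_mem {A B : AugGrAlg.{u} k} (f : A ⟶ B) (n : ℕ) :
    ∀ a ∈ A.idealGrading n, idealMap f a ∈ B.idealGrading n :=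
  fun a ha => f.map_mem n a ha

/-! ### The symmetric algebra comonad -/

/-- The symmetric algebra functor `A ↦ S(I(A))` on augmented graded-commutative algebras: the free
graded-commutative algebra on the graded vector space underlying the augmentation ideal. -/
noncomputable def symFunctor (k : Type) [Field k] : AugGrAlg.{u} k ⥤ AugGrAlg.{u} k where
  obj A :=
    { carrier := GrSymAlg A.idealGrading
      grading := GrSymAlg.grading A.idealGrading
      graded_comm := GrSymAlg.graded_comm A.idealGrading
      aug := GrSymAlg.aug A.idealGrading
      aug_eq_zero := fun hn ha => GrSymAlg.aug_eq_zero A.idealGrading hn ha }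
  map {A B} f :=
    { toAlgHom := GrSymAlg.map (idealMap f) (idealMap_mem f)
      map_mem := fun n a ha => GrSymAlg.mem_of_ι_mem A.idealGrading (GrSymAlg.grading B.idealGrading) _
        (fun n x hx => by
          rw [GrSymAlg.map_ι]
          exact GrSymAlg.ι_mem_grading _ (idealMap_mem f n x hx)) ha
      aug_comp := by
        intro a
        have h : (GrSymAlg.aug B.idealGrading).comp (GrSymAlg.map (idealMap f) (idealMap_mem f)) =
            GrSymAlg.aug A.idealGrading :=
          GrSymAlg.algHom_ext _ fun v => by simp [GrSymAlg.aug]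
        exact DFunLike.congr_fun h a }
  map_id A := hom_ext (GrSymAlg.algHom_ext _ fun v => by
    rw [GrSymAlg.map_ι]
    rfl)
  map_comp f g := hom_ext (GrSymAlg.algHom_ext _ fun v => by
    rw [GrSymAlg.map_ι, comp_toAlgHom, AlgHom.comp_apply]
    dsimp only
    rw [GrSymAlg.map_ι, GrSymAlg.map_ι]
    rfl)

/-- The algebra map `S(I(A)) → A` extending the inclusion of `I(A)`: it multiplies out the elements
of `I(A)` in `A`. -/
noncomputable def multHom (A : AugGrAlg.{u} k) : GrSymAlg A.idealGrading →ₐ[k] A.carrier :=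
  GrSymAlg.lift A.idealGrading A.augIdeal.subtype fun _ _ _ _ hx hy => A.graded_comm hx hy

@[simp]
theorem multHom_ι (A : AugGrAlg.{u} k) (v : A.augIdeal) :
    A.multHom (GrSymAlg.ι A.idealGrading v) = (v : A.carrier) :=
  GrSymAlg.lift_ι _ _ _ _

theorem multHom_mem (A : AugGrAlg.{u} k) (n : ℕ) (a : GrSymAlg A.idealGrading)
    (ha : a ∈ GrSymAlg.grading A.idealGrading n) : A.multHom a ∈ A.grading n :=
  GrSymAlg.mem_of_ι_mem A.idealGrading A.grading _
    (fun n x hx => by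
      rw [multHom_ι]
      exact hx) ha

theorem aug_multHom (A : AugGrAlg.{u} k) (a : GrSymAlg A.idealGrading) :
    A.aug (A.multHom a) = GrSymAlg.aug A.idealGrading a := by
  have h : A.aug.comp A.multHom = GrSymAlg.aug A.idealGrading :=
    GrSymAlg.algHom_ext _ fun v => by
      rw [AlgHom.comp_apply, multHom_ι, GrSymAlg.aug, GrSymAlg.lift_ι]
      exact v.2
  exact DFunLike.congr_fun h a

theorem multHom_map {A B : AugGrAlg.{u} k} (f : A ⟶ B) :
    B.multHom.comp (GrSymAlg.map (idealMap f) (idealMap_mem f)) = f.toAlgHom.comp A.multHom :=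
  GrSymAlg.algHom_ext _ fun v => by simp

/-- The counit `S(I(A)) → A` of the symmetric algebra comonad. -/
noncomputable def symCounit (k : Type) [Field k] : symFunctor.{u} k ⟶ 𝟭 (AugGrAlg.{u} k) where
  app A := ⟨A.multHom, A.multHom_mem, A.aug_multHom⟩
  naturality _ _ f := hom_ext (multHom_map f)

/-! ### Indecomposables -/

/-- The decomposable elements, i.e. the square of the augmentation ideal, inside that ideal. -/
def decomposables (A : AugGrAlg.{u} k) : Submodule k A.augIdeal :=
  (A.augIdeal * A.augIdeal).comap A.augIdeal.subtype

/-- The vector space of indecomposables `QA = I(A) / I(A)²`. -/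
abbrev Indec (A : AugGrAlg.{u} k) : Type u := A.augIdeal ⧸ A.decomposables

/-- The degree `m` part of `QA`. -/
def indecGrading (A : AugGrAlg.{u} k) (m : ℕ) : Submodule k A.Indec :=
  (A.idealGrading m).map A.decomposables.mkQ

theorem decomposables_le_comap {A B : AugGrAlg.{u} k} (f : A ⟶ B) :
    A.decomposables ≤ B.decomposables.comap (idealMap f) := by
  intro a ha
  have h1 : (a : A.carrier) ∈ A.augIdeal * A.augIdeal := ha
  have h2 := Submodule.mem_map_of_mem (f := f.toAlgHom.toLinearMap) h1
  rw [Submodule.map_mul] at h2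
  have h3 : A.augIdeal.map f.toAlgHom.toLinearMap ≤ B.augIdeal := by
    rintro _ ⟨x, hx, rfl⟩
    exact (idealMap f ⟨x, hx⟩).2
  exact mul_le_mul' h3 h3 h2

/-- The map induced on indecomposables. -/
def indecMap {A B : AugGrAlg.{u} k} (f : A ⟶ B) : A.Indec →ₗ[k] B.Indec :=
  A.decomposables.mapQ B.decomposables (idealMap f) (decomposables_le_comap f)

theorem indecMap_mem {A B : AugGrAlg.{u} k} (f : A ⟶ B) (m : ℕ) :
    ∀ x ∈ A.indecGrading m, indecMap f x ∈ B.indecGrading m := by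
  rintro _ ⟨a, ha, rfl⟩
  exact ⟨idealMap f a, idealMap_mem f m a ha, rfl⟩

/-- The functor `A ↦ (QA)_m`, the degree `m` part of the indecomposables. -/
def indecFunctor (k : Type) [Field k] (m : ℕ) : AugGrAlg.{u} k ⥤ ModuleCat.{u} k where
  obj A := ModuleCat.of k (A.indecGrading m)
  map f := ModuleCat.ofHom ((indecMap f).restrict (indecMap_mem f m))
  map_id A := by
    ext ⟨_, a, ha, rfl⟩
    rfl
  map_comp f g := by
    ext ⟨_, a, ha, rfl⟩
    rfl

end

end AugGrAlg

/-! ## The chain complex of a comonad -/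

namespace Cotriple

section

universe v₁ v₂ u₁ u₂

variable {C : Type u₁} [Category.{v₁} C] (G : C ⥤ C) (ε : G ⟶ 𝟭 C)

/-- The iterates `G ^ n X`. -/
def iter (X : C) : ℕ → C
  | 0 => X
  | n + 1 => G.obj (iter X n)

/-- The face maps `d_i : G ^ (n + 1) X ⟶ G ^ n X`, `0 ≤ i ≤ n`, of the simplicial resolution of `X`:
`d_i` is `G ^ i` applied to the counit `ε` at `G ^ (n - i) X`. -/
def face (X : C) : (n : ℕ) → Fin (n + 1) → (iter G X (n + 1) ⟶ iter G X n)
  | 0 => fun _ => ε.app X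
  | n + 1 => Fin.cases (ε.app (iter G X (n + 1))) fun i => G.map (face X n i)

@[simp]
theorem face_zero (X : C) (n : ℕ) : face G ε X n 0 = ε.app (iter G X n) := by
  cases n <;> rfl

@[simp]
theorem face_succ (X : C) (n : ℕ) (i : Fin (n + 1)) :
    face G ε X (n + 1) i.succ = G.map (face G ε X n i) := rfl

theorem face_comp_face (X : C) (n : ℕ) (i j : Fin (n + 1)) (h : i ≤ j) :
    face G ε X (n + 1) j.succ ≫ face G ε X n i =
      face G ε X (n + 1) i.castSucc ≫ face G ε X n j := by
  induction n with
  | zero =>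
    obtain rfl : i = 0 := by lia
    obtain rfl : j = 0 := by lia
    exact ε.naturality (ε.app X)
  | succ n ih =>
    refine Fin.cases (fun h => ?_) (fun i h => ?_) i h
    · rw [face_zero, Fin.castSucc_zero, face_zero, face_succ]
      exact ε.naturality (face G ε X (n + 1) j)
    · obtain ⟨j, rfl⟩ : ∃ j' : Fin (n + 1), j = j'.succ := by
        refine ⟨j.pred ?_, (Fin.succ_pred _ _).symm⟩
        rintro rfl
        exact Fin.succ_ne_zero i (Fin.le_zero_iff.mp h)
      have hij : i ≤ j := Fin.succ_le_succ_iff.mp h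
      exact ((G.map_comp _ _).symm.trans (congr_arg (fun f => G.map f) (ih i j hij))).trans
        (G.map_comp _ _)

variable {D : Type u₂} [Category.{v₂} D] [Preadditive D] (F : C ⥤ D)

/-- The differential: the alternating sum of the images under `F` of the face maps. -/
def d (X : C) (n : ℕ) : F.obj (iter G X (n + 2)) ⟶ F.obj (iter G X (n + 1)) :=
  ∑ i : Fin (n + 2), (-1 : ℤ) ^ (i : ℕ) • F.map (face G ε X (n + 1) i)

theorem d_comp_d (X : C) (n : ℕ) : d G ε F X (n + 1) ≫ d G ε F X n = 0 := by
  simp only [d, Preadditive.comp_sum, Preadditive.sum_comp, ← Finset.sum_product']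
  let P := Fin (n + 2) × Fin (n + 3)
  let S : Finset P := {ij : P | (ij.2 : ℕ) ≤ (ij.1 : ℕ)}
  rw [Finset.univ_product_univ, ← Finset.sum_add_sum_compl S, ← eq_neg_iff_add_eq_zero,
    ← Finset.sum_neg_distrib]
  let φ : ∀ ij : P, ij ∈ S → P := fun ij hij =>
    (Fin.castLT ij.2 (lt_of_le_of_lt (Finset.mem_filter.mp hij).right (Fin.is_lt ij.1)), ij.1.succ)
  apply Finset.sum_bij φ
  · intro ij hij
    simp_rw [S, φ, Finset.compl_filter, Finset.mem_filter_univ, Fin.val_succ,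
      Fin.val_castLT] at hij ⊢
    lia
  · rintro ⟨i, j⟩ hij ⟨i', j'⟩ hij' h
    rw [Prod.mk_inj]
    exact ⟨by simpa [φ] using! congr_arg Prod.snd h,
      by simpa [φ, Fin.castSucc_castLT] using! congr_arg Fin.castSucc (congr_arg Prod.fst h)⟩
  · rintro ⟨i', j'⟩ hij'
    simp_rw [S, Finset.compl_filter, Finset.mem_filter_univ, not_le] at hij'
    refine ⟨(j'.pred <| ?_, Fin.castSucc i'), ?_, ?_⟩
    · rintro rfl
      simp only [Fin.val_zero, not_lt_zero] at hij'
    · simpa [S] using! Nat.le_sub_one_of_lt hij'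
    · simp only [φ, Fin.castLT_castSucc, Fin.succ_pred]
  · rintro ⟨i, j⟩ hij
    have hle : (j : ℕ) ≤ i := (Finset.mem_filter.mp hij).right
    dsimp
    simp only [Preadditive.zsmul_comp, Preadditive.comp_zsmul, smul_smul, ← neg_smul,
      ← F.map_comp]
    congr 1
    · simp only [φ, Fin.val_succ, pow_add, pow_one, mul_neg, neg_neg, mul_one]
      apply mul_comm
    · have h := face_comp_face G ε X (n + 1) (j.castLT (lt_of_le_of_lt hle i.2)) i hle
      rw [Fin.castSucc_castLT] at h
      exact congr_arg F.map h.symm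

/-- The chain complex `⋯ ⟶ F (G³ X) ⟶ F (G² X) ⟶ F (G X)` with `F (G ^ (n + 1) X)` in degree `n`. -/
def complex (X : C) : ChainComplex D ℕ :=
  ChainComplex.of (fun n => F.obj (iter G X (n + 1))) (d G ε F X) (d_comp_d G ε F X)

theorem complex_d (X : C) (n : ℕ) : (complex G ε F X).d (n + 1) n = d G ε F X n := by
  simp [complex]

end

end Cotriple

/-! ## André-Quillen homology, Hopf algebras and Borel decompositions -/

namespace AugGrAlg

section

variable {k : Type} [Field k]

/-- The degree `m` part of the complex of indecomposables of the resolution of `A` given by the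
symmetric algebra comonad. -/
noncomputable def aqComplex (A : AugGrAlg.{u} k) (m : ℕ) : ChainComplex (ModuleCat.{u} k) ℕ :=
  Cotriple.complex (symFunctor k) (symCounit k) (indecFunctor k m) A

/-- The degree `m` part `H_n^Q(A)_m` of the `n`-th André-Quillen homology group of `A`. -/
noncomputable def aqHomology (A : AugGrAlg.{u} k) (n m : ℕ) : ModuleCat.{u} k :=
  (A.aqComplex m).homology n

/-- `A` is connected if its degree `0` part is `k · 1`. -/
def Connected (A : AugGrAlg.{u} k) : Prop :=
  ∀ a ∈ A.grading 0, ∃ c : k, a = algebraMap k A.carrier c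

/-- `A` is of finite type if it is finite dimensional in each degree. -/
def FiniteType (A : AugGrAlg.{u} k) : Prop :=
  ∀ n, Module.Finite k (A.grading n)

/-- A Hopf algebra structure (in the sense of graded Hopf algebras in topology) on an augmented
graded-commutative algebra: a comultiplication `A → A ⊗ A`, where `A ⊗ A` carries the
multiplication with the Koszul sign, that is a degree-preserving algebra map and for which the
augmentation is a two-sided counit. Neither coassociativity nor cocommutativity is required (the
cohomology of an H-space need not have them). -/
structure HopfStructure (A : AugGrAlg.{u} k) where
  comul : A.carrier →ₐ[k] A.grading ᵍ⊗[k] A.grading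
  comul_mem : ∀ n, ∀ a ∈ A.grading n,
    (GradedTensorProduct.of k A.grading A.grading).symm (comul a) ∈
      ⨆ ij ∈ Finset.HasAntidiagonal.antidiagonal n,
        Submodule.map₂ (TensorProduct.mk k A.carrier A.carrier) (A.grading ij.1) (A.grading ij.2)
  counit_left : ∀ a, TensorProduct.lid k A.carrier (A.aug.toLinearMap.rTensor A.carrier
    ((GradedTensorProduct.of k A.grading A.grading).symm (comul a))) = a
  counit_right : ∀ a, TensorProduct.rid k A.carrier (A.aug.toLinearMap.lTensor A.carrier
    ((GradedTensorProduct.of k A.grading A.grading).symm (comul a))) = a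

/-- The three kinds of monogenic algebras: polynomial algebras `k[y]`, truncated polynomial algebras
`k[x] / (x ^ (p ^ e))`, and exterior algebras `Λ(z)`. -/
inductive GeneratorKind : Type
  | polynomial : GeneratorKind
  | truncated (e : ℕ) : GeneratorKind
  | exterior : GeneratorKind

/-- The height of a generator: the smallest power of it that vanishes in the monogenic algebra. -/
def GeneratorKind.height (p : ℕ) : GeneratorKind → ℕ∞
  | .polynomial => ⊤
  | .truncated e => ((p ^ e : ℕ) : ℕ∞)
  | .exterior => 2

/-- An expression of the graded-commutative algebra `A` over `𝔽_p` as a tensor product, over an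
ordered index set `ι`, of monogenic algebras with homogeneous generators `gen i` of positive
degree: the ordered monomials `∏ gen i ^ s i` of finite support with exponents `s i` smaller than
the height of `gen i` are a basis of `A`, and `gen i ^ height = 0` if the height is finite.
Truncated polynomial generators have height `p ^ e` with `0 < e < ∞`; for odd `p` polynomial and
truncated polynomial generators have even degree, and exterior generators (of odd degree) occur
only for odd `p`. -/
structure BorelDecomposition {p : ℕ} [Fact p.Prime] (A : AugGrAlg.{u} (ZMod p)) (ι : Type*)
    [LinearOrder ι] where
  kind : ι → GeneratorKind
  deg : ι → ℕ
  gen : ι → A.carrier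
  deg_pos : ∀ i, 0 < deg i
  gen_mem : ∀ i, gen i ∈ A.grading (deg i)
  even_of_polynomial : ∀ i, kind i = .polynomial → p ≠ 2 → Even (deg i)
  pos_of_truncated : ∀ i e, kind i = .truncated e → 0 < e
  even_of_truncated : ∀ i e, kind i = .truncated e → p ≠ 2 → Even (deg i)
  odd_of_exterior : ∀ i, kind i = .exterior → p ≠ 2 ∧ Odd (deg i)
  pow_height : ∀ i, ∀ h : ℕ, (kind i).height p = h → gen i ^ h = 0
  linearIndependent : LinearIndependent (ZMod p)
    fun s : {s : ι →₀ ℕ // ∀ i, (s i : ℕ∞) < (kind i).height p} =>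
      ((s.1.support.sort (· ≤ ·)).map fun i => gen i ^ s.1 i).prod
  span_eq_top : Submodule.span (ZMod p) (Set.range
    fun s : {s : ι →₀ ℕ // ∀ i, (s i : ℕ∞) < (kind i).height p} =>
      ((s.1.support.sort (· ≤ ·)).map fun i => gen i ^ s.1 i).prod) = ⊤

namespace BorelDecomposition

variable {p : ℕ} [Fact p.Prime] {A : AugGrAlg.{u} (ZMod p)} {ι : Type*} [LinearOrder ι]
  (D : A.BorelDecomposition ι)

/-- The class in `QA` of the generator `x_i`. -/
def genClass (i : ι) : A.Indec :=
  A.decomposables.mkQ ⟨D.gen i, A.aug_eq_zero (D.deg_pos i).ne' (D.gen_mem i)⟩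

/-- The truncated polynomial generators: pairs of an index `i` and the exponent `e` for which `x_i`
has height `p ^ e`. -/
def Truncated : Type _ := {ie : ι × ℕ // D.kind ie.1 = .truncated ie.2}

/-- The element `ξ ^ e x_i = x_i ^ (p ^ e)` of the symmetric algebra `S(QA)`, for `x_i` a truncated
polynomial generator of height `p ^ e` (`ξ` is the Frobenius map). -/
noncomputable def frobeniusPower (t : D.Truncated) : GrSymAlg A.indecGrading :=
  GrSymAlg.ι A.indecGrading (D.genClass t.1.1) ^ p ^ t.1.2

/-- The degree `p ^ e · |x_i|` of `ξ ^ e x_i`. -/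
def frobeniusDegree (t : D.Truncated) : ℕ := p ^ t.1.2 * D.deg t.1.1

/-- The degree `m` part of the graded vector space spanned by the elements `ξ ^ e x_i` of `S(QA)`,
with `x_i` running over the truncated polynomial generators. -/
noncomputable def frobeniusSpan (m : ℕ) : Submodule (ZMod p) (GrSymAlg A.indecGrading) :=
  Submodule.span (ZMod p) {a | ∃ t : D.Truncated, D.frobeniusDegree t = m ∧ D.frobeniusPower t = a}

end BorelDecomposition

end

end AugGrAlg

/-!
**Generators.** The proof of Borel's theorem chooses homogeneous generators of `A` one after the
other: each lies in the smallest degree that is not yet generated, and its height is as small as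
possible among the elements that could be chosen instead (`IsNextGenerator`). Ordered monomials
whose exponents stay below the heights ("restricted" monomials) clearly span `A`, and the point is
their linear independence, `linearIndepOn_restricted`. In a linear relation of smallest degree with
last generator `x_m`, apply the comultiplication, and compare the coefficients of a power `x_m ^ i`
in the second factor. The relation becomes one of smaller degree, in which the coefficient of
`x ^ s` has been multiplied by the binomial coefficient `s m choose i`. These must vanish
(`choose_eq_zero_of_contract_comul_eq_zero`), which forces the relation to express a power
`x_m ^ (p ^ j)` through monomials in the earlier generators. The same comparison for powers
`x_l ^ i` with `l` smaller than `m` shows that all exponents in those monomials are divisible by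
`p ^ j` (`pow_dvd_of_pow_eq_sum`). Hence `x_m ^ (p ^ j) = b ^ (p ^ j)` for a polynomial `b` in the
earlier generators, and `x_m - b` would have been a better choice than `x_m`
(`exists_sub_pow_eq_zero`). Only the counit law and multiplicativity of the comultiplication enter,
not coassociativity.

**Degree zero.** Write `[b]` for the generator of `S(I(A))` given by `b`. Up to sign, the class of
`[b c]` in the indecomposables is the boundary of the class of the generator `[[b] [c]]`, because
`[b] [c]` is decomposable. This makes `Q S(I(S(I(A)))) ⟶ Q S(I(A)) ⟶ QA ⟶ 0` exact
(`exists_aqHomology_zero_iso`).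

**Positive degrees.** A Borel decomposition gives a basis of monomials, from which a resolution of
`A` by free algebras is built. For a set `W` with base points `0` and `1`, let `relAlg` be the free
graded-commutative algebra on the generators `x_i` of `A` and elements `y_{t, w}`, for `x_t`
truncated of height `N` and `w` in `W`, subject to `y_{t, 0} = 0` and `y_{t, 1} = x_t ^ N`. Taking
`W` to be the set of monotone maps `[n] → [1]` with the two constant maps as base points gives a
simplicial algebra, `MonogenicBasis.resolution`. Forgetting products, it contracts onto `A`, since
its terms have bases of monomials `x ^ s y ^ m` with `s` below the heights, on which all maps of
sets that preserve `0` act, whether or not they preserve `1` (`MonogenicBasis.contractibleOver`).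
The functor `S(I(-))` depends only on the underlying graded vector space of the augmentation ideal,
so the contraction survives all of its iterates; on the other hand the André-Quillen complex of a
free algebra is exact in positive degrees. Comparing the two augmentations of the resulting double
complex identifies the André-Quillen homology of `A` with the homology of the indecomposables of the
resolution, in the range that is needed (`IsBiresolution.exact_dZ`,
`IsBiresolution.nonempty_homology_equiv`).

**The homology of the indecomposables.** As `N ≥ 2`, the class of `y_{t, 1} = x_t ^ N` is zero.
Extending maps `[n] → [1]` by `0` is therefore a contraction of the indecomposables in positive
degrees, except for the classes of `y_{t, w}` with `w = (0, 1, ⋯, 1)`. These span a complex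
`⋯ ⟶ E ⟶ E` in degrees at least one, with differentials `-1` and `0` in turn, ending with `0`
(`MonogenicBasis.resD_resS`, `MonogenicBasis.resD_resV`). Only the last copy of `E` survives, in
homological degree one, and it has one basis element of degree `N |x_t|` for each `t`. The span of
the `ξ ^ e x_t` has a basis of the same degrees, as functionals on `QA` dual to the truncated
generators, whose degree is even unless `p = 2`, extend to algebra maps on `S(QA)`
(`BorelDecomposition.linearIndependent_frobeniusPower`).
-/

/-! ### Ordered monomials in sign-commuting families -/

section OrderedMonomial

variable {R : Type u} [Ring R] {ι : Type v} [LinearOrder ι]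

/-- The monomial `∏ g i ^ s i`, with the factors in increasing order of their indices. -/
def orderedMonomial (g : ι → R) (s : ι →₀ ℕ) : R :=
  ((s.support.sort (· ≤ ·)).map fun i => g i ^ s i).prod

/-- The elements of the family commute with each other up to sign. -/
def SignCommuting {κ : Type*} (g : κ → R) : Prop :=
  ∀ i j, ∃ c : ℤˣ, g i * g j = c • (g j * g i)

theorem SignCommuting.prod_perm {κ : Type*} {g : κ → R} (hg : SignCommuting g) {L L' : List κ}
    (h : L.Perm L') : ∃ c : ℤˣ, (L.map g).prod = c • (L'.map g).prod := by
  induction h with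
  | nil => exact ⟨1, by simp⟩
  | cons x _ ih =>
    obtain ⟨c, hc⟩ := ih
    exact ⟨c, by rw [List.map_cons, List.prod_cons, hc, List.map_cons, List.prod_cons,
      mul_smul_comm]⟩
  | swap x y l =>
    obtain ⟨c, hc⟩ := hg y x
    exact ⟨c, by
      rw [List.map_cons, List.prod_cons, List.map_cons, List.prod_cons, ← mul_assoc, hc,
        List.map_cons, List.prod_cons, List.map_cons, List.prod_cons, smul_mul_assoc, mul_assoc]⟩
  | trans _ _ h₁ h₂ =>
    obtain ⟨c, hc⟩ := h₁
    obtain ⟨d, hd⟩ := h₂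
    exact ⟨c * d, by rw [hc, hd, smul_smul]⟩

/-- The list of indices, in increasing order and with multiplicities `s`. -/
def indexList (s : ι →₀ ℕ) : List ι :=
  (s.support.sort (· ≤ ·)).flatMap fun i => List.replicate (s i) i

theorem orderedMonomial_eq_prod (g : ι → R) (s : ι →₀ ℕ) :
    orderedMonomial g s = ((indexList s).map g).prod := by
  unfold orderedMonomial indexList
  generalize s.support.sort (· ≤ ·) = L
  induction L with
  | nil => simp
  | cons a L ih => simp [ih]

theorem count_indexList (s : ι →₀ ℕ) (i : ι) : (indexList s).count i = s i := by
  unfold indexList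
  rw [List.count_flatMap]
  have h : ((s.support.sort (· ≤ ·)).map
      (List.count i ∘ fun j => List.replicate (s j) j)).sum =
        ∑ j ∈ s.support, if j = i then s j else 0 := by
    rw [← Finset.sum_map_toList]
    apply List.Perm.sum_eq
    refine ((Finset.sort_perm_toList s.support (· ≤ ·)).map _).trans (List.Perm.of_eq ?_)
    apply List.map_congr_left
    intro j _
    simp [List.count_replicate]
  rw [h, Finset.sum_ite_eq']
  split_ifs with hi
  · rfl
  · exact (Finsupp.notMem_support_iff.mp hi).symm

theorem indexList_add_perm (s t : ι →₀ ℕ) :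
    (indexList s ++ indexList t).Perm (indexList (s + t)) := by
  rw [List.perm_iff_count]
  intro i
  simp [count_indexList]

theorem orderedMonomial_zero (g : ι → R) : orderedMonomial g 0 = 1 := by
  simp [orderedMonomial]

theorem orderedMonomial_single (g : ι → R) (i : ι) (a : ℕ) :
    orderedMonomial g (Finsupp.single i a) = g i ^ a := by
  by_cases ha : a = 0
  · subst ha
    simp [orderedMonomial]
  · simp [orderedMonomial, Finsupp.support_single, ha]

theorem SignCommuting.monomial_mul {g : ι → R} (hg : SignCommuting g) (s t : ι →₀ ℕ) :
    ∃ c : ℤˣ, orderedMonomial g s * orderedMonomial g t = c • orderedMonomial g (s + t) := by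
  obtain ⟨c, hc⟩ := hg.prod_perm (indexList_add_perm s t)
  refine ⟨c, ?_⟩
  rw [orderedMonomial_eq_prod, orderedMonomial_eq_prod, orderedMonomial_eq_prod, ← hc,
    List.map_append, List.prod_append]

theorem SignCommuting.monomial_add {g : ι → R} (hg : SignCommuting g) (s t : ι →₀ ℕ) :
    ∃ c : ℤˣ, orderedMonomial g (s + t) = c • (orderedMonomial g s * orderedMonomial g t) := by
  obtain ⟨c, hc⟩ := hg.monomial_mul s t
  refine ⟨c⁻¹, ?_⟩
  rw [hc, smul_smul, inv_mul_cancel, one_smul]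

theorem SignCommuting.monomial_pow {g : ι → R} (hg : SignCommuting g) (s : ι →₀ ℕ) (n : ℕ) :
    ∃ c : ℤˣ, orderedMonomial g s ^ n = c • orderedMonomial g (n • s) := by
  induction n with
  | zero => exact ⟨1, by simp [orderedMonomial_zero]⟩
  | succ n ih =>
    obtain ⟨c, hc⟩ := ih
    obtain ⟨d, hd⟩ := hg.monomial_mul (n • s) s
    exact ⟨c * d, by rw [pow_succ, hc, smul_mul_assoc, hd, smul_smul, succ_nsmul]⟩

theorem orderedMonomial_eq_zero {g : ι → R} {s : ι →₀ ℕ} {i : ι} (hi : g i ^ s i = 0) :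
    orderedMonomial g s = 0 := by
  rcases subsingleton_or_nontrivial R with _ | _
  · exact Subsingleton.elim _ _
  have hs : i ∈ s.support := by
    rw [Finsupp.mem_support_iff]
    intro h
    rw [h, pow_zero] at hi
    exact one_ne_zero hi
  exact List.prod_eq_zero
    (List.mem_map.mpr ⟨i, (Finset.mem_sort _).mpr hs, hi⟩)

theorem orderedMonomial_map {S F : Type*} [Ring S] [FunLike F R S] [RingHomClass F R S] (f : F)
    (g : ι → R) (s : ι →₀ ℕ) :
    f (orderedMonomial g s) = orderedMonomial (fun i => f (g i)) s := by
  simp [orderedMonomial, map_list_prod, Function.comp_def]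

variable {k : Type} [Field k] [Algebra k R]

theorem units_smul_mem {M : Type*} [AddCommGroup M] [Module k M] (S : Submodule k M)
    (c : ℤˣ) {x : M} (hx : x ∈ S) : c • x ∈ S := by
  rcases Int.units_eq_one_or c with rfl | rfl
  · simpa using hx
  · simpa using hx

theorem neg_one_pow_smul {M : Type*} [AddCommGroup M] [Module k M] (n : ℕ) (x : M) :
    (-1 : k) ^ n • x = ((-1 : ℤˣ) ^ n) • x := by
  rcases Nat.even_or_odd n with h | h
  · simp [h.neg_one_pow]
  · simp [h.neg_one_pow]

theorem SignCommuting.prod_mem_span {g : ι → R} (hg : SignCommuting g) (L : List ι) :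
    ∃ (c : ℤˣ) (s : ι →₀ ℕ), (L.map g).prod = c • orderedMonomial g s ∧ ∀ i ∈ s.support, i ∈ L := by
  let s : ι →₀ ℕ := Multiset.toFinsupp (L : Multiset ι)
  have h : L.Perm (indexList s) := by
    rw [List.perm_iff_count]
    intro i
    simp [count_indexList, s, Multiset.toFinsupp_apply]
  obtain ⟨c, hc⟩ := hg.prod_perm h
  refine ⟨c, s, by rw [hc, orderedMonomial_eq_prod], fun i hi => ?_⟩
  simpa [s] using hi

theorem orderedMonomial_mem_adjoin {g : ι → R} {s : ι →₀ ℕ} {T : Set ι}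
    (hs : ∀ i ∈ s.support, i ∈ T) : orderedMonomial g s ∈ Algebra.adjoin k (g '' T) := by
  apply list_prod_mem
  intro x hx
  obtain ⟨i, hi, rfl⟩ := List.mem_map.mp hx
  exact pow_mem (Algebra.subset_adjoin
    (Set.mem_image_of_mem g (hs i ((Finset.mem_sort _).mp hi)))) _

/-- The subalgebra generated by some members of a sign-commuting family is spanned by the ordered
monomials in them. -/
theorem SignCommuting.adjoin_eq_span {g : ι → R} (hg : SignCommuting g) (T : Set ι) :
    Subalgebra.toSubmodule (Algebra.adjoin k (g '' T)) =
      Submodule.span k (orderedMonomial g '' {s | ∀ i ∈ s.support, i ∈ T}) := by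
  apply le_antisymm
  · rw [Algebra.adjoin_eq_span, Submodule.span_le]
    intro x hx
    obtain ⟨L, hL, rfl⟩ := Submonoid.exists_list_of_mem_closure (SetLike.mem_coe.mp hx)
    obtain ⟨L', rfl, hL'⟩ : ∃ L' : List ι, L'.map g = L ∧ ∀ i ∈ L', i ∈ T := by
      clear hx
      induction L with
      | nil => exact ⟨[], rfl, by simp⟩
      | cons a L ih =>
        obtain ⟨L', rfl, hL'⟩ := ih fun y hy => hL y (List.mem_cons_of_mem _ hy)
        obtain ⟨i, hi, rfl⟩ := hL a List.mem_cons_self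
        exact ⟨i :: L', rfl, by simpa using ⟨hi, hL'⟩⟩
    obtain ⟨c, s, hc, hs⟩ := hg.prod_mem_span L'
    rw [hc]
    exact units_smul_mem _ c (Submodule.subset_span
      (Set.mem_image_of_mem _ fun i hi => hL' i (hs i hi)))
  · rw [Submodule.span_le]
    rintro _ ⟨s, hs, rfl⟩
    exact orderedMonomial_mem_adjoin (T := T) hs

end OrderedMonomial

namespace AugGrAlg

section

variable {k : Type} [Field k] {B : AugGrAlg.{u} k} {ι : Type v} {g : ι → B.carrier} {deg : ι → ℕ}

theorem mul_eq_units_smul {i j : ℕ} {a b : B.carrier} (ha : a ∈ B.grading i)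
    (hb : b ∈ B.grading j) : a * b = ((-1 : ℤˣ) ^ (i * j)) • (b * a) := by
  rw [B.graded_comm ha hb, neg_one_pow_smul]

theorem signCommuting (hg : ∀ i, g i ∈ B.grading (deg i)) : SignCommuting g :=
  fun i j => ⟨_, mul_eq_units_smul (hg i) (hg j)⟩

theorem list_prod_mem_grading {κ : Type*} (L : List κ) (f : κ → B.carrier) (d : κ → ℕ)
    (hf : ∀ i ∈ L, f i ∈ B.grading (d i)) : (L.map f).prod ∈ B.grading (L.map d).sum := by
  induction L with
  | nil => simpa using SetLike.GradedOne.one_mem (A := B.grading)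
  | cons a L ih =>
    simp only [List.map_cons, List.prod_cons, List.sum_cons]
    exact SetLike.GradedMul.mul_mem (hf a List.mem_cons_self)
      (ih fun i hi => hf i (List.mem_cons_of_mem _ hi))

theorem orderedMonomial_mem [LinearOrder ι] (hg : ∀ i, g i ∈ B.grading (deg i)) (s : ι →₀ ℕ) :
    orderedMonomial g s ∈ B.grading (Finsupp.weight deg s) := by
  have h := list_prod_mem_grading (s.support.sort (· ≤ ·)) (fun i => g i ^ s i)
    (fun i => s i * deg i) fun i _ => by
      simpa using SetLike.pow_mem_graded (s i) (hg i)
  unfold orderedMonomial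
  convert h using 2
  rw [Finsupp.weight_apply, Finsupp.sum, ← Finset.sum_map_toList]
  exact ((Finset.sort_perm_toList s.support (· ≤ ·)).map fun i => s i * deg i).sum_eq.symm

/-- The projection of `B` onto its part of degree `n`. -/
noncomputable def proj (B : AugGrAlg.{u} k) (n : ℕ) : B.carrier →ₗ[k] B.carrier :=
  GradedAlgebra.proj B.grading n

theorem proj_of_mem {n : ℕ} {b : B.carrier} (hb : b ∈ B.grading n) : B.proj n b = b := by
  rw [proj, GradedAlgebra.proj_apply, DirectSum.decompose_of_mem_same _ hb]

theorem proj_of_mem_ne {m n : ℕ} {b : B.carrier} (hb : b ∈ B.grading m) (h : m ≠ n) :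
    B.proj n b = 0 := by
  rw [proj, GradedAlgebra.proj_apply, DirectSum.decompose_of_mem_ne _ hb h]

theorem proj_apply_of_mem {m n : ℕ} {b : B.carrier} (hb : b ∈ B.grading m) :
    B.proj n b = if m = n then b else 0 := by
  split_ifs with h
  · exact proj_of_mem (h ▸ hb)
  · exact proj_of_mem_ne hb h

/-- A homogeneous element in the span of homogeneous elements is in the span of those of its
degree. -/
theorem mem_span_of_mem_grading {κ : Type*} {f : κ → B.carrier} {d : κ → ℕ}
    (hf : ∀ i, f i ∈ B.grading (d i)) {T : Set κ} {n : ℕ} {b : B.carrier}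
    (hb : b ∈ B.grading n) (h : b ∈ Submodule.span k (f '' T)) :
    b ∈ Submodule.span k (f '' {i ∈ T | d i = n}) := by
  rw [← proj_of_mem hb]
  clear hb
  induction h using Submodule.span_induction with
  | mem x hx =>
    obtain ⟨i, hi, rfl⟩ := hx
    rw [proj_apply_of_mem (hf i)]
    split_ifs with h
    · exact Submodule.subset_span ⟨i, ⟨hi, h⟩, rfl⟩
    · exact zero_mem _
  | zero => simp
  | add x y _ _ hx hy => rw [map_add]; exact add_mem hx hy
  | smul c x _ hx => rw [map_smul]; exact Submodule.smul_mem _ _ hx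

end

end AugGrAlg

/-! ### The Koszul tensor square -/

namespace AugGrAlg

section KoszulSquare

variable {k : Type} [Field k] (A : AugGrAlg.{u} k)

/-- The tensor square `A ⊗ A`, with the Koszul sign in its multiplication. -/
abbrev KoszulSquare : Type u := A.grading ᵍ⊗[k] A.grading

variable {A}

/-- The pure tensor `a ⊗ b` in `A ⊗ A`. -/
noncomputable def tens (a b : A.carrier) : A.KoszulSquare := a ᵍ⊗ₜ[k] b

/-- The pure tensor, as a bilinear map. -/
noncomputable def tensₗ (A : AugGrAlg.{u} k) : A.carrier →ₗ[k] A.carrier →ₗ[k] A.KoszulSquare :=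
  (TensorProduct.mk k A.carrier A.carrier).compr₂
    (GradedTensorProduct.of k A.grading A.grading).toLinearMap

theorem tens_add (a b c : A.carrier) : tens a (b + c) = tens a b + tens a c :=
  map_add (A.tensₗ a) b c

theorem add_tens (a b c : A.carrier) : tens (a + b) c = tens a c + tens b c :=
  LinearMap.map_add₂ A.tensₗ a b c

theorem smul_tens (c : k) (a b : A.carrier) : tens (c • a) b = c • tens a b :=
  LinearMap.map_smul₂ A.tensₗ c a b

theorem tens_smul (c : k) (a b : A.carrier) : tens a (c • b) = c • tens a b :=
  map_smul (A.tensₗ a) c b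

theorem tens_mul_tens {i j : ℕ} (a : A.carrier) {b a' : A.carrier} (hb : b ∈ A.grading j)
    (ha' : a' ∈ A.grading i) (b' : A.carrier) :
    tens a b * tens a' b' = ((-1 : ℤˣ) ^ (j * i)) • tens (a * a') (b * b') :=
  GradedTensorProduct.tmul_coe_mul_coe_tmul A.grading A.grading a ⟨b, hb⟩ ⟨a', ha'⟩ b'

theorem tens_one_mul (a a' b : A.carrier) : tens a 1 * tens a' b = tens (a * a') b := by
  induction a' using DirectSum.Decomposition.inductionOn A.grading with
  | zero =>
    have h : ∀ x : A.carrier, tens 0 x = 0 := fun x => LinearMap.map_zero₂ A.tensₗ x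
    rw [h, mul_zero, mul_zero, h]
  | homogeneous a' => exact GradedTensorProduct.tmul_one_mul_coe_tmul A.grading A.grading a a' b
  | add x y hx hy => rw [add_tens, mul_add, hx, hy, mul_add, add_tens]

theorem tens_mul_one (a b b' : A.carrier) : tens a b * tens 1 b' = tens a (b * b') := by
  induction b using DirectSum.Decomposition.inductionOn A.grading with
  | zero =>
    have h : ∀ x : A.carrier, tens x 0 = 0 := fun x => map_zero (A.tensₗ x)
    rw [h, zero_mul, zero_mul, h]
  | homogeneous b => exact GradedTensorProduct.tmul_coe_mul_one_tmul A.grading A.grading a b b'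
  | add x y hx hy => rw [tens_add, add_mul, hx, hy, add_mul, tens_add]

theorem tens_one_one : (tens 1 1 : A.KoszulSquare) = 1 := rfl

theorem tens_one_pow (a : A.carrier) (n : ℕ) : (tens a 1) ^ n = tens (a ^ n) 1 := by
  induction n with
  | zero => rw [pow_zero, pow_zero, tens_one_one]
  | succ n ih => rw [pow_succ, ih, tens_one_mul, pow_succ]

theorem one_tens_pow (a : A.carrier) (n : ℕ) : (tens 1 a) ^ n = tens 1 (a ^ n) := by
  induction n with
  | zero => rw [pow_zero, pow_zero, tens_one_one]
  | succ n ih => rw [pow_succ, ih, tens_mul_one, pow_succ]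

/-- Pure tensors `a ⊗ b` of homogeneous elements span `A ⊗ A`. -/
theorem induction_tens {P : A.KoszulSquare → Prop}
    (hom : ∀ (i j : ℕ) (a b : A.carrier), a ∈ A.grading i → b ∈ A.grading j → P (tens a b))
    (zero : P 0) (add : ∀ x y, P x → P y → P (x + y)) (x : A.KoszulSquare) : P x := by
  have h : ∀ y : A.carrier ⊗[k] A.carrier, P (GradedTensorProduct.of k A.grading A.grading y) := by
    intro y
    induction y with
    | zero => rw [map_zero]; exact zero
    | add x y hx hy => rw [map_add]; exact add _ _ hx hy
    | tmul a b =>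
      change P (tens a b)
      induction a using DirectSum.Decomposition.inductionOn A.grading with
      | zero =>
        rw [show tens 0 b = 0 from LinearMap.map_zero₂ A.tensₗ b]
        exact zero
      | add x y hx hy => rw [add_tens]; exact add _ _ hx hy
      | homogeneous a =>
        induction b using DirectSum.Decomposition.inductionOn A.grading with
        | zero =>
          rw [show tens (a : A.carrier) 0 = 0 from map_zero (A.tensₗ (a : A.carrier))]
          exact zero
        | add x y hx hy => rw [tens_add]; exact add _ _ hx hy
        | homogeneous b => exact hom _ _ _ _ a.2 b.2
  exact h ((GradedTensorProduct.of k A.grading A.grading).symm x)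

/-- The map `id ⊗ l : A ⊗ A → A`, for `l` a linear functional on `A`. -/
noncomputable def contract (l : A.carrier →ₗ[k] k) : A.KoszulSquare →ₗ[k] A.carrier :=
  (TensorProduct.rid k A.carrier).toLinearMap ∘ₗ l.lTensor A.carrier ∘ₗ
    (GradedTensorProduct.of k A.grading A.grading).symm.toLinearMap

theorem contract_tens (l : A.carrier →ₗ[k] k) (a b : A.carrier) :
    contract l (tens a b) = l b • a := rfl

/-- The map `l ⊗ id : A ⊗ A → A`, for `l` a linear functional on `A`. -/
noncomputable def contractLeft (l : A.carrier →ₗ[k] k) : A.KoszulSquare →ₗ[k] A.carrier :=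
  (TensorProduct.lid k A.carrier).toLinearMap ∘ₗ l.rTensor A.carrier ∘ₗ
    (GradedTensorProduct.of k A.grading A.grading).symm.toLinearMap

theorem contractLeft_tens (l : A.carrier →ₗ[k] k) (a b : A.carrier) :
    contractLeft l (tens a b) = l a • b := rfl

/-- The part of `A ⊗ A` of total degree `n`. -/
noncomputable def squareGrading (A : AugGrAlg.{u} k) (n : ℕ) : Submodule k A.KoszulSquare :=
  Submodule.span k {x | ∃ (i j : ℕ) (a b : A.carrier),
    a ∈ A.grading i ∧ b ∈ A.grading j ∧ i + j = n ∧ tens a b = x}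

theorem HopfStructure.comul_mem_squareGrading (hopf : A.HopfStructure) {n : ℕ} {a : A.carrier}
    (ha : a ∈ A.grading n) : hopf.comul a ∈ A.squareGrading n := by
  have h : (⨆ ij ∈ Finset.HasAntidiagonal.antidiagonal n,
      Submodule.map₂ (TensorProduct.mk k A.carrier A.carrier) (A.grading ij.1) (A.grading ij.2)) ≤
      (A.squareGrading n).comap (GradedTensorProduct.of k A.grading A.grading).toLinearMap := by
    refine iSup₂_le fun ij hij => Submodule.map₂_le.mpr fun a ha b hb => ?_
    exact Submodule.subset_span
      ⟨_, _, a, b, ha, hb, Finset.HasAntidiagonal.mem_antidiagonal.mp hij, rfl⟩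
  exact h (hopf.comul_mem n a ha)

theorem commute_of_mem_squareGrading {m n : ℕ} (hmn : Even (m * n) ∨ ringChar k = 2)
    {x y : A.KoszulSquare} (hx : x ∈ A.squareGrading m) (hy : y ∈ A.squareGrading n) :
    Commute x y := by
  induction hx using Submodule.span_induction with
  | zero => exact Commute.zero_left _
  | add x x' _ _ hx hx' => exact hx.add_left hx'
  | smul c x _ hx => exact hx.smul_left c
  | mem x hx =>
    obtain ⟨i, j, a, b, ha, hb, rfl, rfl⟩ := hx
    induction hy using Submodule.span_induction with
    | zero => exact Commute.zero_right _
    | add x x' _ _ hx hx' => exact hx.add_right hx'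
    | smul c x _ hx => exact hx.smul_right c
    | mem y hy =>
      obtain ⟨i', j', a', b', ha', hb', rfl, rfl⟩ := hy
      change tens a b * tens a' b' = tens a' b' * tens a b
      have e : tens (a * a') (b * b') =
          (-1 : k) ^ (i * i') • (-1 : k) ^ (j * j') • tens (a' * a) (b' * b) := by
        rw [A.graded_comm ha ha', A.graded_comm hb hb', smul_tens, tens_smul]
      rw [tens_mul_tens a hb ha' b', tens_mul_tens a' hb' ha b, ← neg_one_pow_smul (k := k),
        ← neg_one_pow_smul (k := k), e, smul_smul, smul_smul, ← pow_add, ← pow_add]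
      congr 1
      rcases hmn with h | h
      · have : (-1 : k) ^ (j * i' + i * i' + j * j') * (-1) ^ (j' * i) = 1 := by
          rw [← pow_add]
          refine Even.neg_one_pow ?_
          have e : j * i' + i * i' + j * j' + j' * i = (i + j) * (i' + j') := by ring
          rwa [e]
        have h2 : (-1 : k) ^ (j' * i) * (-1) ^ (j' * i) = 1 := by
          rw [← mul_pow]; simp
        have h3 : (-1 : k) ^ (j' * i) ≠ 0 := pow_ne_zero _ (by simp)
        exact mul_right_cancel₀ h3 (this.trans h2.symm)
      · have : CharP k 2 := h ▸ ringChar.charP k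
        simp [CharTwo.neg_eq]

end KoszulSquare

end AugGrAlg

/-! ### Ideals of `A ⊗ A` spanned by tensors with monomials -/

namespace AugGrAlg

section ExponentIdeal

variable {k : Type} [Field k] {A : AugGrAlg.{u} k} {ι : Type v} [LinearOrder ι]
  {g : ι → A.carrier} {deg : ι → ℕ}

/-- The span in `A ⊗ A` of the tensors `a ⊗ x ^ s`, with `x ^ s` running over the monomials whose
exponents belong to `S`. -/
noncomputable def exponentIdeal (g : ι → A.carrier) (S : Set (ι →₀ ℕ)) :
    Submodule k A.KoszulSquare :=
  Submodule.span k {x | ∃ (i : ℕ) (a : A.carrier) (s : ι →₀ ℕ),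
    a ∈ A.grading i ∧ s ∈ S ∧ tens a (orderedMonomial g s) = x}

variable {S : Set (ι →₀ ℕ)}

theorem tens_mem_exponentIdeal (a : A.carrier) {b : A.carrier}
    (hb : b ∈ Submodule.span k (orderedMonomial g '' S)) : tens a b ∈ exponentIdeal g S := by
  induction a using DirectSum.Decomposition.inductionOn A.grading with
  | zero =>
    rw [show tens 0 b = 0 from LinearMap.map_zero₂ A.tensₗ b]
    exact zero_mem _
  | add x y hx hy => rw [add_tens]; exact add_mem hx hy
  | homogeneous a =>
    induction hb using Submodule.span_induction with
    | zero =>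
      rw [show tens (a : A.carrier) 0 = 0 from map_zero (A.tensₗ (a : A.carrier))]
      exact zero_mem _
    | add x y _ _ hx hy => rw [tens_add]; exact add_mem hx hy
    | smul c x _ hx => rw [tens_smul]; exact Submodule.smul_mem _ _ hx
    | mem x hx =>
      obtain ⟨s, hs, rfl⟩ := hx
      exact Submodule.subset_span ⟨_, _, s, a.2, hs, rfl⟩

theorem mul_orderedMonomial_mem (hg : ∀ i, g i ∈ A.grading (deg i))
    (hspan : Submodule.span k (Set.range (orderedMonomial g)) = ⊤)
    (hS : ∀ s ∈ S, ∀ t, s + t ∈ S) (b : A.carrier) {s : ι →₀ ℕ} (hs : s ∈ S) :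
    b * orderedMonomial g s ∈ Submodule.span k (orderedMonomial g '' S) := by
  have hb : b ∈ Submodule.span k (Set.range (orderedMonomial g)) := hspan ▸ Submodule.mem_top
  induction hb using Submodule.span_induction with
  | zero => rw [zero_mul]; exact zero_mem _
  | add x y _ _ hx hy => rw [add_mul]; exact add_mem hx hy
  | smul c x _ hx => rw [smul_mul_assoc]; exact Submodule.smul_mem _ _ hx
  | mem x hx =>
    obtain ⟨t, rfl⟩ := hx
    obtain ⟨c, hc⟩ := (signCommuting hg).monomial_mul t s
    rw [hc]
    exact units_smul_mem _ c (Submodule.subset_span ⟨t + s, add_comm s t ▸ hS s hs t, rfl⟩)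

theorem orderedMonomial_mul_mem (hg : ∀ i, g i ∈ A.grading (deg i))
    (hspan : Submodule.span k (Set.range (orderedMonomial g)) = ⊤)
    (hS : ∀ s ∈ S, ∀ t, s + t ∈ S) (b : A.carrier) {s : ι →₀ ℕ} (hs : s ∈ S) :
    orderedMonomial g s * b ∈ Submodule.span k (orderedMonomial g '' S) := by
  induction b using DirectSum.Decomposition.inductionOn A.grading with
  | zero => rw [mul_zero]; exact zero_mem _
  | add x y hx hy => rw [mul_add]; exact add_mem hx hy
  | homogeneous b =>
    rw [mul_eq_units_smul (orderedMonomial_mem hg s) b.2]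
    exact units_smul_mem _ _ (mul_orderedMonomial_mem hg hspan hS _ hs)

theorem mul_mem_exponentIdeal (hg : ∀ i, g i ∈ A.grading (deg i))
    (hspan : Submodule.span k (Set.range (orderedMonomial g)) = ⊤)
    (hS : ∀ s ∈ S, ∀ t, s + t ∈ S) (x : A.KoszulSquare) {y : A.KoszulSquare}
    (hy : y ∈ exponentIdeal g S) : x * y ∈ exponentIdeal g S := by
  induction x using induction_tens with
  | zero => rw [zero_mul]; exact zero_mem _
  | add x x' hx hx' => rw [add_mul]; exact add_mem hx hx'
  | hom i j a b ha hb =>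
    induction hy using Submodule.span_induction with
    | zero => rw [mul_zero]; exact zero_mem _
    | add x y _ _ hx hy => rw [mul_add]; exact add_mem hx hy
    | smul c x _ hx => rw [mul_smul_comm]; exact Submodule.smul_mem _ _ hx
    | mem y hy =>
      obtain ⟨i', a', s, ha', hs, rfl⟩ := hy
      rw [tens_mul_tens _ hb ha']
      exact units_smul_mem _ _ (tens_mem_exponentIdeal _ (mul_orderedMonomial_mem hg hspan hS _ hs))

theorem exponentIdeal_mul_mem (hg : ∀ i, g i ∈ A.grading (deg i))
    (hspan : Submodule.span k (Set.range (orderedMonomial g)) = ⊤)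
    (hS : ∀ s ∈ S, ∀ t, s + t ∈ S) (x : A.KoszulSquare) {y : A.KoszulSquare}
    (hy : y ∈ exponentIdeal g S) : y * x ∈ exponentIdeal g S := by
  induction x using induction_tens with
  | zero => rw [mul_zero]; exact zero_mem _
  | add x x' hx hx' => rw [mul_add]; exact add_mem hx hx'
  | hom i j a b ha hb =>
    induction hy using Submodule.span_induction with
    | zero => rw [zero_mul]; exact zero_mem _
    | add x y _ _ hx hy => rw [add_mul]; exact add_mem hx hy
    | smul c x _ hx => rw [smul_mul_assoc]; exact Submodule.smul_mem _ _ hx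
    | mem y hy =>
      obtain ⟨i', a', s, ha', hs, rfl⟩ := hy
      rw [tens_mul_tens _ (orderedMonomial_mem hg s) ha]
      exact units_smul_mem _ _ (tens_mem_exponentIdeal _ (orderedMonomial_mul_mem hg hspan hS _ hs))

theorem contract_eq_zero {l : A.carrier →ₗ[k] k} (hl : ∀ s ∈ S, l (orderedMonomial g s) = 0)
    {x : A.KoszulSquare} (hx : x ∈ exponentIdeal g S) : contract l x = 0 := by
  induction hx using Submodule.span_induction with
  | zero => simp
  | add x y _ _ hx hy => rw [map_add, hx, hy, add_zero]
  | smul c x _ hx => rw [map_smul, hx, smul_zero]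
  | mem y hy =>
    obtain ⟨i', a', s, ha', hs, rfl⟩ := hy
    rw [contract_tens, hl s hs, zero_smul]

section Congruence

variable (hg : ∀ i, g i ∈ A.grading (deg i))
  (hspan : Submodule.span k (Set.range (orderedMonomial g)) = ⊤)
  (hS : ∀ s ∈ S, ∀ t, s + t ∈ S)

include hg hspan hS

theorem mul_sub_mul_mem {x x' y y' : A.KoszulSquare} (hx : x - x' ∈ exponentIdeal g S)
    (hy : y - y' ∈ exponentIdeal g S) : x * y - x' * y' ∈ exponentIdeal g S := by
  have e : x * y - x' * y' = x * (y - y') + (x - x') * y' := by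
    rw [mul_sub, sub_mul]; abel
  rw [e]
  exact add_mem (mul_mem_exponentIdeal hg hspan hS _ hy) (exponentIdeal_mul_mem hg hspan hS _ hx)

theorem pow_sub_pow_mem {x x' : A.KoszulSquare} (hx : x - x' ∈ exponentIdeal g S) (n : ℕ) :
    x ^ n - x' ^ n ∈ exponentIdeal g S := by
  induction n with
  | zero => simp
  | succ n ih =>
    rw [pow_succ, pow_succ]
    exact mul_sub_mul_mem hg hspan hS ih hx

theorem list_prod_sub_mem {κ : Type*} (L : List κ) {f f' : κ → A.KoszulSquare}
    (h : ∀ i ∈ L, f i - f' i ∈ exponentIdeal g S) :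
    (L.map f).prod - (L.map f').prod ∈ exponentIdeal g S := by
  induction L with
  | nil => simp
  | cons a L ih =>
    rw [List.map_cons, List.map_cons, List.prod_cons, List.prod_cons]
    exact mul_sub_mul_mem hg hspan hS (h a List.mem_cons_self)
      (ih fun i hi => h i (List.mem_cons_of_mem _ hi))

end Congruence

/-- The Frobenius is additive on commuting elements, so it takes the span of a set of commuting
elements to any subspace that contains the images of these elements. -/
theorem pow_mem_of_mem_span {p : ℕ} [Fact p.Prime] {R : Type*} [Ring R] [Algebra (ZMod p) R]
    {T : Set R} (hT : ∀ x ∈ T, ∀ y ∈ T, Commute x y) {M : Submodule (ZMod p) R} (j : ℕ)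
    (h : ∀ x ∈ T, x ^ p ^ j ∈ M) {x : R} (hx : x ∈ Submodule.span (ZMod p) T) :
    x ^ p ^ j ∈ M := by
  rcases subsingleton_or_nontrivial R with _ | _
  · rw [Subsingleton.elim (x ^ p ^ j) 0]
    exact zero_mem _
  have hchar : CharP R p := charP_of_injective_algebraMap (algebraMap (ZMod p) R).injective p
  have hcomm : ∀ x ∈ Submodule.span (ZMod p) T, ∀ y ∈ Submodule.span (ZMod p) T,
      Commute x y := by
    intro x hx y hy
    induction hx using Submodule.span_induction with
    | zero => exact Commute.zero_left _
    | add x x' _ _ hx hx' => exact hx.add_left hx'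
    | smul c x _ hx => exact hx.smul_left c
    | mem x hx =>
      induction hy using Submodule.span_induction with
      | zero => exact Commute.zero_right _
      | add x x' _ _ hx hx' => exact hx.add_right hx'
      | smul c x _ hx => exact hx.smul_right c
      | mem y hy => exact hT x hx y hy
  induction hx using Submodule.span_induction with
  | zero =>
    rw [zero_pow (pow_ne_zero _ (Fact.out : p.Prime).ne_zero)]
    exact zero_mem _
  | add x y hx hy hx' hy' =>
    rw [add_pow_char_pow_of_commute (p := p) _ (hcomm x hx y hy)]
    exact add_mem hx' hy'
  | smul c x _ hx =>
    rw [smul_pow]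
    exact Submodule.smul_mem _ _ hx
  | mem x hx => exact h x hx

end ExponentIdeal

end AugGrAlg

/-! ### Binomial coefficients and the comultiplication of monomials -/

/-- This is Lucas' theorem: the base `p` digits of `M % p ^ j` are the last `j` digits of `M`. -/
theorem choose_mod_pow_not_dvd {p : ℕ} [Fact p.Prime] (M j : ℕ) :
    ¬ p ∣ M.choose (M % p ^ j) := by
  have hp : p.Prime := Fact.out
  induction j generalizing M with
  | zero => simpa [Nat.mod_one] using hp.one_lt.ne'
  | succ j ih =>
    intro h
    have h1 := Choose.choose_modEq_choose_mod_mul_choose_div_nat (n := M) (k := M % p ^ (j + 1))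
      (p := p)
    have e1 : M % p ^ (j + 1) % p = M % p :=
      Nat.mod_mod_of_dvd _ (Dvd.intro_left (p ^ j) (pow_succ p j).symm)
    have e2 : M % p ^ (j + 1) / p = M / p % p ^ j := by
      rw [pow_succ', Nat.mod_mul_right_div_self]
    rw [e1, e2, Nat.choose_self, one_mul] at h1
    exact ih _ ((h1.dvd_iff dvd_rfl).mp h)

/-- If all inner binomial coefficients of `M` vanish modulo `p`, then `M` is a power of `p`. -/
theorem exists_eq_pow_of_dvd_choose {p : ℕ} [Fact p.Prime] {M : ℕ} (hM : 0 < M)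
    (h : ∀ i, 0 < i → i < M → p ∣ M.choose i) : ∃ j, M = p ^ j := by
  have hp : p.Prime := Fact.out
  induction M using Nat.strong_induction_on with
  | _ M ih =>
    by_cases h1 : M = 1
    · exact ⟨0, by simpa using h1⟩
    have hdvd : p ∣ M := by
      have := h 1 one_pos (by lia)
      simpa using this
    obtain ⟨M', rfl⟩ := hdvd
    have hM' : 0 < M' := Nat.pos_of_mul_pos_left hM
    obtain ⟨j, hj⟩ := ih M' ((Nat.lt_mul_iff_one_lt_left hM').mpr hp.one_lt) hM' (by
      intro i hi hiM
      have h2 := h (p * i) (Nat.mul_pos hp.pos hi) (Nat.mul_lt_mul_of_pos_left hiM hp.pos)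
      have h1 := Choose.choose_modEq_choose_mod_mul_choose_div_nat (n := p * M') (k := p * i)
        (p := p)
      rw [Nat.mul_mod_right, Nat.mul_mod_right, Nat.choose_self, one_mul,
        Nat.mul_div_cancel_left _ hp.pos, Nat.mul_div_cancel_left _ hp.pos] at h1
      exact (h1.dvd_iff dvd_rfl).mp h2)
    exact ⟨j + 1, by rw [hj, pow_succ']⟩

theorem sum_pow_char_pow_of_commute {p : ℕ} [Fact p.Prime] {R κ : Type*} [Ring R] [CharP R p]
    (F : Finset κ) (y : κ → R) (h : ∀ a ∈ F, ∀ b ∈ F, Commute (y a) (y b)) (j : ℕ) :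
    (∑ a ∈ F, y a) ^ p ^ j = ∑ a ∈ F, y a ^ p ^ j := by
  classical
  induction F using Finset.induction_on with
  | empty => simp [(Fact.out : p.Prime).ne_zero]
  | insert a F ha ih =>
    rw [Finset.sum_insert ha, Finset.sum_insert ha, add_pow_char_pow_of_commute (p := p),
      ih fun a ha b hb => h a (Finset.mem_insert_of_mem ha) b (Finset.mem_insert_of_mem hb)]
    exact Commute.sum_right _ _ _ fun b hb => h a (Finset.mem_insert_self _ _) b
      (Finset.mem_insert_of_mem hb)

namespace AugGrAlg

theorem weight_single_mul {ι : Type*} (deg : ι → ℕ) (l : ι) (i : ℕ) :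
    Finsupp.weight deg (Finsupp.single l i) = i * deg l := by
  rw [Finsupp.weight_single, smul_eq_mul]

theorem weight_eq_zero_iff {ι : Type*} {deg : ι → ℕ} (hpos : ∀ i, 0 < deg i) {s : ι →₀ ℕ} :
    Finsupp.weight deg s = 0 ↔ s = 0 := by
  have : Finsupp.NonTorsionWeight ℕ deg :=
    Finsupp.nonTorsionWeight_of (R := ℕ) deg fun i => (hpos i).ne'
  exact Finsupp.weight_eq_zero_iff_eq_zero deg

section DualBasis

variable {k : Type} [Field k] {A : AugGrAlg.{u} k} {ι : Type v} [LinearOrder ι]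
  {g : ι → A.carrier} {deg : ι → ℕ}

/-- The exponents of the monomials in which the `i`-th exponent is smaller than `q i`. -/
def restricted (q : ι → ℕ∞) : Set (ι →₀ ℕ) := {s | ∀ i, (s i : ℕ∞) < q i}

theorem orderedMonomial_eq_zero_of_notMem {q : ι → ℕ∞}
    (hq : ∀ i, ∀ h : ℕ, q i = h → g i ^ h = 0) {s : ι →₀ ℕ} (hs : s ∉ restricted q) :
    orderedMonomial g s = 0 := by
  simp only [restricted, Set.mem_ofPred_eq, not_forall, not_lt] at hs
  obtain ⟨i, hi⟩ := hs
  obtain ⟨h, hh⟩ := ENat.ne_top_iff_exists.mp (ne_top_of_le_ne_top (ENat.natCast_ne_top _) hi)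
  refine orderedMonomial_eq_zero (i := i) ?_
  rw [← hh, Nat.cast_le] at hi
  exact pow_eq_zero_of_le hi (hq i h hh.symm)

/-- Linear independence of the restricted monomials of degree `n` provides coordinate functionals,
defined on all of `A`. -/
theorem exists_coordinate {q : ι → ℕ∞} (hg : ∀ i, g i ∈ A.grading (deg i))
    (hq : ∀ i, ∀ h : ℕ, q i = h → g i ^ h = 0) {e : ι →₀ ℕ} (he : e ∈ restricted q)
    (hli : LinearIndepOn k (orderedMonomial g)
      {s | s ∈ restricted q ∧ Finsupp.weight deg s = Finsupp.weight deg e}) :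
    ∃ l : A.carrier →ₗ[k] k, ∀ s, l (orderedMonomial g s) = if s = e then 1 else 0 := by
  have h : orderedMonomial g e ∉ Submodule.span k (orderedMonomial g '' {s | s ≠ e}) := by
    intro h
    have h1 := mem_span_of_mem_grading (orderedMonomial_mem hg) (orderedMonomial_mem hg e) h
    refine hli.notMem_span (i := e) ⟨he, rfl⟩ ?_
    refine Submodule.span_le.mpr ?_ h1
    rintro _ ⟨s, ⟨hs, hs'⟩, rfl⟩
    by_cases hsr : s ∈ restricted q
    · exact Submodule.subset_span ⟨s, ⟨⟨hsr, hs'⟩, hs⟩, rfl⟩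
    · rw [orderedMonomial_eq_zero_of_notMem hq hsr]
      exact zero_mem _
  obtain ⟨l, hl, hle⟩ := Submodule.exists_le_ker_of_notMem h
  refine ⟨(l (orderedMonomial g e))⁻¹ • l, fun s => ?_⟩
  rw [LinearMap.smul_apply]
  split_ifs with hs
  · rw [hs, smul_eq_mul, inv_mul_cancel₀ hl]
  · have : orderedMonomial g s ∈ LinearMap.ker l := hle (Submodule.subset_span ⟨s, hs, rfl⟩)
    rw [LinearMap.mem_ker.mp this, smul_zero]

end DualBasis

section Comultiplication

variable {k : Type} [Field k] {A : AugGrAlg.{u} k} {ι : Type v} [LinearOrder ι]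
  {g : ι → A.carrier} {deg : ι → ℕ}

/-- The reduced comultiplication of an element of degree `d` is a combination of tensors of
monomials of degree strictly between `0` and `d`. -/
theorem HopfStructure.comul_sub_mem (hconn : A.Connected) (hopf : A.HopfStructure)
    (hg : ∀ i, g i ∈ A.grading (deg i))
    (hspan : Submodule.span k (Set.range (orderedMonomial g)) = ⊤) {d : ℕ} (hd : d ≠ 0)
    {x : A.carrier} (hx : x ∈ A.grading d) :
    hopf.comul x - tens x 1 - tens 1 x ∈ Submodule.span k
      {y : A.KoszulSquare | ∃ (i : ℕ) (a : A.carrier) (s : ι →₀ ℕ), a ∈ A.grading i ∧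
        0 < Finsupp.weight deg s ∧ Finsupp.weight deg s < d ∧ i + Finsupp.weight deg s = d ∧
        tens a (orderedMonomial g s) = y} := by
  have h := hopf.comul_mem_squareGrading hx
  have h1 : contract A.aug.toLinearMap (hopf.comul x) = x := hopf.counit_right x
  have h2 : contractLeft A.aug.toLinearMap (hopf.comul x) = x := hopf.counit_left x
  rw [show tens x 1 = tens (contract A.aug.toLinearMap (hopf.comul x)) 1 by rw [h1],
    show tens 1 x = tens 1 (contractLeft A.aug.toLinearMap (hopf.comul x)) by rw [h2]]
  clear h1 h2
  generalize hopf.comul x = z at h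
  induction h using Submodule.span_induction with
  | zero =>
    rw [map_zero, map_zero, show tens (0 : A.carrier) 1 = 0 from LinearMap.map_zero₂ A.tensₗ 1,
      show tens (1 : A.carrier) 0 = 0 from map_zero (A.tensₗ 1)]
    simp
  | add x y _ _ hx hy =>
    rw [map_add, map_add, tens_add, add_tens]
    convert add_mem hx hy using 1
    abel
  | smul c x _ hx =>
    rw [map_smul, map_smul, tens_smul, smul_tens, ← smul_sub, ← smul_sub]
    exact Submodule.smul_mem _ _ hx
  | mem z hz =>
    obtain ⟨i, j, a, b, ha, hb, rfl, rfl⟩ := hz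
    rw [contract_tens, contractLeft_tens, smul_tens, tens_smul]
    change tens a b - A.aug b • tens a 1 - A.aug a • tens 1 b ∈ _
    by_cases hj : j = 0
    · subst hj
      obtain ⟨c, rfl⟩ := hconn b hb
      rw [A.aug_eq_zero (n := i) (by lia) ha, zero_smul, sub_zero, AlgHom.commutes,
        Algebra.algebraMap_eq_smul_one, tens_smul, Algebra.algebraMap_self_apply, sub_self]
      exact zero_mem _
    by_cases hi : i = 0
    · subst hi
      obtain ⟨c, rfl⟩ := hconn a ha
      rw [A.aug_eq_zero hj hb, zero_smul, sub_zero, AlgHom.commutes,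
        Algebra.algebraMap_eq_smul_one, smul_tens, Algebra.algebraMap_self_apply, sub_self]
      exact zero_mem _
    rw [A.aug_eq_zero hj hb, A.aug_eq_zero hi ha, zero_smul, zero_smul, sub_zero, sub_zero]
    have hb' : b ∈ Submodule.span k (orderedMonomial g '' Set.univ) := by
      rw [Set.image_univ, hspan]; trivial
    have hb'' := mem_span_of_mem_grading (orderedMonomial_mem hg) hb hb'
    clear hb hb'
    induction hb'' using Submodule.span_induction with
    | zero =>
      rw [show tens a 0 = 0 from map_zero (A.tensₗ a)]
      exact zero_mem _
    | add x y _ _ hx hy => rw [tens_add]; exact add_mem hx hy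
    | smul c x _ hx => rw [tens_smul]; exact Submodule.smul_mem _ _ hx
    | mem b hb =>
      obtain ⟨s, ⟨-, hs⟩, rfl⟩ := hb
      exact Submodule.subset_span ⟨i, a, s, ha, by lia, by lia, by lia, rfl⟩

/-- The exponents of all monomials other than `x_l ^ i` with `i < N`. -/
def avoiding (l : ι) (N : ℕ∞) : Set (ι →₀ ℕ) :=
  {s | ∀ i : ℕ, (i : ℕ∞) < N → s ≠ Finsupp.single l i}

theorem add_mem_avoiding {l : ι} {N : ℕ∞} :
    ∀ s ∈ avoiding l N, ∀ t, s + t ∈ avoiding l N := by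
  intro s hs t i hi h
  have h1 : s ≤ Finsupp.single l i := h ▸ le_self_add
  refine hs (s l) (lt_of_le_of_lt (Nat.cast_le.mpr ?_) hi) ?_
  · simpa using h1 l
  · ext r
    by_cases hr : r = l
    · subst hr; simp
    · have := h1 r
      rw [Finsupp.single_eq_of_ne hr] at this
      rw [Finsupp.single_eq_of_ne hr]
      exact Nat.le_zero.mp this

theorem tens_pow {i j : ℕ} {a b : A.carrier} (ha : a ∈ A.grading i) (hb : b ∈ A.grading j)
    (n : ℕ) : ∃ c : ℤˣ, (tens a b) ^ n = c • tens (a ^ n) (b ^ n) := by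
  induction n with
  | zero => exact ⟨1, by simp only [pow_zero, one_smul]; rfl⟩
  | succ n ih =>
    obtain ⟨c, hc⟩ := ih
    refine ⟨c * (-1) ^ (n • j * i), ?_⟩
    rw [pow_succ, hc, smul_mul_assoc, tens_mul_tens _ (SetLike.pow_mem_graded n hb) ha, smul_smul,
      pow_succ, pow_succ]

section

variable (hconn : A.Connected) (hopf : A.HopfStructure) (hg : ∀ i, g i ∈ A.grading (deg i))
  (hpos : ∀ i, 0 < deg i) (hspan : Submodule.span k (Set.range (orderedMonomial g)) = ⊤)

include hconn hg hpos hspan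

/-- Modulo the tensors `a ⊗ x ^ s` with `x ^ s` not a power of `x_l`, the generators whose degree is
at most that of `x_l` are primitive. -/
theorem comul_gen_sub_mem {l r : ι} (hr : deg r ≤ deg l) (N : ℕ∞) :
    hopf.comul (g r) - (tens (g r) 1 + tens 1 (g r)) ∈ exponentIdeal g (avoiding l N) := by
  have h := hopf.comul_sub_mem hconn hg hspan (hpos r).ne' (hg r)
  rw [sub_sub] at h
  refine Submodule.span_le.mpr ?_ h
  rintro _ ⟨i, a, s, ha, hs, hs', -, rfl⟩
  refine Submodule.subset_span ⟨i, a, s, ha, ?_, rfl⟩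
  rintro n - rfl
  rw [weight_single_mul] at hs hs'
  rcases Nat.eq_zero_or_pos n with rfl | hn
  · simp at hs
  · have : deg l ≤ n * deg l := Nat.le_mul_of_pos_left _ hn
    lia

theorem comul_gen_sub_mem_of_ne {l r : ι} (hr : deg r ≤ deg l) (hrl : r ≠ l) (N : ℕ∞) :
    hopf.comul (g r) - tens (g r) 1 ∈ exponentIdeal g (avoiding l N) := by
  have h : tens 1 (g r) ∈ exponentIdeal g (avoiding l N) := by
    refine tens_mem_exponentIdeal 1 (Submodule.subset_span ⟨Finsupp.single r 1, ?_, ?_⟩)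
    · intro n _ h
      have := DFunLike.congr_fun h r
      rw [Finsupp.single_eq_same, Finsupp.single_eq_of_ne hrl] at this
      exact one_ne_zero this
    · rw [orderedMonomial_single, pow_one]
  convert add_mem (comul_gen_sub_mem hconn hopf hg hpos hspan hr N) h using 1
  abel

end

/-- The value of `id ⊗ l` on `(b ⊗ 1) (x ⊗ 1 + 1 ⊗ x) ^ a`, for `l` the functional that picks the
coefficient of `x ^ i`. -/
theorem contract_mul_pow {d : ℕ} {x : A.carrier} (hx : x ∈ A.grading d) (b : A.carrier) {a i : ℕ}
    (hd : Even d ∨ ringChar k = 2 ∨ a ≤ 1) {l : A.carrier →ₗ[k] k}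
    (hl : ∀ n, l (x ^ n) = if n = i then 1 else 0) :
    contract l (tens b 1 * (tens x 1 + tens 1 x) ^ a) =
      (a.choose i : k) • (b * x ^ (a - i)) := by
  have hl0 : l 1 = if 0 = i then 1 else 0 := by simpa using hl 0
  have hl1 : l x = if 1 = i then 1 else 0 := by simpa using hl 1
  by_cases ha : a ≤ 1
  · interval_cases a
    · rw [pow_zero, mul_one, contract_tens, hl0]
      rcases i with _ | i
      · simp
      · simp
    · rw [pow_one, mul_add, tens_one_mul, tens_one_mul, mul_one, map_add, contract_tens,
        contract_tens, hl0, hl1]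
      rcases i with _ | _ | i
      · simp
      · simp
      · simp [Nat.choose_eq_zero_of_lt]
  have hc : Commute (tens x 1 : A.KoszulSquare) (tens 1 x) := by
    refine commute_of_mem_squareGrading (m := d) (n := d) ?_
      (Submodule.subset_span ⟨d, 0, x, 1, hx, SetLike.GradedOne.one_mem, by simp, rfl⟩)
      (Submodule.subset_span ⟨0, d, 1, x, SetLike.GradedOne.one_mem, hx, by simp, rfl⟩)
    rcases hd with h | h | h
    · exact Or.inl (h.mul_left _)
    · exact Or.inr h
    · exact absurd h ha
  rw [hc.add_pow, Finset.mul_sum, map_sum]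
  have e : ∀ m ∈ Finset.range (a + 1), contract l (tens b 1 * ((tens x 1) ^ m * (tens 1 x) ^ (a - m) *
      (a.choose m : A.KoszulSquare))) = if a - m = i then (a.choose m : k) • (b * x ^ m) else 0 := by
    intro m _
    rw [tens_one_pow, one_tens_pow, tens_one_mul, mul_one, ← mul_assoc, tens_one_mul,
      ← Nat.cast_comm, ← nsmul_eq_mul, map_nsmul, contract_tens, hl, ite_smul, one_smul, zero_smul,
      smul_ite, smul_zero, Nat.cast_smul_eq_nsmul]
  rw [Finset.sum_congr rfl e]
  by_cases hi : i ≤ a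
  · rw [Finset.sum_eq_single (a - i)]
    · rw [if_pos (by lia), Nat.choose_symm hi]
    · intro m hm hne
      rw [if_neg]
      have := Finset.mem_range.mp hm
      lia
    · intro h
      exact absurd (Finset.mem_range.mpr (by lia)) h
  · rw [Nat.choose_eq_zero_of_lt (by lia), Nat.cast_zero, zero_smul]
    refine Finset.sum_eq_zero fun m _ => if_neg ?_
    lia

end Comultiplication

end AugGrAlg

/-! ### Comparing coefficients under the comultiplication -/

namespace AugGrAlg

theorem map_units_smul_of_addMonoidHomClass {M N F : Type*} [AddCommGroup M] [AddCommGroup N]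
    [FunLike F M N] [AddMonoidHomClass F M N] (f : F) (c : ℤˣ) (x : M) : f (c • x) = c • f x := by
  rcases Int.units_eq_one_or c with rfl | rfl <;> simp

section Coefficients

variable {k : Type} [Field k] {A : AugGrAlg.{u} k} {ι : Type v} [LinearOrder ι]
  {g : ι → A.carrier} {deg : ι → ℕ}

/-- Comparing coefficients of `x_l ^ i` in the second factor of `A ⊗ A`, on a single monomial. -/
theorem contract_comul_orderedMonomial (hconn : A.Connected) (hopf : A.HopfStructure)
    (hg : ∀ i, g i ∈ A.grading (deg i)) (hpos : ∀ i, 0 < deg i)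
    (hspan : Submodule.span k (Set.range (orderedMonomial g)) = ⊤) {l : ι} {i : ℕ} {N : ℕ∞}
    (hiN : (i : ℕ∞) < N) {φ : A.carrier →ₗ[k] k}
    (hφ : ∀ s, φ (orderedMonomial g s) = if s = Finsupp.single l i then 1 else 0)
    {s : ι →₀ ℕ} (hpar : Even (deg l) ∨ ringChar k = 2 ∨ s l ≤ 1)
    (hΔ : ∀ r, r ≠ l →
      hopf.comul (g r) ^ s r - tens (g r ^ s r) 1 ∈ exponentIdeal g (avoiding l N)) :
    ∃ c : ℤˣ, contract φ (hopf.comul (orderedMonomial g s)) =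
      c • ((s l).choose i : k) • orderedMonomial g (s - Finsupp.single l i) := by
  have hS := add_mem_avoiding (l := l) (N := N)
  have hφ' : ∀ t ∈ avoiding l N, φ (orderedMonomial g t) = 0 := fun t ht => by
    rw [hφ, if_neg (ht i hiN)]
  have hφpow : ∀ n, φ (g l ^ n) = if n = i then 1 else 0 := by
    intro n
    rw [← orderedMonomial_single, hφ]
    simp only [(Finsupp.single_injective l).eq_iff]
  obtain ⟨c, hc⟩ := (signCommuting hg).monomial_add (s.erase l) (Finsupp.single l (s l))
  rw [Finsupp.erase_add_single, orderedMonomial_single] at hc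
  have h1 : hopf.comul (orderedMonomial g (s.erase l)) - tens (orderedMonomial g (s.erase l)) 1 ∈
      exponentIdeal g (avoiding l N) := by
    have e : tens (orderedMonomial g (s.erase l)) 1 = (((s.erase l).support.sort (· ≤ ·)).map
        fun r => (tens (g r ^ s.erase l r) 1 : A.KoszulSquare)).prod := by
      have := map_list_prod (GradedTensorProduct.includeLeft A.grading A.grading)
        (((s.erase l).support.sort (· ≤ ·)).map fun r => g r ^ s.erase l r)
      rw [List.map_map] at this
      exact this
    rw [e, orderedMonomial, map_list_prod, List.map_map]
    refine list_prod_sub_mem hg hspan hS _ fun r hr => ?_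
    have hr' : r ≠ l := by
      rintro rfl
      simp at hr
    rw [Function.comp_apply, map_pow, Finsupp.erase_ne hr']
    exact hΔ r hr'
  have h2 := mul_sub_mul_mem hg hspan hS h1 (pow_sub_pow_mem hg hspan hS
    (comul_gen_sub_mem hconn hopf hg hpos hspan (le_refl (deg l)) N) (s l))
  have h3 := contract_eq_zero hφ' h2
  rw [map_sub, sub_eq_zero, contract_mul_pow (hg l) _ hpar hφpow] at h3
  have h4 : contract φ (hopf.comul (orderedMonomial g s)) =
      c • ((s l).choose i : k) • (orderedMonomial g (s.erase l) * g l ^ (s l - i)) := by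
    rw [hc, map_units_smul_of_addMonoidHomClass, map_units_smul_of_addMonoidHomClass, map_mul,
      map_pow, h3]
  obtain ⟨c', hc'⟩ := (signCommuting hg).monomial_mul (s.erase l) (Finsupp.single l (s l - i))
  have e : s.erase l + Finsupp.single l (s l - i) = s - Finsupp.single l i := by
    ext r
    by_cases hr : r = l
    · subst hr; simp
    · simp [hr]
  rw [orderedMonomial_single, e] at hc'
  refine ⟨c * c', ?_⟩
  rw [h4, hc', smul_comm _ c', smul_smul]

/-- Comparing coefficients of `x_l ^ i` in the second factor of `A ⊗ A`, on a combination of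
monomials of the same degree. -/
theorem choose_eq_zero_of_contract_comul_eq_zero (hconn : A.Connected) (hopf : A.HopfStructure)
    (hg : ∀ i, g i ∈ A.grading (deg i)) (hpos : ∀ i, 0 < deg i)
    (hspan : Submodule.span k (Set.range (orderedMonomial g)) = ⊤) {q : ι → ℕ∞} {n : ℕ}
    (ih : ∀ e ∈ restricted q, Finsupp.weight deg e < n →
      ∃ φ : A.carrier →ₗ[k] k, ∀ s, φ (orderedMonomial g s) = if s = e then 1 else 0)
    {F : Finset (ι →₀ ℕ)} (hF : ∀ s ∈ F, s ∈ restricted q ∧ Finsupp.weight deg s = n)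
    (c : (ι →₀ ℕ) → k) {l : ι} {i : ℕ} {N : ℕ∞} (hi : 0 < i)
    (hiN : (i : ℕ∞) < N) {φ : A.carrier →ₗ[k] k}
    (hφ : ∀ s, φ (orderedMonomial g s) = if s = Finsupp.single l i then 1 else 0)
    (hpar : ∀ s ∈ F, Even (deg l) ∨ ringChar k = 2 ∨ s l ≤ 1)
    (hΔ : ∀ s ∈ F, ∀ r, r ≠ l →
      hopf.comul (g r) ^ s r - tens (g r ^ s r) 1 ∈ exponentIdeal g (avoiding l N))
    (hzero : contract φ (hopf.comul (∑ s ∈ F, c s • orderedMonomial g s)) = 0)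
    {s : ι →₀ ℕ} (hs : s ∈ F) (hil : i ≤ s l) (hcs : c s ≠ 0) : ((s l).choose i : k) = 0 := by
  have h : ∀ s, ∃ u : ℤˣ, s ∈ F → contract φ (hopf.comul (orderedMonomial g s)) =
      u • ((s l).choose i : k) • orderedMonomial g (s - Finsupp.single l i) := by
    intro s
    by_cases hs : s ∈ F
    · obtain ⟨u, hu⟩ := contract_comul_orderedMonomial hconn hopf hg hpos hspan hiN hφ (hpar s hs)
        (hΔ s hs)
      exact ⟨u, fun _ => hu⟩
    · exact ⟨1, fun h => absurd h hs⟩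
  choose u hu using h
  have hle : Finsupp.single l i ≤ s := Finsupp.single_le_iff.mpr hil
  obtain ⟨ψ, hψ⟩ := ih (s - Finsupp.single l i)
    (fun r => lt_of_le_of_lt (Nat.cast_le.mpr (by simp)) ((hF s hs).1 r)) (by
      have h1 := congr_arg (Finsupp.weight deg) (tsub_add_cancel_of_le hle)
      rw [map_add, (hF s hs).2, weight_single_mul] at h1
      have := Nat.mul_pos hi (hpos l)
      lia)
  have h1 := congr_arg ψ hzero
  rw [map_sum, map_sum, map_sum, map_zero, Finset.sum_eq_single s] at h1
  · rw [map_smul, map_smul, hu s hs, map_smul, map_units_smul_of_addMonoidHomClass, map_smul, hψ,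
      if_pos rfl, smul_eq_mul, smul_eq_mul, mul_one] at h1
    have h2 := (mul_eq_zero.mp h1).resolve_left hcs
    rcases Int.units_eq_one_or (u s) with h | h
    · simpa [h] using h2
    · simpa [h] using h2
  · intro t ht hts
    rw [map_smul, map_smul, hu t ht, map_smul, map_units_smul_of_addMonoidHomClass, map_smul, hψ]
    by_cases hit : i ≤ t l
    · rw [if_neg]
      · simp
      · intro h
        apply hts
        rw [← tsub_add_cancel_of_le hle, ← h,
          tsub_add_cancel_of_le (Finsupp.single_le_iff.mpr hit)]
    · simp [Nat.choose_eq_zero_of_lt (by lia : t l < i)]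
  · exact fun h => absurd hs h

end Coefficients

end AugGrAlg

/-! ### Linear independence of restricted monomials -/

namespace AugGrAlg

section LinearIndependence

variable {p : ℕ} [Fact p.Prime] {A : AugGrAlg.{u} (ZMod p)} {ι : Type v} [LinearOrder ι]
  {g : ι → A.carrier} {deg : ι → ℕ}

theorem carrier_nontrivial {k : Type} [Field k] (A : AugGrAlg.{u} k) : Nontrivial A.carrier :=
  ⟨1, 0, fun h => one_ne_zero (α := k) (by rw [← map_one A.aug, h, map_zero])⟩

theorem units_smul_pow_char_pow {R : Type*} [Ring R] [Algebra (ZMod p) R] (c : ℤˣ) (x : R) (j : ℕ) :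
    (c • x) ^ p ^ j = c • x ^ p ^ j := by
  rcases Int.units_eq_one_or c with rfl | rfl
  · simp
  · have h := smul_pow (-1 : ZMod p) x (p ^ j)
    rw [ZMod.pow_card_pow] at h
    simpa using h

/-- If `x_m ^ (p ^ j)` is a combination of monomials in other generators of degree at most that of
`x_m`, then all exponents in it are divisible by `p ^ j`. -/
theorem pow_dvd_of_pow_eq_sum (hconn : A.Connected) (hopf : A.HopfStructure)
    (hg : ∀ i, g i ∈ A.grading (deg i)) (hpos : ∀ i, 0 < deg i)
    (hspan : Submodule.span (ZMod p) (Set.range (orderedMonomial g)) = ⊤)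
    (hmono : ∀ i j, i ≤ j → deg i ≤ deg j) {q : ι → ℕ∞} (hq1 : ∀ i, 1 < q i)
    (hqodd : ∀ i, ¬ (Even (deg i) ∨ p = 2) → q i = 2) {m : ι} {j : ℕ}
    (hm : j = 0 ∨ Even (deg m) ∨ p = 2)
    (ih : ∀ e ∈ restricted q, Finsupp.weight deg e < p ^ j * deg m →
      ∃ φ : A.carrier →ₗ[ZMod p] ZMod p, ∀ s, φ (orderedMonomial g s) = if s = e then 1 else 0)
    {F : Finset (ι →₀ ℕ)}
    (hF : ∀ s ∈ F, s ∈ restricted q ∧ Finsupp.weight deg s = p ^ j * deg m)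
    (hFm : ∀ s ∈ F, ∀ r ∈ s.support, r < m)
    {c : (ι →₀ ℕ) → ZMod p} (hc : ∀ s ∈ F, c s ≠ 0)
    (hsum : g m ^ p ^ j = ∑ s ∈ F, c s • orderedMonomial g s) :
    ∀ s ∈ F, ∀ r, p ^ j ∣ s r := by
  classical
  have hp : p.Prime := Fact.out
  by_contra! hbad
  let U : Finset ι := (F.biUnion Finsupp.support).filter fun l => ∃ s ∈ F, ¬ p ^ j ∣ s l
  have hU : ∀ l, (∃ s ∈ F, ¬ p ^ j ∣ s l) → l ∈ U := by
    rintro l ⟨s, hs, hl⟩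
    refine Finset.mem_filter.mpr ⟨Finset.mem_biUnion.mpr ⟨s, hs, ?_⟩, s, hs, hl⟩
    rw [Finsupp.mem_support_iff]
    intro h
    exact hl (h ▸ dvd_zero _)
  have hne : U.Nonempty := by
    obtain ⟨s, hs, r, hr⟩ := hbad
    exact ⟨r, hU r ⟨s, hs, hr⟩⟩
  -- `l` is the largest index for which divisibility fails.
  let l := U.max' hne
  obtain ⟨-, s, hs, hsl⟩ := Finset.mem_filter.mp (U.max'_mem hne)
  change ¬ p ^ j ∣ s l at hsl
  have hgt : ∀ t ∈ F, ∀ r, l < r → p ^ j ∣ t r := by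
    intro t ht r hr
    by_contra h
    exact absurd (U.le_max' r (hU r ⟨t, ht, h⟩)) (not_le.mpr hr)
  have hpj : 0 < p ^ j := pow_pos hp.pos j
  let i := s l % p ^ j
  have hi : 0 < i := Nat.pos_of_ne_zero fun h => hsl (Nat.dvd_of_mod_eq_zero h)
  have hij : i < p ^ j := Nat.mod_lt _ hpj
  have hil : i ≤ s l := Nat.mod_le _ _
  have hslm : l < m := hFm s hs l (Finsupp.mem_support_iff.mpr (by lia))
  have hlm : deg l ≤ deg m := hmono l m hslm.le
  obtain ⟨φ, hφ⟩ := ih (Finsupp.single l i) (by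
      intro r
      by_cases hr : r = l
      · subst hr
        rw [Finsupp.single_eq_same]
        exact lt_of_le_of_lt (Nat.cast_le.mpr hil) ((hF s hs).1 _)
      · rw [Finsupp.single_eq_of_ne hr]
        exact lt_trans (by simp) (hq1 r)) (by
      rw [weight_single_mul]
      calc i * deg l ≤ i * deg m := Nat.mul_le_mul_left _ hlm
        _ < p ^ j * deg m := Nat.mul_lt_mul_of_pos_right hij (hpos m))
  have hS := add_mem_avoiding (l := l) (N := ((p ^ j : ℕ) : ℕ∞))
  -- The Frobenius kills the part of the comultiplication that involves the other generators.
  have hfrob : ∀ r, j = 0 ∨ Even (deg r) ∨ p = 2 →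
      hopf.comul (g r) ^ p ^ j - tens (g r ^ p ^ j) 1 ∈
        exponentIdeal g (avoiding l ((p ^ j : ℕ) : ℕ∞)) := by
    intro r hr
    let T : Set A.KoszulSquare := {y | ∃ (i : ℕ) (a : A.carrier) (s : ι →₀ ℕ),
      a ∈ A.grading i ∧ s ≠ 0 ∧ i + Finsupp.weight deg s = deg r ∧
      tens a (orderedMonomial g s) = y}
    have hT : hopf.comul (g r) - tens (g r) 1 ∈ Submodule.span (ZMod p) T := by
      have h1 := hopf.comul_sub_mem hconn hg hspan (hpos r).ne' (hg r)
      have h2 : tens 1 (g r) ∈ Submodule.span (ZMod p) T :=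
        Submodule.subset_span ⟨0, 1, Finsupp.single r 1, SetLike.GradedOne.one_mem, by simp,
          by rw [weight_single_mul, zero_add, one_mul], by rw [orderedMonomial_single, pow_one]⟩
      have h3 := add_mem (Submodule.span_mono ?_ h1) h2
      · rw [sub_add_cancel] at h3
        exact h3
      · rintro _ ⟨i, a, s, ha, hs, -, hs', rfl⟩
        exact ⟨i, a, s, ha, by rintro rfl; simp at hs, hs', rfl⟩
    have hTsq : T ⊆ A.squareGrading (deg r) := by
      rintro _ ⟨i, a, s, ha, -, hs', rfl⟩
      exact Submodule.subset_span ⟨i, _, a, _, ha, orderedMonomial_mem hg s, hs', rfl⟩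
    have hpow : ∀ y ∈ T, y ^ p ^ j ∈ exponentIdeal g (avoiding l ((p ^ j : ℕ) : ℕ∞)) := by
      rintro _ ⟨i, a, s, ha, hs, -, rfl⟩
      obtain ⟨u, hu⟩ := tens_pow ha (orderedMonomial_mem hg s) (p ^ j)
      obtain ⟨u', hu'⟩ := (signCommuting hg).monomial_pow s (p ^ j)
      rw [hu]
      refine units_smul_mem _ _ (tens_mem_exponentIdeal _ ?_)
      rw [hu']
      refine units_smul_mem _ _ (Submodule.subset_span ⟨_, ?_, rfl⟩)
      intro n hn h
      apply hs
      ext t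
      have h1 := DFunLike.congr_fun h t
      rw [Finsupp.smul_apply, smul_eq_mul] at h1
      by_cases ht : t = l
      · rw [ht, Finsupp.single_eq_same] at h1
        rw [Nat.cast_lt] at hn
        rw [ht]
        by_contra h2
        have := Nat.le_mul_of_pos_right (p ^ j) (Nat.pos_of_ne_zero h2)
        lia
      · rw [Finsupp.single_eq_of_ne ht] at h1
        simpa [hp.ne_zero] using h1
    have hchar : ringChar (ZMod p) = p := ZMod.ringChar_zmod_n p
    rcases hr with rfl | hr
    · rw [pow_zero, pow_one, pow_one]
      refine Submodule.span_le.mpr (fun y hy => ?_) hT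
      simpa using hpow y hy
    have hcomm : ∀ x ∈ A.squareGrading (deg r), ∀ y ∈ A.squareGrading (deg r), Commute x y := by
      intro x hx y hy
      refine commute_of_mem_squareGrading ?_ hx hy
      rcases hr with hr | hr
      · exact Or.inl (hr.mul_left _)
      · exact Or.inr (hchar.trans hr)
    have hmem := pow_mem_of_mem_span (fun x hx y hy => hcomm x (hTsq hx) y (hTsq hy)) j hpow hT
    have : Nontrivial A.carrier := A.carrier_nontrivial
    have : Nontrivial A.KoszulSquare :=
      ⟨1, 0, fun h => by
        have h1 := congr_arg (contract A.aug.toLinearMap) h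
        rw [← tens_one_one, contract_tens, map_zero] at h1
        simp at h1⟩
    have : CharP A.KoszulSquare p :=
      charP_of_injective_algebraMap (algebraMap (ZMod p) A.KoszulSquare).injective p
    rwa [sub_pow_char_pow_of_commute (p := p) _
      (hcomm _ (hopf.comul_mem_squareGrading (hg r)) _
        (Submodule.subset_span ⟨_, 0, _, 1, hg r, SetLike.GradedOne.one_mem, by simp, rfl⟩)),
      tens_one_pow] at hmem
  have hone : φ 1 = 0 := by
    have := hφ 0
    rw [orderedMonomial_zero, if_neg] at this
    · exact this
    · intro h
      have := DFunLike.congr_fun h l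
      rw [Finsupp.single_eq_same] at this
      exact hi.ne this
  have hzero : contract φ (hopf.comul (∑ s ∈ F, c s • orderedMonomial g s)) = 0 := by
    rw [← hsum, map_pow]
    have h1 := contract_eq_zero (l := φ) (g := g) (S := avoiding l ((p ^ j : ℕ) : ℕ∞)) (fun t ht => by
      rw [hφ, if_neg (ht i (Nat.cast_lt.mpr hij))]) (hfrob m hm)
    rwa [map_sub, contract_tens, hone, zero_smul, sub_zero] at h1
  have key := choose_eq_zero_of_contract_comul_eq_zero hconn hopf hg hpos hspan ih hF c hi
    (N := ((p ^ j : ℕ) : ℕ∞)) (Nat.cast_lt.mpr hij) hφ ?_ ?_ hzero hs hil (hc s hs)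
  · rw [ZMod.natCast_eq_zero_iff] at key
    exact choose_mod_pow_not_dvd (s l) j key
  · intro t ht
    by_cases h : Even (deg l) ∨ p = 2
    · rcases h with h | h
      · exact Or.inl h
      · exact Or.inr (Or.inl ((ZMod.ringChar_zmod_n p).trans h))
    · refine Or.inr (Or.inr ?_)
      have := (hF t ht).1 l
      rw [hqodd l h] at this
      exact Nat.lt_succ_iff.mp (by exact_mod_cast this)
  · intro t ht r hr
    rcases lt_or_gt_of_ne hr with hr | hr
    · have h1 := comul_gen_sub_mem_of_ne hconn hopf hg hpos hspan (hmono r l hr.le) hr.ne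
        ((p ^ j : ℕ) : ℕ∞)
      rw [← tens_one_pow]
      exact pow_sub_pow_mem hg hspan hS h1 _
    · obtain ⟨a, ha⟩ := hgt t ht r hr
      by_cases ha0 : a = 0
      · rw [ha, ha0, mul_zero, pow_zero, pow_zero, tens_one_one, sub_self]
        exact zero_mem _
      have hr' : j = 0 ∨ Even (deg r) ∨ p = 2 := by
        by_contra! h
        have h1 := (hF t ht).1 r
        rw [hqodd r (by tauto), ha] at h1
        have h2 : p ^ j * a < 2 := by exact_mod_cast h1
        have h3 : 2 ≤ p ^ j := le_trans hp.two_le (Nat.le_self_pow h.1 p)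
        have h4 := Nat.mul_le_mul h3 (Nat.one_le_iff_ne_zero.mpr ha0)
        lia
      rw [ha, pow_mul, pow_mul, ← tens_one_pow _ a]
      exact pow_sub_pow_mem hg hspan hS (hfrob r hr') _

/-- If `x_m ^ (p ^ j)` were a combination of the other restricted monomials in a smallest possible
degree, it would be the `p ^ j`-th power of a combination `b` of monomials in the earlier
generators. -/
theorem exists_sub_pow_eq_zero (hg : ∀ i, g i ∈ A.grading (deg i)) {m : ι} {j : ℕ}
    (hm : j = 0 ∨ Even (deg m) ∨ p = 2) {F : Finset (ι →₀ ℕ)}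
    (hF : ∀ s ∈ F, Finsupp.weight deg s = p ^ j * deg m)
    (hFm : ∀ s ∈ F, ∀ r ∈ s.support, r < m) {c : (ι →₀ ℕ) → ZMod p}
    (hsum : g m ^ p ^ j = ∑ s ∈ F, c s • orderedMonomial g s)
    (hdvd : ∀ s ∈ F, ∀ r, p ^ j ∣ s r) :
    ∃ b ∈ A.grading (deg m), b ∈ Algebra.adjoin (ZMod p) (g '' Set.Iio m) ∧
      (g m - b) ^ p ^ j = 0 := by
  have hp : p.Prime := Fact.out
  have hpj : 0 < p ^ j := pow_pos hp.pos j
  let root : (ι →₀ ℕ) → (ι →₀ ℕ) := fun s => s.mapRange (· / p ^ j) (Nat.zero_div _)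
  have hroot : ∀ s ∈ F, p ^ j • root s = s := by
    intro s hs
    ext r
    simp only [root, Finsupp.smul_apply, Finsupp.mapRange_apply, smul_eq_mul]
    exact Nat.mul_div_cancel' (hdvd s hs r)
  have hsign : ∀ s, ∃ u : ℤˣ, s ∈ F →
      orderedMonomial g s = u • orderedMonomial g (root s) ^ p ^ j := by
    intro s
    by_cases hs : s ∈ F
    · obtain ⟨u, hu⟩ := (signCommuting hg).monomial_pow (root s) (p ^ j)
      rw [hroot s hs] at hu
      exact ⟨u⁻¹, fun _ => by rw [hu, smul_smul, inv_mul_cancel, one_smul]⟩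
    · exact ⟨1, fun h => absurd h hs⟩
  choose u hu using hsign
  have hmem : ∀ s ∈ F, c s • u s • orderedMonomial g (root s) ∈ A.grading (deg m) := by
    intro s hs
    refine Submodule.smul_mem _ _ (units_smul_mem _ _ ?_)
    have h1 := hF s hs
    rw [← hroot s hs, map_nsmul, smul_eq_mul] at h1
    have h2 := orderedMonomial_mem hg (root s)
    rwa [Nat.eq_of_mul_eq_mul_left hpj h1] at h2
  have : Nontrivial A.carrier := A.carrier_nontrivial
  have : CharP A.carrier p :=
    charP_of_injective_algebraMap (algebraMap (ZMod p) A.carrier).injective p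
  have hpow : (∑ s ∈ F, c s • u s • orderedMonomial g (root s)) ^ p ^ j = g m ^ p ^ j ∧
      (g m - ∑ s ∈ F, c s • u s • orderedMonomial g (root s)) ^ p ^ j =
        g m ^ p ^ j - (∑ s ∈ F, c s • u s • orderedMonomial g (root s)) ^ p ^ j := by
    have e : ∀ s ∈ F, (c s • u s • orderedMonomial g (root s)) ^ p ^ j =
        c s • orderedMonomial g s := by
      intro s hs
      rw [smul_pow, units_smul_pow_char_pow, ZMod.pow_card_pow, ← hu s hs]
    rcases hm with rfl | hm
    · simp only [pow_zero, pow_one] at e hsum ⊢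
      rw [Finset.sum_congr rfl e, ← hsum]
      simp
    have hcomm : ∀ a ∈ A.grading (deg m), ∀ b ∈ A.grading (deg m), Commute a b := by
      intro a ha b hb
      change a * b = b * a
      rw [A.graded_comm ha hb]
      rcases hm with hm | rfl
      · rw [(hm.mul_left _).neg_one_pow, one_smul]
      · rw [CharTwo.neg_eq, one_pow, one_smul]
    refine ⟨?_, sub_pow_char_pow_of_commute (p := p) _ (hcomm _ (hg m) _ (sum_mem hmem))⟩
    rw [sum_pow_char_pow_of_commute (p := p) F _
      (fun a ha b hb => hcomm _ (hmem a ha) _ (hmem b hb)), Finset.sum_congr rfl e, hsum]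
  refine ⟨_, sum_mem hmem, sum_mem fun s hs => ?_, by rw [hpow.2, hpow.1, sub_self]⟩
  refine Subalgebra.smul_mem _ ?_ _
  refine units_smul_mem (Subalgebra.toSubmodule (Algebra.adjoin (ZMod p) (g '' Set.Iio m))) _
    ((Subalgebra.mem_toSubmodule _).mpr (orderedMonomial_mem_adjoin fun r hr => ?_))
  refine hFm s hs r ?_
  rw [Finsupp.mem_support_iff] at hr ⊢
  intro h
  simp [root, h] at hr

/-- **Linear independence in Borel's theorem.** The restricted monomials are linearly independent if
each generator `x_i` is chosen, among the elements of its degree that are congruent to it modulo the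
algebra generated by the earlier generators, so that its height is as small as possible. -/
theorem linearIndepOn_restricted (hconn : A.Connected) (hopf : A.HopfStructure)
    (hg : ∀ i, g i ∈ A.grading (deg i)) (hpos : ∀ i, 0 < deg i)
    (hspan : Submodule.span (ZMod p) (Set.range (orderedMonomial g)) = ⊤)
    (hmono : ∀ i j, i ≤ j → deg i ≤ deg j) {q : ι → ℕ∞} (hq1 : ∀ i, 1 < q i)
    (hq : ∀ i, ∀ h : ℕ, q i = h → g i ^ h = 0)
    (hqodd : ∀ i, ¬ (Even (deg i) ∨ p = 2) → q i = 2)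
    (hmin : ∀ i j, ((p ^ j : ℕ) : ℕ∞) < q i → ∀ b ∈ A.grading (deg i),
      b ∈ Algebra.adjoin (ZMod p) (g '' Set.Iio i) → (g i - b) ^ p ^ j ≠ 0) (n : ℕ) :
    LinearIndepOn (ZMod p) (orderedMonomial g)
      {s | s ∈ restricted q ∧ Finsupp.weight deg s = n} := by
  classical
  have hp : p.Prime := Fact.out
  have hnt : Nontrivial A.carrier := A.carrier_nontrivial
  induction n using Nat.strong_induction_on with
  | _ n ih =>
    have ih' : ∀ e ∈ restricted q, Finsupp.weight deg e < n →
        ∃ φ : A.carrier →ₗ[ZMod p] ZMod p, ∀ s,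
          φ (orderedMonomial g s) = if s = e then 1 else 0 :=
      fun e he hn => exists_coordinate hg hq he (ih _ hn)
    rw [linearIndepOn_iff']
    intro t c ht hsum
    by_contra! hne
    let F := t.filter fun s => c s ≠ 0
    have hF : ∀ s ∈ F, s ∈ restricted q ∧ Finsupp.weight deg s = n := fun s hs =>
      ht (Finset.mem_filter.mp hs).1
    have hc : ∀ s ∈ F, c s ≠ 0 := fun s hs => (Finset.mem_filter.mp hs).2
    have hsumF : ∑ s ∈ F, c s • orderedMonomial g s = 0 := by
      rw [← hsum, Finset.sum_filter_of_ne]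
      intro s _ h h0
      exact h (by rw [h0, zero_smul])
    obtain ⟨s₀, hs₀, hcs₀⟩ := hne
    have hs₀F : s₀ ∈ F := Finset.mem_filter.mpr ⟨hs₀, hcs₀⟩
    have hwz : ∀ s : ι →₀ ℕ, Finsupp.weight deg s = 0 → s = 0 :=
      fun s => (weight_eq_zero_iff hpos).mp
    rcases Nat.eq_zero_or_pos n with rfl | hn
    · have : F = {0} := by
        ext s
        rw [Finset.mem_singleton]
        refine ⟨fun hs => hwz s (hF s hs).2, ?_⟩
        rintro rfl
        rwa [hwz s₀ (hF s₀ hs₀F).2] at hs₀F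
      rw [this, Finset.sum_singleton, orderedMonomial_zero] at hsumF
      have h0 := hc 0 (by rw [this]; exact Finset.mem_singleton_self _)
      exact (smul_ne_zero h0 one_ne_zero) hsumF
    let U := F.biUnion Finsupp.support
    have hUne : U.Nonempty := by
      have : s₀ ≠ 0 := by
        rintro rfl
        have := (hF 0 hs₀F).2
        rw [map_zero] at this
        lia
      obtain ⟨r, hr⟩ := Finsupp.support_nonempty_iff.mpr this
      exact ⟨r, Finset.mem_biUnion.mpr ⟨s₀, hs₀F, hr⟩⟩
    -- `m` is the largest index that occurs in the relation.
    let m := U.max' hUne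
    have hmax : ∀ s ∈ F, ∀ r ∈ s.support, r ≤ m := fun s hs r hr =>
      U.le_max' r (Finset.mem_biUnion.mpr ⟨s, hs, hr⟩)
    obtain ⟨s₁, hs₁, hs₁m⟩ := Finset.mem_biUnion.mp (U.max'_mem hUne)
    rw [Finsupp.mem_support_iff] at hs₁m
    change s₁ m ≠ 0 at hs₁m
    have hsmall : ∀ s ∈ F, ¬ (Even (deg m) ∨ p = 2) → s m ≤ 1 := by
      intro s hs h
      have := (hF s hs).1 m
      rw [hqodd m h] at this
      exact Nat.lt_succ_iff.mp (by exact_mod_cast this)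
    have hbinom : ∀ s ∈ F, ∀ i, 0 < i → i ≤ s m → i * deg m < n →
        ((s m).choose i : ZMod p) = 0 := by
      intro s hs i hi his hin
      obtain ⟨φ, hφ⟩ := ih' (Finsupp.single m i) (by
        intro r
        by_cases hr : r = m
        · subst hr
          rw [Finsupp.single_eq_same]
          exact lt_of_le_of_lt (Nat.cast_le.mpr his) ((hF s hs).1 _)
        · rw [Finsupp.single_eq_of_ne hr]
          exact lt_trans (by simp) (hq1 r)) (by rwa [weight_single_mul])
      refine choose_eq_zero_of_contract_comul_eq_zero hconn hopf hg hpos hspan ih' hF c hi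
        (N := ⊤) (ENat.natCast_lt_top i) hφ ?_ ?_ (by rw [hsumF, map_zero, map_zero]) hs his
        (hc s hs)
      · intro t ht
        by_cases h : Even (deg m) ∨ p = 2
        · rcases h with h | h
          · exact Or.inl h
          · exact Or.inr (Or.inl ((ZMod.ringChar_zmod_n p).trans h))
        · exact Or.inr (Or.inr (hsmall t ht h))
      · intro t ht r hr
        by_cases htr : t r = 0
        · rw [htr, pow_zero, pow_zero, tens_one_one, sub_self]
          exact zero_mem _
        · have hrm := hmax t ht r (Finsupp.mem_support_iff.mpr htr)
          rw [← tens_one_pow]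
          exact pow_sub_pow_mem hg hspan add_mem_avoiding
            (comul_gen_sub_mem_of_ne hconn hopf hg hpos hspan (hmono r m hrm) hr ⊤) _
    -- Hence only a pure power of the last generator can involve that generator.
    have hpure : ∀ s ∈ F, s m ≠ 0 → s = Finsupp.single m (s m) ∧ s m * deg m = n := by
      intro s hs hsm
      have h1 : n ≤ s m * deg m := by
        by_contra! h
        have := hbinom s hs (s m) (Nat.pos_of_ne_zero hsm) le_rfl h
        rw [Nat.choose_self, Nat.cast_one] at this
        exact one_ne_zero this
      have hle : Finsupp.single m (s m) ≤ s := Finsupp.single_le_iff.mpr le_rfl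
      have h2 := congr_arg (Finsupp.weight deg) (tsub_add_cancel_of_le hle)
      rw [map_add, (hF s hs).2, weight_single_mul] at h2
      have h3 := hwz (s - Finsupp.single m (s m)) (by lia)
      refine ⟨?_, by lia⟩
      have h4 := tsub_add_cancel_of_le hle
      rw [h3, zero_add] at h4
      exact h4.symm
    obtain ⟨hs₁', hn'⟩ := hpure s₁ hs₁ hs₁m
    obtain ⟨j, hj⟩ : ∃ j, s₁ m = p ^ j := by
      refine exists_eq_pow_of_dvd_choose (Nat.pos_of_ne_zero hs₁m) fun i hi him => ?_
      rw [← ZMod.natCast_eq_zero_iff]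
      refine hbinom s₁ hs₁ i hi him.le ?_
      rw [← hn']
      exact Nat.mul_lt_mul_of_pos_right him (hpos m)
    have hm : j = 0 ∨ Even (deg m) ∨ p = 2 := by
      by_contra! h
      have h1 := hsmall s₁ hs₁ (by tauto)
      have h3 : 2 ≤ p ^ j := le_trans hp.two_le (Nat.le_self_pow h.1 p)
      lia
    rw [hj] at hn' hs₁'
    let c' : (ι →₀ ℕ) → ZMod p := fun s => -(c s₁)⁻¹ * c s
    have hc₁ := hc s₁ hs₁
    have hc' : ∀ s ∈ F.erase s₁, c' s ≠ 0 := fun s hs =>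
      mul_ne_zero (neg_ne_zero.mpr (inv_ne_zero hc₁)) (hc s (Finset.mem_of_mem_erase hs))
    have hFm : ∀ s ∈ F.erase s₁, ∀ r ∈ s.support, r < m := by
      intro s hs r hr
      obtain ⟨hne, hs⟩ := Finset.mem_erase.mp hs
      refine lt_of_le_of_ne (hmax s hs r hr) ?_
      rintro rfl
      obtain ⟨h1, h2⟩ := hpure s hs (Finsupp.mem_support_iff.mp hr)
      apply hne
      rw [h1, hs₁', Nat.eq_of_mul_eq_mul_right (hpos _) (h2.trans hn'.symm)]
    have hrel : g m ^ p ^ j = ∑ s ∈ F.erase s₁, c' s • orderedMonomial g s := by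
      rw [← Finset.add_sum_erase F _ hs₁, hs₁', orderedMonomial_single, ← hs₁'] at hsumF
      simp only [c', mul_smul, ← Finset.smul_sum]
      rw [eq_neg_of_add_eq_zero_right hsumF, smul_neg, neg_smul, neg_neg, smul_smul,
        inv_mul_cancel₀ hc₁, one_smul]
    have hF' : ∀ s ∈ F.erase s₁, s ∈ restricted q ∧ Finsupp.weight deg s = p ^ j * deg m :=
      fun s hs => hn' ▸ hF s (Finset.mem_of_mem_erase hs)
    have hdvd := pow_dvd_of_pow_eq_sum hconn hopf hg hpos hspan hmono hq1 hqodd hm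
      (hn' ▸ ih') hF' hFm hc' hrel
    obtain ⟨b, hb, hb', hb0⟩ := exists_sub_pow_eq_zero hg hm (fun s hs => (hF' s hs).2) hFm hrel
      hdvd
    refine hmin m j ?_ b hb hb' hb0
    have := (hF s₁ hs₁).1 m
    rwa [hj] at this

/-- Linear independence of homogeneous elements can be checked degree by degree. -/
theorem linearIndependent_restricted_of_linearIndepOn {k : Type} [Field k] {A : AugGrAlg.{u} k}
    {g : ι → A.carrier} (hg : ∀ i, g i ∈ A.grading (deg i)) {q : ι → ℕ∞}
    (hq : ∀ i, ∀ h : ℕ, q i = h → g i ^ h = 0)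
    (h : ∀ n, LinearIndepOn k (orderedMonomial g)
      {s | s ∈ restricted q ∧ Finsupp.weight deg s = n}) :
    LinearIndependent k fun s : {s : ι →₀ ℕ // ∀ i, (s i : ℕ∞) < q i} =>
      orderedMonomial g s.1 := by
  rw [linearIndependent_iff']
  intro F c hc s hs
  obtain ⟨φ, hφ⟩ := exists_coordinate hg hq s.2 (h _)
  have h1 := congr_arg φ hc
  rw [map_sum, map_zero, Finset.sum_eq_single s] at h1
  · simpa [hφ] using h1
  · intro t _ hts
    rw [map_smul, hφ, if_neg (fun h => hts (Subtype.ext h)), smul_zero]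
  · exact fun h => absurd hs h

end LinearIndependence

end AugGrAlg

/-! ### Choice of generators -/

namespace AugGrAlg

section Generators

variable {p : ℕ} [Fact p.Prime] {A : AugGrAlg.{u} (ZMod p)}

/-- `x` is a good next generator after the elements of `S`: it is homogeneous of the smallest degree
`d` in which `S` does not generate `A`, and its height is as small as possible among the elements of
degree `d` outside of the algebra generated by `S`. -/
structure IsNextGenerator (S : Set A.carrier) (x : A.carrier) (d : ℕ) : Prop where
  mem : x ∈ A.grading d
  notMem : x ∉ Algebra.adjoin (ZMod p) S
  lt_mem : ∀ e < d, ∀ y ∈ A.grading e, y ∈ Algebra.adjoin (ZMod p) S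
  height_min : ∀ y ∈ A.grading d, y ∉ Algebra.adjoin (ZMod p) S →
    ∀ j, y ^ p ^ j = 0 → x ^ p ^ j = 0

theorem exists_isNextGenerator {S : Set A.carrier} (hS : Algebra.adjoin (ZMod p) S ≠ ⊤) :
    ∃ x d, IsNextGenerator S x d := by
  classical
  have hex : ∃ d, ∃ y ∈ A.grading d, y ∉ Algebra.adjoin (ZMod p) S := by
    by_contra! h
    apply hS
    rw [eq_top_iff]
    rintro a -
    induction a using DirectSum.Decomposition.inductionOn A.grading with
    | zero => exact zero_mem _
    | homogeneous a => exact h _ _ a.2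
    | add x y hx hy => exact add_mem hx hy
  let d := Nat.find hex
  have hd := Nat.find_spec hex
  have hlt : ∀ e < d, ∀ y ∈ A.grading e, y ∈ Algebra.adjoin (ZMod p) S := by
    intro e he y hy
    by_contra h
    exact Nat.find_min hex he ⟨y, hy, h⟩
  by_cases hnil : ∃ j, ∃ y ∈ A.grading d, y ∉ Algebra.adjoin (ZMod p) S ∧ y ^ p ^ j = 0
  · obtain ⟨x, hx, hxS, hx0⟩ := Nat.find_spec hnil
    refine ⟨x, d, hx, hxS, hlt, fun y hy hyS j hj => ?_⟩
    have hle : Nat.find hnil ≤ j := Nat.find_min' hnil ⟨y, hy, hyS, hj⟩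
    exact pow_eq_zero_of_le (Nat.pow_le_pow_right (Fact.out : p.Prime).pos hle) hx0
  · obtain ⟨x, hx, hxS⟩ := hd
    exact ⟨x, d, hx, hxS, hlt, fun y hy hyS j hj => absurd ⟨j, y, hy, hyS, hj⟩ hnil⟩

/-- A sequence of good generators, running until the whole algebra is generated. -/
theorem exists_generator_sequence (A : AugGrAlg.{u} (ZMod p)) :
    ∃ (f : ℕ → A.carrier) (d : ℕ → ℕ), ∀ n,
      Algebra.adjoin (ZMod p) (f '' Set.Iio n) ≠ ⊤ →
        IsNextGenerator (f '' Set.Iio n) (f n) (d n) := by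
  have h : ∀ S : Set A.carrier, ∃ x d, Algebra.adjoin (ZMod p) S ≠ ⊤ → IsNextGenerator S x d := by
    intro S
    by_cases hS : Algebra.adjoin (ZMod p) S = ⊤
    · exact ⟨0, 0, fun h => absurd hS h⟩
    · obtain ⟨x, d, h⟩ := exists_isNextGenerator hS
      exact ⟨x, d, fun _ => h⟩
  choose X D hXD using h
  let B : ℕ → Set A.carrier := fun n => Nat.rec ∅ (fun _ S => insert (X S) S) n
  have hB : ∀ n, B n = (fun m => X (B m)) '' Set.Iio n := by
    intro n
    induction n with
    | zero => simp [B]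
    | succ n ih =>
      have e : Set.Iio (n + 1) = insert n (Set.Iio n) := by ext m; simp
      rw [e, Set.image_insert_eq, ← ih]
  refine ⟨fun n => X (B n), fun n => D (B n), fun n hn => ?_⟩
  rw [← hB] at hn ⊢
  exact hXD _ hn

/-- An infinite sequence of next generators generates `A`: otherwise their degrees would be bounded,
although in each degree the generated algebras become stationary, `A` being of finite type. -/
theorem adjoin_eq_top_of_finiteType (hfin : A.FiniteType) {f : ℕ → A.carrier} {d : ℕ → ℕ}
    (hf : ∀ n, IsNextGenerator (f '' Set.Iio n) (f n) (d n)) :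
    Algebra.adjoin (ZMod p) (Set.range f) = ⊤ := by
  have hmono : Monotone fun n => Algebra.adjoin (ZMod p) (f '' Set.Iio n) := fun m n hmn =>
    Algebra.adjoin_mono (Set.image_mono (Set.Iio_subset_Iio hmn))
  rw [eq_top_iff]
  rintro a -
  induction a using DirectSum.Decomposition.inductionOn A.grading with
  | zero => exact zero_mem _
  | add x y hx hy => exact add_mem hx hy
  | @homogeneous e a =>
    by_contra ha
    have hle : ∀ n, d n ≤ e := by
      intro n
      by_contra! h
      exact ha (Algebra.adjoin_mono (Set.image_subset_range _ _) ((hf n).lt_mem e h _ a.2))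
    -- The filtration by the subalgebras becomes stationary in each degree up to `e`.
    have hstab : ∀ i, ∃ n, ∀ m, n ≤ m → ∀ y ∈ A.grading i,
        y ∈ Algebra.adjoin (ZMod p) (f '' Set.Iio m) →
        y ∈ Algebra.adjoin (ZMod p) (f '' Set.Iio n) := by
      intro i
      have := hfin i
      let W : ℕ →o Submodule (ZMod p) (A.grading i) :=
        ⟨fun n => (Subalgebra.toSubmodule (Algebra.adjoin (ZMod p) (f '' Set.Iio n))).comap
          (A.grading i).subtype, fun m n hmn x hx => hmono hmn hx⟩
      obtain ⟨n, hn⟩ := monotone_stabilizes_iff_noetherian.mpr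
        (inferInstance : IsNoetherian (ZMod p) (A.grading i)) W
      refine ⟨n, fun m hm y hy hym => ?_⟩
      have : (⟨y, hy⟩ : A.grading i) ∈ W n := by
        rw [hn m hm]
        exact hym
      exact this
    choose N hN using hstab
    let n := (Finset.range (e + 1)).sup N
    have hn : N (d n) ≤ n := Finset.le_sup (Finset.mem_range.mpr (Nat.lt_succ_of_le (hle n)))
    refine (hf n).notMem (hmono hn (hN (d n) (n + 1) (by lia) _ (hf n).mem ?_))
    exact Algebra.subset_adjoin ⟨n, Nat.lt_succ_self n, rfl⟩

open Classical in
/-- The kind of a generator `x` of degree `d` in a tensor product decomposition. -/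
noncomputable def generatorKind (p : ℕ) {R : Type*} [Ring R] (x : R) (d : ℕ) : GeneratorKind :=
  if Even d ∨ p = 2 then
    if h : ∃ e, x ^ p ^ e = 0 then .truncated (Nat.find h) else .polynomial
  else .exterior

theorem sq_eq_zero_of_odd {d : ℕ} (hd : ¬ (Even d ∨ p = 2)) {x : A.carrier}
    (hx : x ∈ A.grading d) : x ^ 2 = 0 := by
  push Not at hd
  have h := A.graded_comm hx hx
  rw [(Nat.not_even_iff_odd.mp hd.1 |>.mul (Nat.not_even_iff_odd.mp hd.1)).neg_one_pow, neg_smul,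
    one_smul, eq_neg_iff_add_eq_zero, ← two_smul (ZMod p)] at h
  rw [pow_two]
  refine (smul_eq_zero.mp h).resolve_left fun h2 => hd.2 ?_
  have h3 : ((2 : ℕ) : ZMod p) = 0 := by exact_mod_cast h2
  rw [ZMod.natCast_eq_zero_iff] at h3
  exact (Nat.prime_dvd_prime_iff_eq Fact.out Nat.prime_two).mp h3

/-- **Borel's theorem**, for a comultiplication that need not be coassociative. The generators are
indexed by the stages at which the chosen sequence does not yet generate `A`. -/
theorem exists_borelDecomposition (hconn : A.Connected) (hfin : A.FiniteType)
    (hopf : A.HopfStructure) :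
    ∃ (ι : Type) (_ : LinearOrder ι), Nonempty (A.BorelDecomposition ι) := by
  have hp : p.Prime := Fact.out
  obtain ⟨f, d, hfd⟩ := exists_generator_sequence A
  let ι : Type := {n : ℕ // Algebra.adjoin (ZMod p) (f '' Set.Iio n) ≠ ⊤}
  let g : ι → A.carrier := fun i => f i.1
  let deg : ι → ℕ := fun i => d i.1
  have hmonoB : ∀ m n, m ≤ n → Algebra.adjoin (ZMod p) (f '' Set.Iio m) ≤
      Algebra.adjoin (ZMod p) (f '' Set.Iio n) := fun m n hmn =>
    Algebra.adjoin_mono (Set.image_mono (Set.Iio_subset_Iio hmn))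
  have hdown : ∀ m n, m ≤ n → Algebra.adjoin (ZMod p) (f '' Set.Iio n) ≠ ⊤ →
      Algebra.adjoin (ZMod p) (f '' Set.Iio m) ≠ ⊤ := by
    intro m n hmn hn hm
    exact hn (top_le_iff.mp (hm ▸ hmonoB m n hmn))
  have himage : ∀ i : ι, g '' Set.Iio i = f '' Set.Iio i.1 := by
    intro i
    ext x
    constructor
    · rintro ⟨j, hj, rfl⟩
      exact ⟨j.1, hj, rfl⟩
    · rintro ⟨j, hj, rfl⟩
      exact ⟨⟨j, hdown j i.1 (le_of_lt hj) i.2⟩, hj, rfl⟩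
  have hnext : ∀ i : ι, IsNextGenerator (g '' Set.Iio i) (g i) (deg i) := by
    intro i
    rw [himage]
    exact hfd i.1 i.2
  have hg : ∀ i, g i ∈ A.grading (deg i) := fun i => (hnext i).mem
  have hpos : ∀ i, 0 < deg i := by
    intro i
    by_contra! h
    obtain ⟨c, hc⟩ := hconn (g i) (Nat.le_zero.mp h ▸ hg i)
    exact (hnext i).notMem (hc ▸ algebraMap_mem _ c)
  have hg0 : ∀ i, g i ≠ 0 := fun i h => (hnext i).notMem (h ▸ zero_mem _)
  have hmono : ∀ i j, i ≤ j → deg i ≤ deg j := by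
    intro i j hij
    by_contra! h
    refine (hnext j).notMem (Algebra.adjoin_mono (Set.image_mono (Set.Iio_subset_Iio hij))
      ((hnext i).lt_mem _ h _ (hg j)))
  have hgen : Algebra.adjoin (ZMod p) (g '' Set.univ) = ⊤ := by
    rw [Set.image_univ]
    by_cases h : ∃ n, Algebra.adjoin (ZMod p) (f '' Set.Iio n) = ⊤
    · classical
      rw [eq_top_iff, ← Nat.find_spec h]
      apply Algebra.adjoin_mono
      rintro _ ⟨m, hm, rfl⟩
      exact ⟨⟨m, Nat.find_min h hm⟩, rfl⟩
    · push Not at h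
      rw [eq_top_iff, ← adjoin_eq_top_of_finiteType hfin fun n => hfd n (h n)]
      apply Algebra.adjoin_mono
      rintro _ ⟨m, rfl⟩
      exact ⟨⟨m, h m⟩, rfl⟩
  have hspan : Submodule.span (ZMod p) (Set.range (orderedMonomial g)) = ⊤ := by
    have h := (signCommuting hg).adjoin_eq_span (k := ZMod p) Set.univ
    rw [hgen] at h
    simpa using h.symm
  let kind : ι → GeneratorKind := fun i => generatorKind p (g i) (deg i)
  have hpoly : ∀ i, kind i = .polynomial → (Even (deg i) ∨ p = 2) ∧ ∀ e, g i ^ p ^ e ≠ 0 := by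
    intro i hi
    simp only [kind, generatorKind] at hi
    split_ifs at hi with h1 h2
    exact ⟨h1, by push Not at h2; exact h2⟩
  have htrunc : ∀ i e, kind i = .truncated e → (Even (deg i) ∨ p = 2) ∧ g i ^ p ^ e = 0 ∧
      ∀ e' < e, g i ^ p ^ e' ≠ 0 := by
    classical
    intro i e hi
    simp only [kind, generatorKind] at hi
    split_ifs at hi with h1 h2
    cases hi
    refine ⟨h1, ?_, fun e' he' => ?_⟩
    · convert Nat.find_spec h2
    · exact Nat.find_min h2 (by convert he')
  have hext : ∀ i, kind i = .exterior → ¬ (Even (deg i) ∨ p = 2) := by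
    intro i hi
    simp only [kind, generatorKind] at hi
    split_ifs at hi with h1 h2
    exact h1
  have htpos : ∀ i e, kind i = .truncated e → 0 < e := by
    intro i e hi
    obtain ⟨-, h, -⟩ := htrunc i e hi
    by_contra! h0
    rw [Nat.le_zero.mp h0, pow_zero, pow_one] at h
    exact hg0 i h
  have hq : ∀ i, ∀ h : ℕ, (kind i).height p = h → g i ^ h = 0 := by
    intro i h hh
    rcases hk : kind i with _ | e | _
    · rw [hk] at hh
      exact absurd hh.symm (ENat.natCast_ne_top h)
    · rw [hk] at hh
      have : p ^ e = h := Nat.cast_injective (R := ℕ∞) hh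
      exact this ▸ (htrunc i e hk).2.1
    · rw [hk] at hh
      have : 2 = h := Nat.cast_injective (R := ℕ∞) hh
      exact this ▸ sq_eq_zero_of_odd (hext i hk) (hg i)
  have hq1 : ∀ i, 1 < (kind i).height p := by
    intro i
    rcases hk : kind i with _ | e | _
    · exact ENat.natCast_lt_top 1
    · have : 1 < p ^ e := Nat.one_lt_pow (htpos i e hk).ne' hp.one_lt
      rw [← Nat.cast_one]
      exact Nat.cast_lt.mpr this
    · change (1 : ℕ∞) < 2
      exact_mod_cast one_lt_two
  have hqodd : ∀ i, ¬ (Even (deg i) ∨ p = 2) → (kind i).height p = 2 := by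
    intro i hi
    have : kind i = .exterior := if_neg hi
    rw [this]
    rfl
  have hmin : ∀ i j, ((p ^ j : ℕ) : ℕ∞) < (kind i).height p → ∀ b ∈ A.grading (deg i),
      b ∈ Algebra.adjoin (ZMod p) (g '' Set.Iio i) → (g i - b) ^ p ^ j ≠ 0 := by
    intro i j hj b hb hb' h0
    have h1 := (hnext i).height_min (g i - b) (sub_mem (hg i) hb)
      (fun h => (hnext i).notMem (by simpa using add_mem h hb')) j h0
    rcases hk : kind i with _ | e | _
    · exact (hpoly i hk).2 j h1
    · rw [hk] at hj
      have h2 : p ^ j < p ^ e := Nat.cast_lt.mp hj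
      exact (htrunc i e hk).2.2 j ((Nat.pow_lt_pow_iff_right hp.one_lt).mp h2) h1
    · rw [hk] at hj
      have h2 : p ^ j < 2 := by exact_mod_cast (show ((p ^ j : ℕ) : ℕ∞) < 2 from hj)
      have h3 : p ^ j = 1 := by have := pow_pos hp.pos j; lia
      rw [h3, pow_one] at h1
      exact hg0 i h1
  refine ⟨ι, inferInstance, ⟨{
    kind := kind
    deg := deg
    gen := g
    deg_pos := hpos
    gen_mem := hg
    even_of_polynomial := fun i hi h2 => (hpoly i hi).1.resolve_right h2
    pos_of_truncated := htpos
    even_of_truncated := fun i e hi h2 => (htrunc i e hi).1.resolve_right h2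
    odd_of_exterior := fun i hi => by
      have := hext i hi
      push Not at this
      exact ⟨this.2, Nat.not_even_iff_odd.mp this.1⟩
    pow_height := hq
    linearIndependent := linearIndependent_restricted_of_linearIndepOn hg hq
      (linearIndepOn_restricted hconn hopf hg hpos hspan hmono hq1 hq hqodd hmin)
    span_eq_top := ?_ }⟩⟩
  rw [eq_top_iff, ← hspan, Submodule.span_le]
  rintro _ ⟨s, rfl⟩
  by_cases hs : s ∈ restricted fun i => (kind i).height p
  · exact Submodule.subset_span ⟨⟨s, hs⟩, rfl⟩
  · rw [orderedMonomial_eq_zero_of_notMem hq hs]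
    exact zero_mem _

end Generators

end AugGrAlg

/-! ### The resolution of a comonad: naturality and contraction -/

namespace Cotriple

section

universe v₁ v₂ u₁ u₂

variable {C : Type u₁} [Category.{v₁} C] (G : C ⥤ C) (ε : G ⟶ 𝟭 C)

/-- The map `G ^ n X ⟶ G ^ n Y` induced by `f : X ⟶ Y`. -/
def iterMap {X Y : C} (f : X ⟶ Y) : (n : ℕ) → (iter G X n ⟶ iter G Y n)
  | 0 => f
  | n + 1 => G.map (iterMap f n)

theorem iterMap_id (X : C) (n : ℕ) : iterMap G (𝟙 X) n = 𝟙 (iter G X n) := by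
  induction n with
  | zero => rfl
  | succ n ih => exact (congrArg (fun f => G.map f) ih).trans (G.map_id _)

theorem iterMap_comp {X Y Z : C} (f : X ⟶ Y) (g : Y ⟶ Z) (n : ℕ) :
    iterMap G (f ≫ g) n = iterMap G f n ≫ iterMap G g n := by
  induction n with
  | zero => rfl
  | succ n ih => exact (congrArg (fun f => G.map f) ih).trans (G.map_comp _ _)

theorem face_naturality {X Y : C} (f : X ⟶ Y) (n : ℕ) (i : Fin (n + 1)) :
    face G ε X n i ≫ iterMap G f n = iterMap G f (n + 1) ≫ face G ε Y n i := by
  induction n with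
  | zero =>
    obtain rfl : i = 0 := by lia
    exact (ε.naturality f).symm
  | succ n ih =>
    refine Fin.cases ?_ (fun i => ?_) i
    · rw [face_zero, face_zero]
      exact (ε.naturality (iterMap G f (n + 1))).symm
    · exact ((G.map_comp _ _).symm.trans (congrArg (fun f => G.map f) (ih i))).trans
        (G.map_comp _ _)

/-- The map `G ^ n X ⟶ G ^ (n + 1) X` obtained by applying `G ^ n` to `h : X ⟶ G X`. -/
def iterSection {X : C} (h : X ⟶ G.obj X) : (n : ℕ) → (iter G X n ⟶ iter G X (n + 1))
  | 0 => h
  | n + 1 => G.map (iterSection h n)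

theorem iterSection_comp_face_last {X : C} {h : X ⟶ G.obj X} (hh : h ≫ ε.app X = 𝟙 X) (n : ℕ) :
    iterSection G h n ≫ face G ε X n (Fin.last n) = 𝟙 _ := by
  induction n with
  | zero => exact hh
  | succ n ih =>
    rw [← Fin.succ_last, face_succ]
    exact ((G.map_comp _ _).symm.trans (congrArg (fun f => G.map f) ih)).trans (G.map_id _)

theorem iterSection_comp_face {X : C} (h : X ⟶ G.obj X) (n : ℕ) (i : Fin (n + 1)) :
    iterSection G h (n + 1) ≫ face G ε X (n + 1) i.castSucc =
      face G ε X n i ≫ iterSection G h n := by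
  induction n with
  | zero =>
    obtain rfl : i = 0 := by lia
    exact ε.naturality h
  | succ n ih =>
    refine Fin.cases ?_ (fun i => ?_) i
    · rw [Fin.castSucc_zero, face_zero, face_zero]
      exact ε.naturality (iterSection G h (n + 1))
    · exact ((G.map_comp _ _).symm.trans (congrArg (fun f => G.map f) (ih i))).trans
        (G.map_comp _ _)

variable {D : Type u₂} [Category.{v₂} D] [Preadditive D] (F : C ⥤ D)

theorem d_naturality {X Y : C} (f : X ⟶ Y) (n : ℕ) :
    d G ε F X n ≫ F.map (iterMap G f (n + 1)) = F.map (iterMap G f (n + 2)) ≫ d G ε F Y n := by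
  simp only [d, Preadditive.sum_comp, Preadditive.comp_sum, Preadditive.zsmul_comp,
    Preadditive.comp_zsmul, ← F.map_comp, face_naturality]

/-- If `h : X ⟶ G X` is a section of the counit, then `F (G ^ n h)` is, up to signs, a contraction
of the complex of `X` in positive degrees. -/
theorem section_comp_d {X : C} {h : X ⟶ G.obj X} (hh : h ≫ ε.app X = 𝟙 X) (n : ℕ) :
    F.map (iterSection G h (n + 2)) ≫ d G ε F X (n + 1) =
      d G ε F X n ≫ F.map (iterSection G h (n + 1)) + (-1 : ℤ) ^ (n + 2) • 𝟙 _ := by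
  rw [d, Fin.sum_univ_castSucc]
  simp only [d, Preadditive.sum_comp, Preadditive.comp_add, Preadditive.comp_sum,
    Preadditive.zsmul_comp, Preadditive.comp_zsmul, ← F.map_comp, iterSection_comp_face,
    iterSection_comp_face_last G ε hh, F.map_id, Fin.val_castSucc, Fin.val_last]

end

end Cotriple

/-! ### A double complex argument -/

section DoubleComplex

variable {R : Type*} [Ring R] {P : ℕ → ℕ → Type*} [∀ i n, AddCommGroup (P i n)]
  [∀ i n, Module R (P i n)] {B : ℕ → Type*} [∀ i, AddCommGroup (B i)] [∀ i, Module R (B i)]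
  {Z : ℕ → Type*} [∀ n, AddCommGroup (Z n)] [∀ n, Module R (Z n)]

/-- A double complex `P i n` (with commuting differentials) all of whose rows `P • n` resolve `Z n`,
and all of whose columns `P i •` resolve `B i`. -/
structure IsBiresolution (dv : ∀ i n, P i (n + 1) →ₗ[R] P i n) (dh : ∀ i n, P (i + 1) n →ₗ[R] P i n)
    (η : ∀ i, P i 0 →ₗ[R] B i) (δ : ∀ i, B (i + 1) →ₗ[R] B i) (a : ∀ n, P 0 n →ₗ[R] Z n)
    (dZ : ∀ n, Z (n + 1) →ₗ[R] Z n) : Prop where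
  dv_dv : ∀ i n x, dv i n (dv i (n + 1) x) = 0
  dh_dh : ∀ i n x, dh i n (dh (i + 1) n x) = 0
  dv_dh : ∀ i n x, dv i n (dh i (n + 1) x) = dh i n (dv (i + 1) n x)
  η_dv : ∀ i x, η i (dv i 0 x) = 0
  η_dh : ∀ i x, η i (dh i 0 x) = δ i (η (i + 1) x)
  a_dh : ∀ n x, a n (dh 0 n x) = 0
  a_dv : ∀ n x, a n (dv 0 n x) = dZ n (a (n + 1) x)
  η_surjective : ∀ i, Function.Surjective (η i)
  a_surjective : ∀ n, Function.Surjective (a n)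
  exact_η : ∀ i x, η i x = 0 → ∃ y, dv i 0 y = x
  exact_dv : ∀ i n x, dv i n x = 0 → ∃ y, dv i (n + 1) y = x
  exact_a : ∀ n x, a n x = 0 → ∃ y, dh 0 n y = x
  exact_dh : ∀ i n x, dh i n x = 0 → ∃ y, dh (i + 1) n y = x

variable {dv : ∀ i n, P i (n + 1) →ₗ[R] P i n} {dh : ∀ i n, P (i + 1) n →ₗ[R] P i n}
  {η : ∀ i, P i 0 →ₗ[R] B i} {δ : ∀ i, B (i + 1) →ₗ[R] B i} {a : ∀ n, P 0 n →ₗ[R] Z n}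
  {dZ : ∀ n, Z (n + 1) →ₗ[R] Z n}

namespace IsBiresolution

/-- The complex `P i • / dh (P (i + 1) •)` is exact in degree `n + 1` if `B` is exact in degree
`i + n + 1`. -/
theorem exists_eq_add (H : IsBiresolution dv dh η δ a dZ) (n i j : ℕ) (hj : j = i + n)
    (hB : ∀ b, δ j b = 0 → ∃ b', δ (j + 1) b' = b)
    (z : P i (n + 1)) (x : P (i + 1) n) (hzx : dv i n z = dh i n x) :
    ∃ z' x', z = dv i (n + 1) z' + dh i (n + 1) x' := by
  induction n generalizing i with
  | zero =>
    obtain rfl : i = j := hj.symm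
    have h1 : δ i (η (i + 1) x) = 0 := by rw [← H.η_dh, ← hzx, H.η_dv]
    obtain ⟨b, hb⟩ := hB _ h1
    obtain ⟨y, rfl⟩ := H.η_surjective _ b
    have h2 : η (i + 1) (x - dh (i + 1) 0 y) = 0 := by
      rw [map_sub, H.η_dh, sub_eq_zero]
      exact hb.symm
    obtain ⟨x', hx'⟩ := H.exact_η _ _ h2
    have h3 : dv i 0 (z - dh i 1 x') = 0 := by
      rw [map_sub, H.dv_dh, hx', map_sub, H.dh_dh, hzx, sub_zero, sub_self]
    obtain ⟨z', hz'⟩ := H.exact_dv _ _ _ h3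
    exact ⟨z', x', by rw [hz', sub_add_cancel]⟩
  | succ n ih =>
    have h1 : dh i n (dv (i + 1) n x) = 0 := by rw [← H.dv_dh, ← hzx, H.dv_dv]
    obtain ⟨y, hy⟩ := H.exact_dh _ _ _ h1
    obtain ⟨x', y', hx'⟩ := ih (i + 1) (by lia) x y hy.symm
    have h3 : dv i (n + 1) (z - dh i (n + 2) x') = 0 := by
      rw [map_sub, H.dv_dh, hzx, hx', map_add, H.dh_dh, add_zero, sub_self]
    obtain ⟨z', hz'⟩ := H.exact_dv _ _ _ h3
    exact ⟨z', x', by rw [hz', sub_add_cancel]⟩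

/-- If `B` is exact in degree `n + 1`, then so is `Z`. -/
theorem exact_dZ (H : IsBiresolution dv dh η δ a dZ) (n : ℕ)
    (hB : ∀ b, δ n b = 0 → ∃ b', δ (n + 1) b' = b) (z : Z (n + 1)) (hz : dZ n z = 0) :
    ∃ z', dZ (n + 1) z' = z := by
  obtain ⟨z, rfl⟩ := H.a_surjective _ z
  rw [← H.a_dv] at hz
  obtain ⟨x, hx⟩ := H.exact_a _ _ hz
  obtain ⟨z', x', rfl⟩ := H.exists_eq_add n 0 n (zero_add n).symm hB z x hx.symm
  exact ⟨a _ z', by rw [← H.a_dv, map_add, H.a_dh, add_zero]⟩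

/-- If `δ 0 = 0`, so that the first homology of `B` is the cokernel of `δ 1`, then that cokernel is
also the first homology of `Z`. The two are compared through the pairs `(x, y)` with
`dh x = dv y`. -/
theorem nonempty_homology_equiv (H : IsBiresolution dv dh η δ a dZ) (hδ : ∀ b, δ 0 b = 0)
    {E : Type*} [AddCommGroup E] [Module R E] (w : B 1 →ₗ[R] E) (hw : Function.Surjective w)
    (hwδ : ∀ b, w b = 0 ↔ ∃ b', δ 1 b' = b) {h : Type*} [AddCommGroup h] [Module R h]
    (q : LinearMap.ker (dZ 0) →ₗ[R] h) (hq : Function.Surjective q)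
    (hqd : ∀ z, q z = 0 ↔ ∃ z', dZ 1 z' = z) : Nonempty (h ≃ₗ[R] E) := by
  let L : Submodule R (P 1 0 × P 0 1) :=
    LinearMap.eqLocus ((dh 0 0).comp (LinearMap.fst R _ _)) ((dv 0 0).comp (LinearMap.snd R _ _))
  have hL (l : L) : dh 0 0 l.1.1 = dv 0 0 l.1.2 := l.2
  let f : L →ₗ[R] LinearMap.ker (dZ 0) :=
    ((a 1).comp ((LinearMap.snd R _ _).comp L.subtype)).codRestrict _ fun l => by
      change dZ 0 (a 1 l.1.2) = 0
      rw [← H.a_dv, ← hL, H.a_dh]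
  have hf (l : L) : (f l : Z 1) = a 1 l.1.2 := rfl
  let g : L →ₗ[R] E := w.comp ((η 1).comp ((LinearMap.fst R _ _).comp L.subtype))
  have hg (l : L) : g l = w (η 1 l.1.1) := rfl
  have hf' : Function.Surjective f := by
    rintro ⟨z, hz⟩
    obtain ⟨y, rfl⟩ := H.a_surjective _ z
    rw [LinearMap.mem_ker, ← H.a_dv] at hz
    obtain ⟨x, hx⟩ := H.exact_a _ _ hz
    exact ⟨⟨(x, y), hx⟩, rfl⟩
  have hg' : Function.Surjective g := by
    intro e
    obtain ⟨b, rfl⟩ := hw e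
    obtain ⟨x, rfl⟩ := H.η_surjective _ b
    have h1 : η 0 (dh 0 0 x) = 0 := by rw [H.η_dh, hδ]
    obtain ⟨y, hy⟩ := H.exact_η _ _ h1
    exact ⟨⟨(x, y), hy.symm⟩, rfl⟩
  have hker : LinearMap.ker (q.comp f) = LinearMap.ker g := by
    ext ⟨⟨x, y⟩, hxy⟩
    have hxy' : dh 0 0 x = dv 0 0 y := hxy
    rw [LinearMap.mem_ker, LinearMap.mem_ker, LinearMap.comp_apply, hqd, hg, hwδ]
    simp only [hf]
    constructor
    · rintro ⟨z', hz'⟩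
      obtain ⟨z', rfl⟩ := H.a_surjective _ z'
      rw [← H.a_dv] at hz'
      obtain ⟨x', hx'⟩ := H.exact_a 1 (y - dv 0 1 z') (by rw [map_sub, hz', sub_self])
      have h2 : dh 0 0 (x - dv 1 0 x') = 0 := by
        rw [map_sub, ← H.dv_dh, hx', map_sub, H.dv_dv, sub_zero, hxy', sub_self]
      obtain ⟨t, ht⟩ := H.exact_dh _ _ _ h2
      exact ⟨η 2 t, by rw [← H.η_dh, ht, map_sub, H.η_dv, sub_zero]⟩
    · rintro ⟨b', hb'⟩
      obtain ⟨t, rfl⟩ := H.η_surjective _ b'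
      rw [← H.η_dh] at hb'
      obtain ⟨x', hx'⟩ := H.exact_η 1 (x - dh 1 0 t) (by rw [map_sub, hb', sub_self])
      have h2 : dv 0 0 (y - dh 0 1 x') = 0 := by
        rw [map_sub, H.dv_dh, hx', map_sub, H.dh_dh, sub_zero, hxy', sub_self]
      obtain ⟨z', hz'⟩ := H.exact_dv _ _ _ h2
      exact ⟨a 2 z', by rw [← H.a_dv, hz', map_sub, H.a_dh, sub_zero]⟩
  exact ⟨((q.comp f).quotKerEquivOfSurjective (hq.comp hf')).symm.trans
    ((Submodule.quotEquivOfEq _ _ hker).trans (g.quotKerEquivOfSurjective hg'))⟩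

end IsBiresolution

end DoubleComplex

/-! ### Simplicial modules and homology modules -/

section

variable {k : Type} [Field k]

/-- The homology of a short complex of modules in terms of cycles and boundaries. -/
theorem ShortComplex.exists_homology_map (S : ShortComplex (ModuleCat.{u} k)) {H : ModuleCat.{u} k}
    (e : S.homology ≅ H) :
    ∃ q : LinearMap.ker S.g.hom →ₗ[k] H, Function.Surjective q ∧
      ∀ z, q z = 0 ↔ ∃ z', S.f.hom z' = z := by
  let i := S.moduleCatHomologyIso.symm ≪≫ e
  let q : ModuleCat.of k (LinearMap.ker S.g.hom) ⟶ H := S.moduleCatLeftHomologyData.π ≫ i.hom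
  have hi : Function.Bijective i.hom.hom :=
    (ConcreteCategory.isIso_iff_bijective i.hom).mp inferInstance
  refine ⟨q.hom, fun h => ?_, fun z => ?_⟩
  · obtain ⟨x, rfl⟩ := hi.2 h
    obtain ⟨z, rfl⟩ := Submodule.mkQ_surjective _ x
    exact ⟨z, rfl⟩
  · refine (map_eq_zero_iff i.hom.hom hi.1).trans
      ((Submodule.Quotient.mk_eq_zero _).trans ⟨?_, ?_⟩)
    · rintro ⟨z', hz'⟩
      exact ⟨z', congrArg Subtype.val hz'⟩
    · rintro ⟨z', hz'⟩
      exact ⟨z', Subtype.ext hz'⟩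

/-- The homology of a chain complex of modules in terms of cycles and boundaries. -/
theorem ChainComplex.exists_homology_map (K : ChainComplex (ModuleCat.{u} k) ℕ) (n : ℕ) :
    ∃ q : LinearMap.ker (K.d (n + 1) n).hom →ₗ[k] K.homology (n + 1), Function.Surjective q ∧
      ∀ z, q z = 0 ↔ ∃ z', (K.d (n + 2) (n + 1)).hom z' = z :=
  ShortComplex.exists_homology_map (K.sc' (n + 2) (n + 1) n)
    (ShortComplex.homologyMapIso (K.isoSc' (n + 2) (n + 1) n (by simp) (by simp))).symm

/-- The zeroth homology of a chain complex of modules is the cokernel of the last differential. -/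
theorem ChainComplex.exists_homology_zero_iso (K : ChainComplex (ModuleCat.{u} k) ℕ)
    {M : ModuleCat.{u} k} (f : K.X 0 ⟶ M) (hf : Function.Surjective f.hom)
    (hf' : ∀ x, f.hom x = 0 ↔ ∃ y, (K.d 1 0).hom y = x) :
    ∃ e : K.homology 0 ≅ M, K.homologyπ 0 ≫ e.hom = K.iCycles 0 ≫ f := by
  have h0 : K.d 1 0 ≫ f = 0 := by
    ext y
    exact (hf' _).mpr ⟨y, rfl⟩
  let g : K.opcycles 0 ⟶ M := K.descOpcycles f 1 (by simp) h0
  have hg : K.pOpcycles 0 ≫ g = f := K.p_descOpcycles f 1 _ h0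
  have hbij : Function.Bijective g.hom := by
    constructor
    · rw [← LinearMap.ker_eq_bot, eq_bot_iff]
      intro x hx
      obtain ⟨x, rfl⟩ := (ModuleCat.epi_iff_surjective (K.pOpcycles 0)).mp inferInstance x
      have hx' : f.hom x = 0 := by
        rw [← hg]
        exact hx
      obtain ⟨y, rfl⟩ := (hf' x).mp hx'
      have := K.d_pOpcycles 1 0
      rw [Submodule.mem_bot]
      exact congrArg (fun φ => φ.hom y) this
    · intro m
      obtain ⟨x, rfl⟩ := hf m
      exact ⟨(K.pOpcycles 0).hom x, by rw [← hg]; rfl⟩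
  have : IsIso (K.homologyι 0) := K.isIso_homologyι 0 0 (by simp) (by simp)
  refine ⟨asIso (K.homologyι 0) ≪≫ (LinearEquiv.ofBijective g.hom hbij).toModuleIso, ?_⟩
  change K.homologyπ 0 ≫ K.homologyι 0 ≫ g = _
  rw [HomologicalComplex.homology_π_ι_assoc, hg]

variable {C : Type*} [Category C] (X : SimplicialObject C) (F : C ⥤ ModuleCat.{u} k)

/-- The alternating sum of the images under `F` of the face maps of a simplicial object. -/
noncomputable def alternatingFaces (n : ℕ) :
    F.obj (X.obj (.op (.mk (n + 1)))) →ₗ[k] F.obj (X.obj (.op (.mk n))) :=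
  ∑ i : Fin (n + 2), (-1 : ℤ) ^ (i : ℕ) • (F.map (X.δ i)).hom

theorem alternatingFaces_apply (n : ℕ) (x) :
    alternatingFaces X F n x = ∑ i : Fin (n + 2), (-1 : ℤ) ^ (i : ℕ) • (F.map (X.δ i)).hom x := by
  simp only [alternatingFaces, LinearMap.sum_apply, LinearMap.smul_apply]

theorem alternatingFaces_alternatingFaces (n : ℕ) (x) :
    alternatingFaces X F n (alternatingFaces X F (n + 1) x) = 0 := by
  have h (n : ℕ) (x : F.obj (X.obj (.op (.mk (n + 1))))) : alternatingFaces X F n x =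
      (AlgebraicTopology.AlternatingFaceMapComplex.objD (X ⋙ F) n).hom x := by
    rw [alternatingFaces_apply]
    simp only [AlgebraicTopology.AlternatingFaceMapComplex.objD, ModuleCat.hom_sum,
      LinearMap.sum_apply]
    rfl
  rw [h, h]
  exact congrArg (fun f => f.hom x)
    (AlgebraicTopology.AlternatingFaceMapComplex.d_squared (X ⋙ F) n)

/-- The alternating sum of the faces has a contraction in positive degrees if there are linear maps
`s` satisfying `d₀ s = 1` and `d_{i+1} s = s d_i`. -/
theorem alternatingFaces_contraction
    (s : ∀ n, F.obj (X.obj (.op (.mk n))) →ₗ[k] F.obj (X.obj (.op (.mk (n + 1)))))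
    (h0 : ∀ n x, (F.map (X.δ 0)).hom (s n x) = x)
    (hs : ∀ n (i : Fin (n + 2)) x,
      (F.map (X.δ i.succ)).hom (s (n + 1) x) = s n ((F.map (X.δ i)).hom x)) (n : ℕ) (x) :
    alternatingFaces X F (n + 1) (s (n + 1) x) = x - s n (alternatingFaces X F n x) := by
  rw [alternatingFaces_apply, Fin.sum_univ_succ, alternatingFaces_apply]
  simp [h0, hs, pow_succ, sub_eq_add_neg, map_sum]

end

namespace AugGrAlg

/-! ### Indecomposables -/

section Indecomposables

variable {k : Type} [Field k]

/-- The class in `(QA)_m` of an element of `A`: that of the degree `m` part of its projection to the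
augmentation ideal. -/
noncomputable def indecOf (A : AugGrAlg.{u} k) (m : ℕ) : A.carrier →ₗ[k] A.indecGrading m :=
  A.decomposables.mkQ.restrict (fun _ ha => Submodule.mem_map_of_mem ha) ∘ₗ
    DirectSum.component k ℕ (fun i => A.idealGrading i) m ∘ₗ
      (DirectSum.decomposeLinearEquiv A.idealGrading).toLinearMap ∘ₗ A.idealProj

variable {A B : AugGrAlg.{u} k} {m n : ℕ} {a b : A.carrier}

theorem coe_indecOf_of_mem (ha : a ∈ A.grading m) :
    (A.indecOf m a : A.Indec) = A.decomposables.mkQ (A.idealProj a) := by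
  have h := DirectSum.decompose_of_mem_same A.idealGrading (A.idealProj_mem ha)
  exact congrArg A.decomposables.mkQ h

theorem indecOf_of_mem_ne (ha : a ∈ A.grading n) (h : n ≠ m) : A.indecOf m a = 0 := by
  have h := DirectSum.decompose_of_mem_ne A.idealGrading (A.idealProj_mem ha) h
  refine Subtype.ext ((congrArg A.decomposables.mkQ h).trans (map_zero _))

theorem indecOf_eq_zero_iff (ha : a ∈ A.grading m) (ha' : a ∈ A.augIdeal) :
    A.indecOf m a = 0 ↔ a ∈ A.augIdeal * A.augIdeal := by
  rw [← Submodule.coe_eq_zero, coe_indecOf_of_mem ha, Submodule.mkQ_apply,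
    Submodule.Quotient.mk_eq_zero, A.idealProj_coe ⟨a, ha'⟩]
  rfl

theorem exists_indecOf_eq (x : A.indecGrading m) :
    ∃ a ∈ A.grading m, a ∈ A.augIdeal ∧ A.indecOf m a = x := by
  obtain ⟨_, a, ha, rfl⟩ := x
  exact ⟨a, ha, a.2, Subtype.ext ((coe_indecOf_of_mem (A := A) ha).trans
    (congrArg A.decomposables.mkQ (A.idealProj_coe a)))⟩

theorem indecOf_one : A.indecOf m 1 = 0 := by
  have h : A.idealProj 1 = 0 := Subtype.ext (by rw [coe_idealProj]; simp)
  simp [indecOf, h]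

/-- Induction on homogeneous elements of the augmentation ideal. -/
theorem augIdeal_induction {P : A.carrier → Prop} (h0 : P 0)
    (hadd : ∀ a b, P a → P b → P (a + b))
    (hom : ∀ n, ∀ a ∈ A.grading n, a ∈ A.augIdeal → P a) (ha : a ∈ A.augIdeal) : P a := by
  have h (x : A.augIdeal) : P x := by
    induction x using DirectSum.Decomposition.inductionOn A.idealGrading with
    | zero => exact h0
    | homogeneous x => exact hom _ _ x.2 x.1.2
    | add x y hx hy => exact hadd _ _ hx hy
  exact h ⟨a, ha⟩

theorem mul_mem_augIdeal (b : A.carrier) (ha : a ∈ A.augIdeal) : a * b ∈ A.augIdeal := by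
  rw [mem_augIdeal] at ha ⊢
  rw [map_mul, ha, zero_mul]

theorem indecOf_mul (ha : a ∈ A.augIdeal) (hb : b ∈ A.augIdeal) : A.indecOf m (a * b) = 0 := by
  refine augIdeal_induction (P := fun a => A.indecOf m (a * b) = 0) (by simp)
    (fun x y hx hy => by rw [add_mul, map_add, hx, hy, add_zero]) (fun i a hi ha => ?_) ha
  refine augIdeal_induction (P := fun b => A.indecOf m (a * b) = 0) (by simp)
    (fun x y hx hy => by rw [mul_add, map_add, hx, hy, add_zero]) (fun j b hj hb => ?_) hb
  by_cases h : i + j = m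
  · subst h
    rw [indecOf_eq_zero_iff (SetLike.mul_mem_graded hi hj) (mul_mem_augIdeal b ha)]
    exact Submodule.mul_mem_mul ha hb
  · exact indecOf_of_mem_ne (SetLike.mul_mem_graded hi hj) h

theorem indecOf_pow (ha : a ∈ A.augIdeal) {N : ℕ} (hN : 2 ≤ N) : A.indecOf m (a ^ N) = 0 := by
  obtain ⟨N, rfl⟩ := Nat.exists_eq_add_of_le' hN
  rw [pow_succ', pow_succ']
  exact indecOf_mul ha (mul_mem_augIdeal _ ha)

/-- The linear map `(QA)_m → (QB)_m` induced by a morphism. -/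
def indecLin (m : ℕ) (f : A ⟶ B) : A.indecGrading m →ₗ[k] B.indecGrading m :=
  (indecMap f).restrict (indecMap_mem f m)

theorem indecLin_indecOf (f : A ⟶ B) (a : A.carrier) :
    indecLin m f (A.indecOf m a) = B.indecOf m (f.toAlgHom a) := by
  induction a using DirectSum.Decomposition.inductionOn A.grading with
  | zero => simp only [map_zero]
  | @homogeneous i a =>
    by_cases h : i = m
    · subst h
      refine Subtype.ext ?_
      rw [coe_indecOf_of_mem (f.map_mem _ _ a.2)]
      change indecMap f (A.indecOf i a : A.Indec) = _
      rw [coe_indecOf_of_mem a.2]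
      refine congrArg B.decomposables.mkQ (Subtype.ext ?_)
      rw [coe_idealMap, coe_idealProj, coe_idealProj, map_sub, f.aug_comp, AlgHom.commutes]
    · rw [indecOf_of_mem_ne a.2 h, indecOf_of_mem_ne (f.map_mem _ _ a.2) h, map_zero]
  | add x y hx hy => simp only [map_add, hx, hy]

theorem indecLin_comp {C : AugGrAlg.{u} k} (f : A ⟶ B) (g : B ⟶ C) (x : A.indecGrading m) :
    indecLin m (f ≫ g) x = indecLin m g (indecLin m f x) := by
  obtain ⟨a, -, -, rfl⟩ := exists_indecOf_eq x
  simp only [indecLin_indecOf]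
  rfl

/-- The linear map on `(QA)_m` induced by a linear map on `A` that vanishes on products of elements
of the augmentation ideal. -/
def indecDesc {M : Type*} [AddCommGroup M] [Module k M] (m : ℕ) (φ : A.carrier →ₗ[k] M)
    (hφ : ∀ a ∈ A.augIdeal, ∀ b ∈ A.augIdeal, φ (a * b) = 0) : A.indecGrading m →ₗ[k] M :=
  A.decomposables.liftQ (φ ∘ₗ A.augIdeal.subtype) (fun x hx => by
    have h : A.augIdeal * A.augIdeal ≤ LinearMap.ker φ := Submodule.mul_le.mpr hφ
    exact h hx) ∘ₗ (A.indecGrading m).subtype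

theorem indecDesc_indecOf {M : Type*} [AddCommGroup M] [Module k M] (φ : A.carrier →ₗ[k] M)
    (hφ : ∀ a ∈ A.augIdeal, ∀ b ∈ A.augIdeal, φ (a * b) = 0) (ha : a ∈ A.grading m)
    (ha' : a ∈ A.augIdeal) : indecDesc m φ hφ (A.indecOf m a) = φ a := by
  rw [indecDesc, LinearMap.comp_apply, Submodule.subtype_apply, coe_indecOf_of_mem ha,
    A.idealProj_coe ⟨a, ha'⟩]
  rfl

end Indecomposables

/-! ### Symmetric algebras as augmented algebras -/

section SymAlg

variable {k : Type} [Field k] {V : Type u} [AddCommGroup V] [Module k V] (𝒱 : ℕ → Submodule k V)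
  [DirectSum.Decomposition 𝒱]

/-- The symmetric algebra `S(V)` as an augmented graded-commutative algebra. -/
noncomputable def symAlg : AugGrAlg.{u} k where
  carrier := GrSymAlg 𝒱
  grading := GrSymAlg.grading 𝒱
  graded_comm := GrSymAlg.graded_comm 𝒱
  aug := GrSymAlg.aug 𝒱
  aug_eq_zero := fun hn ha => GrSymAlg.aug_eq_zero 𝒱 hn ha

/-- The inclusion of the generators into `S(V)`. -/
noncomputable def symι : V →ₗ[k] (symAlg 𝒱).carrier := GrSymAlg.ι 𝒱

variable {𝒱}

theorem symι_mem {n : ℕ} {v : V} (hv : v ∈ 𝒱 n) : symι 𝒱 v ∈ (symAlg 𝒱).grading n :=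
  GrSymAlg.ι_mem_grading 𝒱 hv

theorem symι_mem_augIdeal (v : V) : symι 𝒱 v ∈ (symAlg 𝒱).augIdeal :=
  GrSymAlg.lift_ι 𝒱 0 (by simp) v

/-- The morphism `S(V) ⟶ B` given by a degree-preserving linear map from `V` to the augmentation
ideal of `B`. -/
noncomputable def symLift {B : AugGrAlg.{u} k} (f : V →ₗ[k] B.carrier)
    (hf : ∀ n, ∀ v ∈ 𝒱 n, f v ∈ B.grading n) (hf' : ∀ v, B.aug (f v) = 0) : symAlg 𝒱 ⟶ B where
  toAlgHom := GrSymAlg.lift 𝒱 f fun i j _ _ hx hy => B.graded_comm (hf i _ hx) (hf j _ hy)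
  map_mem _ _ ha := GrSymAlg.mem_of_ι_mem 𝒱 B.grading _
    (fun n x hx => by
      rw [GrSymAlg.lift_ι]
      exact hf n x hx) ha
  aug_comp a := by
    have h : B.aug.comp (GrSymAlg.lift 𝒱 f fun i j _ _ hx hy =>
        B.graded_comm (hf i _ hx) (hf j _ hy)) = GrSymAlg.aug 𝒱 :=
      GrSymAlg.algHom_ext 𝒱 fun v => by
        rw [AlgHom.comp_apply, GrSymAlg.lift_ι, hf', GrSymAlg.aug, GrSymAlg.lift_ι]
        rfl
    exact DFunLike.congr_fun h a

theorem symLift_symι {B : AugGrAlg.{u} k} (f : V →ₗ[k] B.carrier)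
    (hf : ∀ n, ∀ v ∈ 𝒱 n, f v ∈ B.grading n) (hf' : ∀ v, B.aug (f v) = 0) (v : V) :
    (symLift f hf hf').toAlgHom (symι 𝒱 v) = f v :=
  GrSymAlg.lift_ι 𝒱 f (fun i j _ _ hx hy => B.graded_comm (hf i _ hx) (hf j _ hy)) v

theorem symAlg_hom_ext {B : AugGrAlg.{u} k} {f g : symAlg 𝒱 ⟶ B}
    (h : ∀ v, f.toAlgHom (symι 𝒱 v) = g.toAlgHom (symι 𝒱 v)) : f = g :=
  hom_ext (GrSymAlg.algHom_ext 𝒱 h)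

theorem indecOf_prod_symι_mem (L : List (Σ i, 𝒱 i)) :
    (symAlg 𝒱).indecOf (L.map fun v => v.1).sum (L.map fun v => symι 𝒱 (v.2 : V)).prod ∈
      (𝒱 (L.map fun v => v.1).sum).map ((symAlg 𝒱).indecOf _ ∘ₗ symι 𝒱) := by
  rcases L with _ | ⟨v, _ | ⟨w, L⟩⟩
  · rw [List.map_nil (f := fun v : Σ i, 𝒱 i => symι 𝒱 (v.2 : V)), List.prod_nil, indecOf_one]
    exact zero_mem _
  · refine ⟨v.2, ?_, ?_⟩
    · simp
    · rw [List.map_singleton (f := fun v : Σ i, 𝒱 i => symι 𝒱 (v.2 : V)), List.prod_singleton]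
      rfl
  · rw [List.map_cons (f := fun v : Σ i, 𝒱 i => symι 𝒱 (v.2 : V)), List.prod_cons,
      List.map_cons (f := fun v : Σ i, 𝒱 i => symι 𝒱 (v.2 : V)), List.prod_cons,
      indecOf_mul (symι_mem_augIdeal _) (mul_mem_augIdeal _ (symι_mem_augIdeal _))]
    exact zero_mem _

/-- The indecomposables of `S(V)` are represented by elements of `V`. -/
theorem exists_indecOf_symι_eq (m : ℕ) (x : (symAlg 𝒱).indecGrading m) :
    ∃ v ∈ 𝒱 m, (symAlg 𝒱).indecOf m (symι 𝒱 v) = x := by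
  obtain ⟨a, ha, -, rfl⟩ := exists_indecOf_eq x
  let N : Submodule k (symAlg 𝒱).carrier :=
    ((𝒱 m).map ((symAlg 𝒱).indecOf m ∘ₗ symι 𝒱)).comap ((symAlg 𝒱).indecOf m)
  suffices h : GrSymAlg.grading 𝒱 m ≤ N from h ha
  refine Submodule.span_le.mpr ?_
  rintro _ ⟨L, rfl, rfl⟩
  exact indecOf_prod_symι_mem L

end SymAlg

/-! ### The zeroth homology -/

section ZerothHomology

variable {k : Type} [Field k] {A B : AugGrAlg.{u} k} {m : ℕ}

/-- The symmetric algebra `S(I(A))`. -/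
noncomputable def symObj (A : AugGrAlg.{u} k) : AugGrAlg.{u} k := (symFunctor k).obj A

/-- The map `S(I(A)) ⟶ S(I(B))` induced by `A ⟶ B`. -/
noncomputable def symObjMap (f : A ⟶ B) : symObj A ⟶ symObj B := (symFunctor k).map f

/-- The counit `S(I(A)) ⟶ A`. -/
noncomputable def counit (A : AugGrAlg.{u} k) : symObj A ⟶ A := (symCounit k).app A

theorem symObjMap_comp_counit (f : A ⟶ B) : symObjMap f ≫ counit B = counit A ≫ f :=
  (symCounit k).naturality f

/-- The inclusion of the generators into `S(I(A))`, composed with the projection of `A` to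
`I(A)`. -/
noncomputable def toSym (A : AugGrAlg.{u} k) : A.carrier →ₗ[k] (symObj A).carrier :=
  GrSymAlg.ι A.idealGrading ∘ₗ A.idealProj

theorem toSym_mem {n : ℕ} {a : A.carrier} (ha : a ∈ A.grading n) :
    A.toSym a ∈ (symObj A).grading n :=
  GrSymAlg.ι_mem_grading _ (A.idealProj_mem ha)

theorem toSym_mem_augIdeal (a : A.carrier) : A.toSym a ∈ (symObj A).augIdeal :=
  symι_mem_augIdeal (𝒱 := A.idealGrading) _

theorem counit_toSym {a : A.carrier} (ha : a ∈ A.augIdeal) :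
    (counit A).toAlgHom (A.toSym a) = a :=
  (multHom_ι A _).trans (congrArg Subtype.val (A.idealProj_coe ⟨a, ha⟩))

theorem symObjMap_toSym (f : A ⟶ B) (a : A.carrier) :
    (symObjMap f).toAlgHom (A.toSym a) = B.toSym (f.toAlgHom a) := by
  have h : idealMap f (A.idealProj a) = B.idealProj (f.toAlgHom a) := by
    refine Subtype.ext ?_
    rw [coe_idealMap, coe_idealProj, coe_idealProj, map_sub, f.aug_comp, AlgHom.commutes]
  exact (GrSymAlg.map_ι A.idealGrading B.idealGrading (idealMap f) (idealMap_mem f) _).trans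
    (congrArg (GrSymAlg.ι B.idealGrading) h)

theorem exists_indecOf_toSym_eq (x : (symObj A).indecGrading m) :
    ∃ a ∈ A.grading m, a ∈ A.augIdeal ∧ (symObj A).indecOf m (A.toSym a) = x := by
  obtain ⟨v, hv, h⟩ := exists_indecOf_symι_eq (𝒱 := A.idealGrading) m x
  refine ⟨v, hv, v.2, Eq.trans ?_ h⟩
  exact congrArg (fun v => (symObj A).indecOf m (GrSymAlg.ι A.idealGrading v)) (A.idealProj_coe v)

/-- The counit of a free algebra has a section, which sends generators to generators. -/
theorem exists_section_counit {V : Type u} [AddCommGroup V] [Module k V] (𝒱 : ℕ → Submodule k V)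
    [DirectSum.Decomposition 𝒱] :
    ∃ h : symAlg 𝒱 ⟶ symObj (symAlg 𝒱), h ≫ counit (symAlg 𝒱) = 𝟙 _ := by
  refine ⟨symLift ((symAlg 𝒱).toSym ∘ₗ symι 𝒱) (fun n v hv => toSym_mem (symι_mem hv))
    fun v => mem_augIdeal.mp (toSym_mem_augIdeal _), symAlg_hom_ext fun v => ?_⟩
  rw [comp_toAlgHom, AlgHom.comp_apply, symLift_symι]
  exact counit_toSym (symι_mem_augIdeal v)

/-- The first differential of the complex of `A`. -/
theorem cotriple_d_zero (x : (symObj (symObj A)).indecGrading m) :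
    (Cotriple.d (symFunctor k) (symCounit k) (indecFunctor k m) A 0).hom x =
      indecLin m (counit (symObj A)) x - indecLin m (symObjMap (counit A)) x := by
  rw [Cotriple.d, Fin.sum_univ_two]
  simp only [Fin.val_zero, pow_zero, one_smul, Fin.val_one, pow_one, neg_smul, ← sub_eq_add_neg]
  rfl

theorem indecLin_counit_surjective : Function.Surjective (indecLin m (counit A)) := by
  intro x
  obtain ⟨a, ha, ha', rfl⟩ := exists_indecOf_eq x
  exact ⟨(symObj A).indecOf m (A.toSym a), by rw [indecLin_indecOf, counit_toSym ha']⟩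

theorem indecLin_counit_sub (x : (symObj (symObj A)).indecGrading m) :
    indecLin m (counit A)
      (indecLin m (counit (symObj A)) x - indecLin m (symObjMap (counit A)) x) = 0 := by
  rw [map_sub, ← indecLin_comp, ← indecLin_comp, symObjMap_comp_counit, sub_self]

/-- The sequence `Q S(I(S(I(A)))) → Q S(I(A)) → QA → 0` is exact: for `b` and `c` in
`I(A)`, the class of the generator `b c` is, up to sign, the boundary of the class of the generator
given by the product of the generators `b` and `c`. -/
theorem exists_indecLin_counit_sub_eq (x : (symObj A).indecGrading m)
    (hx : indecLin m (counit A) x = 0) :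
    ∃ y, indecLin m (counit (symObj A)) y - indecLin m (symObjMap (counit A)) y = x := by
  obtain ⟨a, ha, ha', rfl⟩ := exists_indecOf_toSym_eq x
  rw [indecLin_indecOf, counit_toSym ha', indecOf_eq_zero_iff ha ha'] at hx
  let N := (LinearMap.range
    (indecLin m (counit (symObj A)) - indecLin m (symObjMap (counit A)))).comap
      ((symObj A).indecOf m ∘ₗ A.toSym)
  suffices h : A.augIdeal * A.augIdeal ≤ N from h hx
  refine Submodule.mul_le.mpr fun b hb c hc => ?_
  refine ⟨-(symObj (symObj A)).indecOf m ((symObj A).toSym (A.toSym b * A.toSym c)), ?_⟩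
  rw [map_neg, LinearMap.sub_apply, indecLin_indecOf, indecLin_indecOf,
    counit_toSym (mul_mem_augIdeal _ (toSym_mem_augIdeal b)), symObjMap_toSym,
    map_mul (counit A).toAlgHom,
    counit_toSym hb, counit_toSym hc,
    indecOf_mul (toSym_mem_augIdeal b) (toSym_mem_augIdeal c), zero_sub, neg_neg]
  rfl

/-- The counit induces an isomorphism from the zeroth André-Quillen homology to the
indecomposables. -/
theorem exists_aqHomology_zero_iso (A : AugGrAlg.{u} k) (m : ℕ) :
    ∃ e : A.aqHomology 0 m ≅ (indecFunctor k m).obj A,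
      (A.aqComplex m).homologyπ 0 ≫ e.hom =
        (A.aqComplex m).iCycles 0 ≫ (indecFunctor k m).map ((symCounit k).app A) := by
  refine ChainComplex.exists_homology_zero_iso (A.aqComplex m)
    ((indecFunctor k m).map ((symCounit k).app A)) indecLin_counit_surjective fun x => ?_
  have hd : (A.aqComplex m).d 1 0 =
      Cotriple.d (symFunctor k) (symCounit k) (indecFunctor k m) A 0 :=
    Cotriple.complex_d _ _ _ _ _
  rw [hd]
  constructor
  · intro hx
    obtain ⟨y, hy⟩ := exists_indecLin_counit_sub_eq x hx
    exact ⟨y, (cotriple_d_zero y).trans hy⟩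
  · rintro ⟨y, rfl⟩
    exact (congrArg (indecLin m (counit A)) (cotriple_d_zero y)).trans (indecLin_counit_sub y)

end ZerothHomology

end AugGrAlg

/-! ### The biresolution of a simplicial algebra with a linear contraction -/

/-- The `n`-fold iterate of `G`, as a functor. -/
def Cotriple.iterFunctor {C : Type*} [Category C] (G : C ⥤ C) (n : ℕ) : C ⥤ C where
  obj X := iter G X n
  map f := iterMap G f n
  map_id X := iterMap_id G X n
  map_comp f g := iterMap_comp G f g n

namespace AugGrAlg

section LinearMorphisms

variable {k : Type} [Field k] {A B C : AugGrAlg.{u} k}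

/-- Linear maps compatible with degrees and augmentations, but not necessarily with products. -/
@[ext]
structure LinHom (A B : AugGrAlg.{u} k) where
  toLin : A.carrier →ₗ[k] B.carrier
  map_mem : ∀ n, ∀ a ∈ A.grading n, toLin a ∈ B.grading n
  aug_comp : ∀ a, B.aug (toLin a) = A.aug a

/-- The linear map underlying a morphism. -/
def Hom.toLinHom (f : A ⟶ B) : LinHom A B where
  toLin := f.toAlgHom.toLinearMap
  map_mem := f.map_mem
  aug_comp := f.aug_comp

/-- Composition of linear morphisms, in diagrammatic order. -/
def LinHom.comp (f : LinHom A B) (g : LinHom B C) : LinHom A C where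
  toLin := g.toLin ∘ₗ f.toLin
  map_mem n a ha := g.map_mem n _ (f.map_mem n a ha)
  aug_comp a := (g.aug_comp _).trans (f.aug_comp a)

/-- A linear morphism induces an algebra map between the symmetric algebras on the augmentation
ideals. -/
noncomputable def LinHom.sym (f : LinHom A B) : symObj A ⟶ symObj B :=
  symLift (𝒱 := A.idealGrading) (B.toSym ∘ₗ f.toLin ∘ₗ A.augIdeal.subtype)
    (fun n _ hv => toSym_mem (f.map_mem n _ hv)) fun _ => mem_augIdeal.mp (toSym_mem_augIdeal _)

theorem LinHom.sym_ι (f : LinHom A B) (v : A.augIdeal) :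
    f.sym.toAlgHom (symι A.idealGrading v) = B.toSym (f.toLin v) :=
  symLift_symι _ _ _ v

theorem LinHom.sym_comp (f : LinHom A B) (g : LinHom B C) : (f.comp g).sym = f.sym ≫ g.sym := by
  refine symAlg_hom_ext (𝒱 := A.idealGrading) fun v => ?_
  have hv : B.aug (f.toLin v) = 0 := (f.aug_comp v).trans v.2
  have h : B.toSym (f.toLin v) = symι B.idealGrading ⟨f.toLin v, hv⟩ :=
    congrArg (GrSymAlg.ι B.idealGrading) (B.idealProj_coe ⟨f.toLin v, hv⟩)
  refine (LinHom.sym_ι _ v).trans (Eq.trans ?_ (congrArg g.sym.toAlgHom (f.sym_ι v)).symm)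
  exact (g.sym_ι ⟨f.toLin v, hv⟩).symm.trans (congrArg g.sym.toAlgHom h.symm)

theorem Hom.sym_toLinHom (f : A ⟶ B) : (Hom.toLinHom f).sym = symObjMap f := by
  refine symAlg_hom_ext (𝒱 := A.idealGrading) fun v => (LinHom.sym_ι _ v).trans ?_
  have h : A.toSym v = symι A.idealGrading v :=
    congrArg (GrSymAlg.ι A.idealGrading) (A.idealProj_coe v)
  exact (symObjMap_toSym f v).symm.trans (congrArg (symObjMap f).toAlgHom h)

/-- The map `S^(n+1) A ⟶ S^(n+1) B` induced by a linear morphism. -/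
noncomputable def LinHom.symIter (f : LinHom A B) :
    (n : ℕ) → (Cotriple.iter (symFunctor k) A (n + 1) ⟶ Cotriple.iter (symFunctor k) B (n + 1))
  | 0 => f.sym
  | n + 1 => (symFunctor k).map (f.symIter n)

theorem LinHom.symIter_comp (f : LinHom A B) (g : LinHom B C) (n : ℕ) :
    (f.comp g).symIter n = f.symIter n ≫ g.symIter n := by
  induction n with
  | zero => exact sym_comp f g
  | succ n ih =>
    exact (congrArg (fun f => (symFunctor k).map f) ih).trans ((symFunctor k).map_comp _ _)

theorem Hom.symIter_toLinHom (f : A ⟶ B) (n : ℕ) :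
    (Hom.toLinHom f).symIter n = Cotriple.iterMap (symFunctor k) f (n + 1) := by
  induction n with
  | zero => exact Hom.sym_toLinHom f
  | succ n ih => exact congrArg (fun f => (symFunctor k).map f) ih

end LinearMorphisms

section AQTerm

variable {k : Type} [Field k] {A B C : AugGrAlg.{u} k}

/-- The degree `m` part of the term `Q S^(n+1) A` of the André-Quillen complex. -/
noncomputable def aqTerm (k : Type) [Field k] (m n : ℕ) : AugGrAlg.{u} k ⥤ ModuleCat.{u} k :=
  Cotriple.iterFunctor (symFunctor k) (n + 1) ⋙ indecFunctor k m

/-- The differential of the André-Quillen complex. -/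
noncomputable def aqD (A : AugGrAlg.{u} k) (m n : ℕ) :
    (aqTerm k m (n + 1)).obj A →ₗ[k] (aqTerm k m n).obj A :=
  (Cotriple.d (symFunctor k) (symCounit k) (indecFunctor k m) A n).hom

/-- The augmentation of the André-Quillen complex. -/
noncomputable def aqη (A : AugGrAlg.{u} k) (m : ℕ) :
    (aqTerm k m 0).obj A →ₗ[k] (indecFunctor k m).obj A :=
  indecLin m (counit A)

theorem aqD_aqD (m n : ℕ) (x) : aqD A m n (aqD A m (n + 1) x) = 0 :=
  congrArg (fun f => f.hom x)
    (Cotriple.d_comp_d (symFunctor k) (symCounit k) (indecFunctor k m) A n)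

theorem aqD_naturality (f : A ⟶ B) (m n : ℕ) (x) :
    aqD B m n (((aqTerm k m (n + 1)).map f).hom x) = ((aqTerm k m n).map f).hom (aqD A m n x) :=
  (congrArg (fun f => f.hom x)
    (Cotriple.d_naturality (symFunctor k) (symCounit k) (indecFunctor k m) f n)).symm

theorem aqη_naturality (f : A ⟶ B) (m : ℕ) (x) :
    aqη B m (((aqTerm k m 0).map f).hom x) = ((indecFunctor k m).map f).hom (aqη A m x) :=
  (indecLin_comp (symObjMap f) (counit B) x).symm.trans
    ((congrArg (fun f => indecLin m f x) (symObjMap_comp_counit f)).trans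
      (indecLin_comp (counit A) f x))

theorem aqη_aqD (m : ℕ) (x) : aqη A m (aqD A m 0 x) = 0 :=
  (congrArg (indecLin m (counit A)) (cotriple_d_zero x)).trans (indecLin_counit_sub x)

theorem aqη_surjective (m : ℕ) : Function.Surjective (aqη A m) :=
  indecLin_counit_surjective

theorem exists_aqD_zero_eq {m : ℕ} {x} (hx : aqη A m x = 0) : ∃ y, aqD A m 0 y = x := by
  obtain ⟨y, hy⟩ := exists_indecLin_counit_sub_eq x hx
  exact ⟨y, (cotriple_d_zero y).trans hy⟩

/-- The André-Quillen complex is exact in positive degrees if the counit has a section. -/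
theorem exists_aqD_succ_eq {h : A ⟶ symObj A} (hh : h ≫ counit A = 𝟙 A) {m n : ℕ} {x}
    (hx : aqD A m n x = 0) : ∃ y, aqD A m (n + 1) y = x := by
  let s (n : ℕ) : (aqTerm k m n).obj A →ₗ[k] (aqTerm k m (n + 1)).obj A :=
    ((indecFunctor k m).map (Cotriple.iterSection (symFunctor k) h (n + 1))).hom
  have h1 : aqD A m (n + 1) (s (n + 1) x) = s n (aqD A m n x) + (-1 : ℤ) ^ (n + 2) • x :=
    congrArg (fun f => f.hom x) (Cotriple.section_comp_d (symFunctor k) (symCounit k)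
      (indecFunctor k m) hh n)
  refine ⟨(-1 : ℤ) ^ (n + 2) • s (n + 1) x, ?_⟩
  rw [map_zsmul, h1, hx, map_zero, zero_add, smul_smul, ← mul_pow, neg_one_mul, neg_neg, one_pow,
    one_smul]

/-- The effect of a linear morphism on the terms of the André-Quillen complex. -/
noncomputable def LinHom.aqMap (f : LinHom A B) (m n : ℕ) :
    (aqTerm k m n).obj A →ₗ[k] (aqTerm k m n).obj B :=
  ((indecFunctor k m).map (f.symIter n)).hom

theorem LinHom.aqMap_comp (f : LinHom A B) (g : LinHom B C) (m n : ℕ) (x) :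
    g.aqMap m n (f.aqMap m n x) = (f.comp g).aqMap m n x := by
  refine (congrArg (fun f => f.hom x) ((indecFunctor k m).map_comp _ _)).symm.trans ?_
  rw [aqMap, symIter_comp]
  rfl

theorem aqTerm_map (f : A ⟶ B) (m n : ℕ) :
    ((aqTerm k m n).map f).hom = (Hom.toLinHom f).aqMap m n := by
  rw [LinHom.aqMap, Hom.symIter_toLinHom]
  rfl

theorem LinHom.aqMap_id (m n : ℕ) (x) : (Hom.toLinHom (𝟙 A)).aqMap m n x = x := by
  rw [← aqTerm_map, (aqTerm k m n).map_id]
  rfl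

end AQTerm

section Biresolution

variable {k : Type} [Field k] {A : AugGrAlg.{u} k}

/-- A simplicial algebra over `A` with a linear contraction onto `A`. -/
structure ContractibleOver (X : SimplicialObject (AugGrAlg.{u} k)) (A : AugGrAlg.{u} k) where
  aug : X.obj (.op (.mk 0)) ⟶ A
  s : ∀ n, LinHom (X.obj (.op (.mk n))) (X.obj (.op (.mk (n + 1))))
  sA : LinHom A (X.obj (.op (.mk 0)))
  δ_aug : X.δ 0 ≫ aug = X.δ 1 ≫ aug
  s_δ_zero : ∀ n, (s n).comp (Hom.toLinHom (X.δ 0)) = Hom.toLinHom (𝟙 _)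
  s_δ_succ : ∀ n (i : Fin (n + 2)),
    (s (n + 1)).comp (Hom.toLinHom (X.δ i.succ)) = (Hom.toLinHom (X.δ i)).comp (s n)
  s_δ_one : (s 0).comp (Hom.toLinHom (X.δ 1)) = (Hom.toLinHom aug).comp sA
  sA_aug : sA.comp (Hom.toLinHom aug) = Hom.toLinHom (𝟙 _)

variable {X : SimplicialObject (AugGrAlg.{u} k)}

/-- The André-Quillen complexes of the terms of a simplicial algebra form a double complex. One
direction is resolved since the terms are free, the other because linear maps act on the
André-Quillen complex, so that the contraction does. -/
theorem ContractibleOver.isBiresolution (H : ContractibleOver X A)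
    (hX : ∀ n, ∃ h : X.obj (.op (.mk n)) ⟶ symObj (X.obj (.op (.mk n))), h ≫ counit _ = 𝟙 _)
    (m : ℕ) :
    IsBiresolution (R := k) (P := fun i n => (aqTerm k m n).obj (X.obj (.op (.mk i))))
      (B := fun i => (indecFunctor k m).obj (X.obj (.op (.mk i))))
      (Z := fun n => (aqTerm k m n).obj A) (fun i n => aqD (X.obj (.op (.mk i))) m n)
      (fun i n => alternatingFaces X (aqTerm k m n) i) (fun i => aqη (X.obj (.op (.mk i))) m)
      (fun i => alternatingFaces X (indecFunctor k m) i)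
      (fun n => ((aqTerm k m n).map H.aug).hom) (fun n => aqD A m n) where
  dv_dv i n x := aqD_aqD m n x
  dh_dh i n x := alternatingFaces_alternatingFaces X _ i x
  dv_dh i n x := by
    simp only [alternatingFaces_apply, map_sum, map_zsmul, aqD_naturality]
  η_dv i x := aqη_aqD m x
  η_dh i x := by
    simp only [alternatingFaces_apply, map_sum, map_zsmul, aqη_naturality]
  a_dh n x := by
    have h (i : Fin 2) : ((aqTerm k m n).map H.aug).hom (((aqTerm k m n).map (X.δ i)).hom x) =
        ((aqTerm k m n).map (X.δ i ≫ H.aug)).hom x := by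
      rw [(aqTerm k m n).map_comp]
      rfl
    rw [alternatingFaces_apply, Fin.sum_univ_two, map_add, map_zsmul, map_zsmul, h, h, H.δ_aug]
    simp
  a_dv n x := (aqD_naturality H.aug m n x).symm
  η_surjective i := aqη_surjective m
  a_surjective n x :=
    ⟨H.sA.aqMap m n x, by rw [aqTerm_map, LinHom.aqMap_comp, H.sA_aug, LinHom.aqMap_id]⟩
  exact_η i x hx := exists_aqD_zero_eq hx
  exact_dv i n x hx := exists_aqD_succ_eq (hX i).choose_spec hx
  exact_a n x hx := by
    refine ⟨(H.s 0).aqMap m n x, ?_⟩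
    rw [aqTerm_map] at hx
    rw [alternatingFaces_apply, Fin.sum_univ_two, aqTerm_map, aqTerm_map, LinHom.aqMap_comp,
      LinHom.aqMap_comp, H.s_δ_zero, LinHom.aqMap_id, Fin.val_zero, pow_zero, one_smul, H.s_δ_one,
      ← LinHom.aqMap_comp, hx, map_zero, smul_zero, add_zero]
  exact_dh i n x hx := by
    refine ⟨(H.s (i + 1)).aqMap m n x, ?_⟩
    rw [alternatingFaces_contraction X (aqTerm k m n) (fun i => (H.s i).aqMap m n)
      (fun i x => ?_) (fun i j x => ?_) i x, hx, map_zero, sub_zero]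
    · rw [aqTerm_map, LinHom.aqMap_comp, H.s_δ_zero, LinHom.aqMap_id]
    · rw [aqTerm_map, LinHom.aqMap_comp, H.s_δ_succ, ← LinHom.aqMap_comp, aqTerm_map]

end Biresolution

/-! ### Free graded-commutative algebras on graded sets -/

section FreeAlg

variable (k : Type) [Field k] {σ : Type u} (deg : σ → ℕ)

/-- The grading of the vector space with basis `σ` in which the basis vector `i` has degree
`deg i`. -/
def basisGrading (n : ℕ) : Submodule k (σ →₀ k) := Finsupp.supported k k {i | deg i = n}

variable {deg} in
theorem single_mem_basisGrading (i : σ) (c : k) :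
    Finsupp.single i c ∈ basisGrading k deg (deg i) :=
  Finsupp.single_mem_supported k c rfl

/-- Auxiliary map for the decomposition of the vector space with basis `σ` into its homogeneous
parts. -/
noncomputable def basisDecompose : (σ →₀ k) →ₗ[k] DirectSum ℕ fun n => basisGrading k deg n :=
  Finsupp.lsum k fun i => DirectSum.lof k ℕ (fun n => basisGrading k deg n) (deg i) ∘ₗ
    (Finsupp.lsingle i).codRestrict _ (single_mem_basisGrading k i)

theorem basisDecompose_of_mem {n : ℕ} {v : σ →₀ k} (hv : v ∈ basisGrading k deg n) :
    basisDecompose k deg v = DirectSum.lof k ℕ (fun n => basisGrading k deg n) n ⟨v, hv⟩ := by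
  have hv' : v ∈ Submodule.span k ((fun i => Finsupp.single i (1 : k)) '' {i | deg i = n}) := by
    rw [← Finsupp.supported_eq_span_single]
    exact hv
  induction hv' using Submodule.span_induction with
  | mem v h =>
    obtain ⟨i, rfl, rfl⟩ := h
    rw [basisDecompose, Finsupp.lsum_single, LinearMap.comp_apply]
    rfl
  | zero =>
    rw [map_zero]
    exact (map_zero _).symm
  | add v w h h' ihv ihw =>
    rw [← Finsupp.supported_eq_span_single] at h h'
    rw [map_add, ihv h, ihw h', ← map_add]
    rfl
  | smul c v h ihv =>
    rw [← Finsupp.supported_eq_span_single] at h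
    rw [map_smul, ihv h, ← map_smul]
    rfl

noncomputable instance : DirectSum.Decomposition (basisGrading k deg) :=
  DirectSum.Decomposition.ofLinearMap _ (basisDecompose k deg)
    (by
      refine Finsupp.lhom_ext fun i c => ?_
      rw [LinearMap.comp_apply, basisDecompose_of_mem k deg (single_mem_basisGrading k i c),
        DirectSum.coeLinearMap_lof]
      rfl)
    (by
      ext n v : 2
      rw [LinearMap.comp_apply, LinearMap.comp_apply, DirectSum.coeLinearMap_lof,
        basisDecompose_of_mem k deg v.2]
      rfl)

/-- The free graded-commutative algebra on a graded set. -/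
noncomputable abbrev freeAlg : AugGrAlg.{u} k := symAlg (basisGrading k deg)

/-- The generators of the free algebra. -/
noncomputable def freeGen (i : σ) : (freeAlg k deg).carrier :=
  symι (basisGrading k deg) (Finsupp.single i 1)

variable {k deg}

theorem freeGen_mem (i : σ) : freeGen k deg i ∈ (freeAlg k deg).grading (deg i) :=
  symι_mem (single_mem_basisGrading k i 1)

theorem freeGen_mem_augIdeal (i : σ) : freeGen k deg i ∈ (freeAlg k deg).augIdeal :=
  symι_mem_augIdeal _

section Lift

variable {B : AugGrAlg.{u} k} (f : σ → B.carrier) (hf : ∀ i, f i ∈ B.grading (deg i))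
  (hf' : ∀ i, f i ∈ B.augIdeal)

include hf in
theorem linearCombination_mem (n : ℕ) (v : σ →₀ k) (hv : v ∈ basisGrading k deg n) :
    Finsupp.linearCombination k f v ∈ B.grading n := by
  rw [Finsupp.linearCombination_apply]
  refine Submodule.sum_mem _ fun i hi => Submodule.smul_mem _ _ ?_
  obtain rfl : deg i = n := hv hi
  exact hf i

/-- The universal property of the free algebra. -/
noncomputable def freeLift : freeAlg k deg ⟶ B :=
  symLift (Finsupp.linearCombination k f) (linearCombination_mem f hf) fun v => by
    rw [Finsupp.linearCombination_apply, Finsupp.sum, map_sum]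
    exact Finset.sum_eq_zero fun i _ => by rw [map_smul, mem_augIdeal.mp (hf' i), smul_zero]

@[simp]
theorem freeLift_freeGen (i : σ) : (freeLift f hf hf').toAlgHom (freeGen k deg i) = f i := by
  rw [freeLift, freeGen, symLift_symι, Finsupp.linearCombination_single, one_smul]

end Lift

/-- An algebra map out of the free algebra, to an algebra in which the images of the generators
commute up to the correct signs. -/
theorem exists_freeAlg_algHom {S : Type*} [Semiring S] [Algebra k S] (f : σ → S)
    (hf : ∀ i j, f i * f j = (-1 : k) ^ (deg i * deg j) • (f j * f i)) :
    ∃ F : (freeAlg k deg).carrier →ₐ[k] S, ∀ i, F (freeGen k deg i) = f i := by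
  refine ⟨GrSymAlg.lift (basisGrading k deg) (Finsupp.linearCombination k f)
    fun m n v w hv hw => ?_, fun i => ?_⟩
  · simp only [Finsupp.linearCombination_apply, Finsupp.sum, Finset.sum_mul_sum, Finset.smul_sum]
    rw [Finset.sum_comm]
    refine Finset.sum_congr rfl fun j hj => Finset.sum_congr rfl fun i hi => ?_
    obtain rfl : deg i = m := hv hi
    obtain rfl : deg j = n := hw hj
    rw [smul_mul_smul_comm, smul_mul_smul_comm, hf, smul_comm, mul_comm (v i)]
  · refine (GrSymAlg.lift_ι _ _ _ _).trans ?_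
    rw [Finsupp.linearCombination_single, one_smul]

theorem freeAlg_algHom_ext {S : Type*} [Semiring S] [Algebra k S]
    {F F' : (freeAlg k deg).carrier →ₐ[k] S}
    (h : ∀ i, F (freeGen k deg i) = F' (freeGen k deg i)) : F = F' := by
  suffices H : ∀ v, F (symι (basisGrading k deg) v) = F' (symι (basisGrading k deg) v) from
    GrSymAlg.algHom_ext (basisGrading k deg) H
  intro v
  induction v using Finsupp.induction_linear with
  | zero => simp only [map_zero]
  | add v w hv hw => simp only [map_add, hv, hw]
  | single i c =>
    rw [← mul_one c, ← smul_eq_mul, ← Finsupp.smul_single, map_smul, map_smul, map_smul]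
    exact congrArg _ (h i)

theorem adjoin_freeGen : Algebra.adjoin k (Set.range (freeGen k deg)) = ⊤ := by
  let S := Algebra.adjoin k (Set.range (freeGen k deg))
  let f (i : σ) : S := ⟨freeGen k deg i, Algebra.subset_adjoin ⟨i, rfl⟩⟩
  have hf (i j : σ) : f i * f j = (-1 : k) ^ (deg i * deg j) • (f j * f i) :=
    Subtype.ext ((freeAlg k deg).graded_comm (freeGen_mem i) (freeGen_mem j))
  obtain ⟨F, hF⟩ := exists_freeAlg_algHom (deg := deg) f hf
  have h : S.val.comp F = AlgHom.id k _ := freeAlg_algHom_ext fun i => by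
    rw [AlgHom.comp_apply, hF]
    rfl
  refine Algebra.eq_top_iff.mpr fun a => ?_
  have ha : (F a : (freeAlg k deg).carrier) = a := DFunLike.congr_fun h a
  rw [← ha]
  exact (F a).2

/-- A linear subspace of the free algebra that contains `1` and is stable under left multiplication
by the generators is everything. -/
theorem freeAlg_eq_top {N : Submodule k (freeAlg k deg).carrier} (h1 : 1 ∈ N)
    (h : ∀ i, ∀ a ∈ N, freeGen k deg i * a ∈ N) : N = ⊤ := by
  refine Submodule.eq_top_iff'.mpr fun a => ?_
  have ha : a ∈ Algebra.adjoin k (Set.range (freeGen k deg)) := by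
    rw [adjoin_freeGen]
    trivial
  suffices H : ∀ b ∈ N, a * b ∈ N by simpa using H 1 h1
  induction ha using Algebra.adjoin_induction with
  | mem a ha =>
    obtain ⟨i, rfl⟩ := ha
    exact h i
  | algebraMap c =>
    intro b hb
    rw [← Algebra.smul_def]
    exact N.smul_mem c hb
  | add x y _ _ hx hy =>
    intro b hb
    rw [add_mul]
    exact N.add_mem (hx b hb) (hy b hb)
  | mul x y _ _ hx hy =>
    intro b hb
    rw [mul_assoc]
    exact hx _ (hy b hb)

/-- The indecomposables of the free algebra are spanned by the classes of the generators. -/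
theorem indecGrading_freeAlg_hom_ext {m : ℕ} {M : Type*} [AddCommGroup M] [Module k M]
    {f f' : (freeAlg k deg).indecGrading m →ₗ[k] M}
    (h : ∀ i, f ((freeAlg k deg).indecOf m (freeGen k deg i)) =
      f' ((freeAlg k deg).indecOf m (freeGen k deg i))) : f = f' := by
  ext1 x
  obtain ⟨v, -, rfl⟩ := exists_indecOf_symι_eq m x
  induction v using Finsupp.induction_linear with
  | zero => simp only [map_zero]
  | add v w hv hw => simp only [map_add, hv, hw]
  | single i c =>
    rw [← mul_one c, ← smul_eq_mul, ← Finsupp.smul_single]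
    simp only [map_smul]
    exact congrArg _ (h i)

/-- The degree `m` part of the indecomposables of the free algebra has a basis consisting of the
classes of the generators of degree `m`. -/
theorem nonempty_indecGrading_freeAlg_equiv (deg : σ → ℕ) (m : ℕ) :
    Nonempty ((freeAlg k deg).indecGrading m ≃ₗ[k] ({i // deg i = m} →₀ k)) := by
  classical
  let ε : TrivSqZeroExt k (σ →₀ k) →ₗ[k] σ →₀ k := TrivSqZeroExt.sndHom k _
  obtain ⟨F, hF⟩ := exists_freeAlg_algHom (k := k) (deg := deg)
    (fun i => (TrivSqZeroExt.inr (Finsupp.single i 1) : TrivSqZeroExt k (σ →₀ k)))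
    fun i j => by rw [TrivSqZeroExt.inr_mul_inr, TrivSqZeroExt.inr_mul_inr, smul_zero]
  have haug (a) : (F a).fst = (freeAlg k deg).aug a := by
    have h : (TrivSqZeroExt.fstHom k k (σ →₀ k)).comp F = (freeAlg k deg).aug :=
      freeAlg_algHom_ext fun i => by
        rw [AlgHom.comp_apply, hF, mem_augIdeal.mp (freeGen_mem_augIdeal i)]
        rfl
    exact DFunLike.congr_fun h a
  let φ := indecDesc (A := freeAlg k deg) m (ε ∘ₗ F.toLinearMap) fun a ha b hb => by
    change (F (a * b)).snd = 0
    rw [map_mul, TrivSqZeroExt.snd_mul, haug, haug, mem_augIdeal.mp ha, mem_augIdeal.mp hb]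
    simp
  have hφ (i : σ) (hi : deg i = m) :
      φ ((freeAlg k deg).indecOf m (freeGen k deg i)) = Finsupp.single i 1 := by
    subst hi
    refine (indecDesc_indecOf _ _ (freeGen_mem i) (freeGen_mem_augIdeal i)).trans ?_
    change (F (freeGen k deg i)).snd = _
    rw [hF, TrivSqZeroExt.snd_inr]
  let ψ : ({i // deg i = m} →₀ k) →ₗ[k] (freeAlg k deg).indecGrading m :=
    Finsupp.linearCombination k fun i => (freeAlg k deg).indecOf m (freeGen k deg i.1)
  refine ⟨(LinearEquiv.ofBijective ψ ⟨?_, ?_⟩).symm⟩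
  · have h : φ ∘ₗ ψ = Finsupp.lmapDomain k k Subtype.val := by
      refine Finsupp.lhom_ext' fun i => LinearMap.ext_ring ?_
      simp only [LinearMap.comp_apply, Finsupp.lsingle_apply, ψ,
        Finsupp.linearCombination_single, one_smul, Finsupp.lmapDomain_apply,
        Finsupp.mapDomain_single]
      exact hφ i.1 i.2
    refine Function.Injective.of_comp (f := φ) ?_
    rw [← LinearMap.coe_comp, h]
    exact Finsupp.mapDomain_injective Subtype.val_injective
  · rw [← LinearMap.range_eq_top]
    have h : (LinearMap.range ψ).mkQ = 0 := by
      refine indecGrading_freeAlg_hom_ext fun i => ?_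
      rw [LinearMap.zero_apply, Submodule.mkQ_apply, Submodule.Quotient.mk_eq_zero]
      by_cases hi : deg i = m
      · exact ⟨Finsupp.single ⟨i, hi⟩ 1, by simp [ψ]⟩
      · rw [indecOf_of_mem_ne (freeGen_mem i) hi]
        exact zero_mem _
    rw [← Submodule.ker_mkQ (LinearMap.range ψ), h, LinearMap.ker_zero]

end FreeAlg

/-! ### Bases of monomials and the associated relative algebras -/

section MonogenicBasis

variable {p : ℕ} [Fact p.Prime]

/-- A family of homogeneous generators of `A` of positive degree whose ordered monomials with
exponents bounded by the heights form a basis of `A`. A Borel decomposition gives such a family; the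
exterior generators are those of odd degree if `p` is odd. -/
structure MonogenicBasis (A : AugGrAlg.{u} (ZMod p)) (ι : Type v) [LinearOrder ι] where
  deg : ι → ℕ
  gen : ι → A.carrier
  height : ι → ℕ∞
  deg_pos : ∀ i, 0 < deg i
  gen_mem : ∀ i, gen i ∈ A.grading (deg i)
  two_le_height : ∀ i, 2 ≤ height i
  height_of_odd : ∀ i, ¬ (Even (deg i) ∨ p = 2) → height i = 2
  pow_height : ∀ i, ∀ h : ℕ, height i = h → gen i ^ h = 0
  linearIndependent : LinearIndependent (ZMod p)
    fun s : restricted height => orderedMonomial gen s.1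
  span_eq_top : Submodule.span (ZMod p)
    (Set.range fun s : restricted height => orderedMonomial gen s.1) = ⊤

/-- A set with two distinct base points. -/
structure Bipointed where
  W : Type
  zero : W
  one : W
  zero_ne_one : zero ≠ one

theorem commute_of_even {B : AugGrAlg.{u} (ZMod p)} {n : ℕ} {b : B.carrier} (hb : b ∈ B.grading n)
    (hn : Even n ∨ p = 2) (a : B.carrier) : Commute b a := by
  induction a using DirectSum.Decomposition.inductionOn B.grading with
  | zero => exact Commute.zero_right b
  | @homogeneous i a =>
    refine (B.graded_comm hb a.2).trans ?_
    have h : (-1 : ZMod p) ^ (n * i) = 1 := by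
      rcases hn with hn | rfl
      · exact (hn.mul_right i).neg_one_pow
      · rw [show (-1 : ZMod 2) = 1 from rfl, one_pow]
    rw [h, one_smul]
  | add x y hx hy => exact hx.add_right hy

variable {A : AugGrAlg.{u} (ZMod p)} {ι : Type v} [LinearOrder ι]

namespace MonogenicBasis

variable (M : A.MonogenicBasis ι)

/-- The truncated polynomial generators. -/
abbrev Trunc : Type v := {i : ι // (Even (M.deg i) ∨ p = 2) ∧ M.height i ≠ ⊤}

/-- The height of a truncated polynomial generator. -/
noncomputable def bound (t : M.Trunc) : ℕ := (M.height t.1).toNat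

theorem coe_bound (t : M.Trunc) : (M.bound t : ℕ∞) = M.height t.1 :=
  ENat.natCast_toNat t.2.2

theorem two_le_bound (t : M.Trunc) : 2 ≤ M.bound t := by
  have h := M.two_le_height t.1
  rw [← M.coe_bound t] at h
  exact_mod_cast h

theorem gen_pow_bound (t : M.Trunc) : M.gen t.1 ^ M.bound t = 0 :=
  M.pow_height t.1 _ (M.coe_bound t).symm

theorem gen_mem_augIdeal (i : ι) : M.gen i ∈ A.augIdeal :=
  A.aug_eq_zero (M.deg_pos i).ne' (M.gen_mem i)

variable [Small.{u} ι]

/-- The generators of `relAlg`: a generator `x_i` for each generator of `A`, and, for each truncated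
polynomial generator `x_t`, a generator `y_{t, w}` for each `w` that is not a base point. -/
abbrev relIndex (P : Bipointed) : Type u :=
  Shrink.{u} ι ⊕ Shrink.{u} M.Trunc × {w : P.W // w ≠ P.zero ∧ w ≠ P.one}

/-- The degrees of the generators of `relAlg`. -/
noncomputable def relDeg (P : Bipointed) : M.relIndex P → ℕ :=
  Sum.elim (fun j => M.deg ((equivShrink ι).symm j)) fun tw =>
    M.bound ((equivShrink M.Trunc).symm tw.1) * M.deg ((equivShrink M.Trunc).symm tw.1).1

/-- The free graded-commutative algebra on the generators `x_i` of `A` and generators `y_{t, w}` of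
degree `N |x_t|`, for `x_t` truncated of height `N` and `w` not a base point. It is functorial in
the bipointed set, if one puts `y_{t, 0} = 0` and `y_{t, 1} = x_t ^ N`. -/
noncomputable abbrev relAlg (P : Bipointed) : AugGrAlg.{u} (ZMod p) := freeAlg (ZMod p) (M.relDeg P)

variable (P : Bipointed)

/-- The element `x_i` of `relAlg`. -/
noncomputable def xGen (i : ι) : (M.relAlg P).carrier :=
  freeGen (ZMod p) (M.relDeg P) (.inl (equivShrink ι i))

open scoped Classical in
/-- The element `y_{t, w}` of `relAlg`, which is `0` or `x_t ^ N` if `w` is a base point. -/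
noncomputable def yGen (t : M.Trunc) (w : P.W) : (M.relAlg P).carrier :=
  if h : w ≠ P.zero ∧ w ≠ P.one then
    freeGen (ZMod p) (M.relDeg P) (.inr (equivShrink M.Trunc t, ⟨w, h⟩))
  else if w = P.zero then 0 else M.xGen P t.1 ^ M.bound t

theorem yGen_zero (t : M.Trunc) : M.yGen P t P.zero = 0 := by simp [yGen]

theorem yGen_one (t : M.Trunc) : M.yGen P t P.one = M.xGen P t.1 ^ M.bound t := by
  simp [yGen, P.zero_ne_one.symm]

theorem yGen_of_ne (t : M.Trunc) {w : P.W} (h : w ≠ P.zero ∧ w ≠ P.one) :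
    M.yGen P t w = freeGen (ZMod p) (M.relDeg P) (.inr (equivShrink M.Trunc t, ⟨w, h⟩)) :=
  dif_pos h

theorem xGen_mem (i : ι) : M.xGen P i ∈ (M.relAlg P).grading (M.deg i) := by
  have h := freeGen_mem (k := ZMod p) (deg := M.relDeg P) (.inl (equivShrink ι i))
  have h' : M.relDeg P (.inl (equivShrink ι i)) = M.deg i :=
    congrArg M.deg ((equivShrink ι).symm_apply_apply i)
  rwa [h'] at h

theorem xGen_mem_augIdeal (i : ι) : M.xGen P i ∈ (M.relAlg P).augIdeal :=
  freeGen_mem_augIdeal _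

/-- Induction on the points of a bipointed set. -/
theorem _root_.AugGrAlg.Bipointed.cases {P : Bipointed} {C : P.W → Prop} (w : P.W)
    (zero : C P.zero) (one : C P.one) (ne : ∀ w, w ≠ P.zero ∧ w ≠ P.one → C w) : C w := by
  by_cases h0 : w = P.zero
  · exact h0 ▸ zero
  by_cases h1 : w = P.one
  · exact h1 ▸ one
  exact ne w ⟨h0, h1⟩

theorem yGen_mem (t : M.Trunc) (w : P.W) :
    M.yGen P t w ∈ (M.relAlg P).grading (M.bound t * M.deg t.1) := by
  induction w using Bipointed.cases with
  | zero =>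
    rw [yGen_zero]
    exact zero_mem _
  | one =>
    rw [yGen_one]
    exact SetLike.pow_mem_graded _ (M.xGen_mem P t.1)
  | ne w h =>
    have h1 := freeGen_mem (k := ZMod p) (deg := M.relDeg P) (.inr (equivShrink M.Trunc t, ⟨w, h⟩))
    have h2 : M.relDeg P (.inr (equivShrink M.Trunc t, ⟨w, h⟩)) = M.bound t * M.deg t.1 :=
      congrArg (fun t => M.bound t * M.deg t.1) ((equivShrink M.Trunc).symm_apply_apply t)
    rw [h2] at h1
    rwa [yGen_of_ne M P t h]

theorem yGen_mem_augIdeal (t : M.Trunc) (w : P.W) : M.yGen P t w ∈ (M.relAlg P).augIdeal := by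
  refine (M.relAlg P).aug_eq_zero ?_ (M.yGen_mem P t w)
  exact (Nat.mul_pos (by have := M.two_le_bound t; lia) (M.deg_pos t.1)).ne'

theorem yGen_commute (t : M.Trunc) (w : P.W) (a : (M.relAlg P).carrier) :
    Commute (M.yGen P t w) a :=
  commute_of_even (M.yGen_mem P t w) (t.2.1.imp_left fun h => h.mul_left _) a

variable {P}

/-- A statement about the generators of `relAlg` holds if it holds for the `x_i` and for the
`y_{t, w}` with `w` not a base point. -/
theorem relGen_cases {C : (M.relAlg P).carrier → Prop} (hx : ∀ i, C (M.xGen P i))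
    (hy : ∀ t w, w ≠ P.zero ∧ w ≠ P.one → C (M.yGen P t w)) (j : M.relIndex P) :
    C (freeGen (ZMod p) (M.relDeg P) j) := by
  rcases j with j | ⟨t, w, hw⟩
  · have h := hx ((equivShrink ι).symm j)
    rwa [xGen, Equiv.apply_symm_apply] at h
  · have h := hy ((equivShrink M.Trunc).symm t) w hw
    rwa [yGen_of_ne M P _ hw, Equiv.apply_symm_apply] at h

theorem relAlg_algHom_ext {S : Type*} [Semiring S] [Algebra (ZMod p) S]
    {F F' : (M.relAlg P).carrier →ₐ[ZMod p] S} (hx : ∀ i, F (M.xGen P i) = F' (M.xGen P i))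
    (hy : ∀ t w, w ≠ P.zero ∧ w ≠ P.one → F (M.yGen P t w) = F' (M.yGen P t w)) : F = F' :=
  freeAlg_algHom_ext (M.relGen_cases (C := fun a => F a = F' a) hx hy)

theorem relAlg_hom_ext {B : AugGrAlg.{u} (ZMod p)} {f f' : M.relAlg P ⟶ B}
    (hx : ∀ i, f.toAlgHom (M.xGen P i) = f'.toAlgHom (M.xGen P i))
    (hy : ∀ t w, w ≠ P.zero ∧ w ≠ P.one →
      f.toAlgHom (M.yGen P t w) = f'.toAlgHom (M.yGen P t w)) : f = f' :=
  hom_ext (M.relAlg_algHom_ext hx hy)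

theorem indecGrading_relAlg_hom_ext {m : ℕ} {E : Type*} [AddCommGroup E] [Module (ZMod p) E]
    {f f' : (M.relAlg P).indecGrading m →ₗ[ZMod p] E}
    (hx : ∀ i, f ((M.relAlg P).indecOf m (M.xGen P i)) = f' ((M.relAlg P).indecOf m (M.xGen P i)))
    (hy : ∀ t w, w ≠ P.zero ∧ w ≠ P.one → f ((M.relAlg P).indecOf m (M.yGen P t w)) =
      f' ((M.relAlg P).indecOf m (M.yGen P t w))) : f = f' :=
  indecGrading_freeAlg_hom_ext (M.relGen_cases (C := fun a => f ((M.relAlg P).indecOf m a) =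
    f' ((M.relAlg P).indecOf m a)) hx hy)

section Lift

variable {B : AugGrAlg.{u} (ZMod p)} (a : ι → B.carrier) (b : M.Trunc → P.W → B.carrier)
  (ha : ∀ i, a i ∈ B.grading (M.deg i)) (hb : ∀ t w, b t w ∈ B.grading (M.bound t * M.deg t.1))
  (h0 : ∀ t, b t P.zero = 0) (h1 : ∀ t, b t P.one = a t.1 ^ M.bound t)

/-- The universal property of `relAlg`. -/
noncomputable def relLift : M.relAlg P ⟶ B :=
  freeLift (Sum.elim (fun j => a ((equivShrink ι).symm j))
      fun tw => b ((equivShrink M.Trunc).symm tw.1) tw.2)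
    (by
      rintro (j | ⟨t, w⟩)
      · exact ha _
      · exact hb _ _)
    (by
      rintro (j | ⟨t, w⟩)
      · exact B.aug_eq_zero (M.deg_pos _).ne' (ha _)
      · refine B.aug_eq_zero ?_ (hb ((equivShrink M.Trunc).symm t) w)
        have := M.two_le_bound ((equivShrink M.Trunc).symm t)
        exact (Nat.mul_pos (by lia) (M.deg_pos _)).ne')

@[simp]
theorem relLift_xGen (i : ι) : (M.relLift a b ha hb).toAlgHom (M.xGen P i) = a i := by
  rw [relLift, xGen, freeLift_freeGen, Sum.elim_inl, Equiv.symm_apply_apply]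

include h0 h1 in
theorem relLift_yGen (t : M.Trunc) (w : P.W) :
    (M.relLift a b ha hb).toAlgHom (M.yGen P t w) = b t w := by
  induction w using Bipointed.cases with
  | zero => rw [yGen_zero, map_zero, h0]
  | one => rw [yGen_one, map_pow, relLift_xGen, h1]
  | ne w h => rw [yGen_of_ne M P t h, relLift, freeLift_freeGen, Sum.elim_inr,
      Equiv.symm_apply_apply]

end Lift

/-- The augmentation `relAlg ⟶ A`, sending `x_i` to the corresponding generator of `A` and
`y_{t, w}` to `0`. -/
noncomputable def relAug (P : Bipointed) : M.relAlg P ⟶ A :=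
  M.relLift M.gen (fun _ _ => 0) M.gen_mem fun _ _ => zero_mem _

theorem relAug_xGen (i : ι) : (M.relAug P).toAlgHom (M.xGen P i) = M.gen i :=
  M.relLift_xGen _ _ _ _ i

theorem relAug_yGen (t : M.Trunc) (w : P.W) : (M.relAug P).toAlgHom (M.yGen P t w) = 0 :=
  M.relLift_yGen _ _ _ _ (fun _ => rfl) (fun t => (M.gen_pow_bound t).symm) t w

section Map

variable {P' P'' : Bipointed} (φ : P.W → P'.W) (h0 : φ P.zero = P'.zero) (h1 : φ P.one = P'.one)

/-- The algebra map induced by a map of bipointed sets. -/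
noncomputable def relMap : M.relAlg P ⟶ M.relAlg P' :=
  M.relLift (M.xGen P') (fun t w => M.yGen P' t (φ w)) (M.xGen_mem P')
    fun t w => M.yGen_mem P' t (φ w)

theorem relMap_xGen (i : ι) : (M.relMap φ).toAlgHom (M.xGen P i) = M.xGen P' i :=
  M.relLift_xGen _ _ _ _ i

include h0 h1 in
theorem relMap_yGen (t : M.Trunc) (w : P.W) :
    (M.relMap φ).toAlgHom (M.yGen P t w) = M.yGen P' t (φ w) :=
  M.relLift_yGen _ _ _ _ (fun t => by rw [h0, yGen_zero]) (fun t => by rw [h1, yGen_one]) t w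

end Map

end MonogenicBasis

end MonogenicBasis

/-! ### Monomial bases of the relative algebras -/

theorem _root_.LinearIndependent.of_eq_units_smul {k E κ : Type*} [Field k] [AddCommGroup E]
    [Module k E] {v w : κ → E} (hv : LinearIndependent k v) (h : ∀ i, ∃ c : ℤˣ, w i = c • v i) :
    LinearIndependent k w := by
  choose c hc using h
  have hw : w = (fun i => Units.map (Int.castRingHom k).toMonoidHom (c i)) • v := by
    ext i
    rw [hc i]
    exact (Int.cast_smul_eq_zsmul k (c i : ℤ) (v i)).symm
  rw [hw]
  exact hv.units_smul _

namespace MonogenicBasis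

variable {p : ℕ} [Fact p.Prime] {A : AugGrAlg.{u} (ZMod p)} {ι : Type v} [LinearOrder ι]
  (M : A.MonogenicBasis ι) {P : Bipointed}

/-- The exponents of a basis of `relAlg`: the exponents of `x_i` are bounded by the height of `x_i`,
and `y_{t, 0} = 0` does not occur (but `y_{t, 1} = x_t ^ N` does). -/
def relExponents (P : Bipointed) : Set ((ι →₀ ℕ) × (M.Trunc × P.W →₀ ℕ)) :=
  {sm | sm.1 ∈ restricted M.height ∧ ∀ t, sm.2 (t, P.zero) = 0}

open scoped Classical in
/-- The exponents of the commuting variables in the image of `x_i` under the map of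
`relAlg` to a polynomial ring over `A` that is used to compare monomials. -/
noncomputable def xExponent (P : Bipointed) (i : ι) : ι ⊕ M.Trunc × P.W →₀ ℕ :=
  if Even (M.deg i) ∨ p = 2 then Finsupp.single (.inl i) 1 else 0

open scoped Classical in
/-- The coefficient in the image of `x_i` under that map. -/
noncomputable def xCoefficient (i : ι) : A.carrier :=
  if Even (M.deg i) ∨ p = 2 then 1 else M.gen i

open scoped Classical in
/-- The exponents of the image of `y_{t, w}` under that map. -/
noncomputable def yExponent (P : Bipointed) (tw : M.Trunc × P.W) : ι ⊕ M.Trunc × P.W →₀ ℕ :=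
  if tw.2 = P.one then M.bound tw.1 • Finsupp.single (.inl tw.1.1) 1 else Finsupp.single (.inr tw) 1

/-- The restriction of an exponent to the generators of odd degree. -/
noncomputable def oddPart (s : ι →₀ ℕ) : ι →₀ ℕ := by
  classical
  exact s.filter fun i => ¬ (Even (M.deg i) ∨ p = 2)

theorem orderedMonomial_xCoefficient (s : ι →₀ ℕ) :
    ∃ c : ℤˣ, orderedMonomial M.xCoefficient s = c • orderedMonomial M.gen (M.oddPart s) := by
  classical
  have hsc : SignCommuting M.xCoefficient := fun i j => by
    by_cases hi : Even (M.deg i) ∨ p = 2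
    · exact ⟨1, by rw [xCoefficient, if_pos hi, one_mul, mul_one, one_smul]⟩
    by_cases hj : Even (M.deg j) ∨ p = 2
    · exact ⟨1, by rw [xCoefficient, xCoefficient, if_pos hj, one_mul, mul_one, one_smul]⟩
    · rw [xCoefficient, xCoefficient, if_neg hi, if_neg hj]
      exact ⟨_, mul_eq_units_smul (M.gen_mem i) (M.gen_mem j)⟩
  obtain ⟨c, hc⟩ := hsc.monomial_add (s.filter fun i => Even (M.deg i) ∨ p = 2)
    (s.filter fun i => ¬ (Even (M.deg i) ∨ p = 2))
  rw [Finsupp.filter_add_filter_not] at hc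
  refine ⟨c, hc.trans (congrArg _ ?_)⟩
  have h1 : orderedMonomial M.xCoefficient (s.filter fun i => Even (M.deg i) ∨ p = 2) = 1 := by
    refine List.prod_eq_one fun x hx => ?_
    obtain ⟨i, hi, rfl⟩ := List.mem_map.mp hx
    rw [Finset.mem_sort, Finsupp.support_filter, Finset.mem_filter] at hi
    rw [xCoefficient, if_pos hi.2, one_pow]
  rw [h1, one_mul, oddPart, orderedMonomial, orderedMonomial]
  refine congrArg List.prod (List.map_congr_left fun i hi => ?_)
  rw [Finset.mem_sort, Finsupp.support_filter, Finset.mem_filter] at hi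
  rw [xCoefficient, if_neg hi.2]

/-- The exponents of the image of a monomial. -/
noncomputable def relExponent (P : Bipointed) (sm : (ι →₀ ℕ) × (M.Trunc × P.W →₀ ℕ)) :
    ι ⊕ M.Trunc × P.W →₀ ℕ :=
  (sm.1.sum fun i n => n • M.xExponent P i) + sm.2.sum fun tw n => n • M.yExponent P tw

theorem sum_xExponent_apply (s : ι →₀ ℕ) (j : ι ⊕ M.Trunc × P.W) :
    (s.sum fun i n => n • M.xExponent P i) j =
      Sum.elim (fun i => s i - M.oddPart s i) (fun _ => 0) j := by
  classical
  induction s using Finsupp.induction_linear with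
  | zero => rcases j with i | tw <;> simp [oddPart]
  | add s s' h h' =>
    rw [Finsupp.sum_add_index' (h := fun i n => n • M.xExponent P i) (fun _ => zero_smul _ _)
      fun _ _ _ => add_smul _ _ _, Finsupp.add_apply, h, h']
    rcases j with i | tw
    · simp only [Sum.elim_inl, oddPart, Finsupp.filter_apply, Finsupp.add_apply]
      split_ifs <;> lia
    · rfl
  | single i n =>
    rw [Finsupp.sum_single_index (h := fun i n => n • M.xExponent P i) (zero_smul _ _)]
    rcases j with j | tw
    · simp only [Sum.elim_inl, oddPart, Finsupp.filter_apply, xExponent, Finsupp.smul_apply,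
        smul_eq_mul]
      by_cases hij : i = j
      · subst hij
        split_ifs <;> simp
      · rw [Finsupp.single_eq_of_ne' hij]
        split_ifs <;> simp [hij]
    · simp only [Sum.elim_inr, xExponent, Finsupp.smul_apply]
      split_ifs <;> simp

theorem sum_yExponent_inr (m : M.Trunc × P.W →₀ ℕ) (t : M.Trunc) {w : P.W} (hw : w ≠ P.one) :
    (m.sum fun tw n => n • M.yExponent P tw) (.inr (t, w)) = m (t, w) := by
  classical
  induction m using Finsupp.induction_linear with
  | zero => rfl
  | add m m' h h' =>
    rw [Finsupp.sum_add_index' (h := fun tw n => n • M.yExponent P tw) (fun _ => zero_smul _ _)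
      fun _ _ _ => add_smul _ _ _, Finsupp.add_apply, h, h', Finsupp.add_apply]
  | single tw n =>
    rw [Finsupp.sum_single_index (h := fun tw n => n • M.yExponent P tw) (zero_smul _ _),
      yExponent, Finsupp.smul_apply, smul_eq_mul]
    split_ifs with h
    · rw [Finsupp.smul_apply, Finsupp.single_eq_of_ne (by simp), Finsupp.single_eq_of_ne, smul_zero,
        mul_zero]
      rintro rfl
      exact hw h
    · simp [Finsupp.single_apply]

theorem sum_yExponent_inl (m : M.Trunc × P.W →₀ ℕ) (i : ι) :
    (m.sum fun tw n => n • M.yExponent P tw) (.inl i) =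
      if h : (Even (M.deg i) ∨ p = 2) ∧ M.height i ≠ ⊤ then
        M.bound ⟨i, h⟩ * m (⟨i, h⟩, P.one) else 0 := by
  classical
  induction m using Finsupp.induction_linear with
  | zero => simp
  | add m m' h h' =>
    rw [Finsupp.sum_add_index' (h := fun tw n => n • M.yExponent P tw) (fun _ => zero_smul _ _)
      fun _ _ _ => add_smul _ _ _, Finsupp.add_apply, h, h']
    split_ifs
    · rw [Finsupp.add_apply, mul_add]
    · rfl
  | single tw n =>
    obtain ⟨t, w⟩ := tw
    rw [Finsupp.sum_single_index (h := fun tw n => n • M.yExponent P tw) (zero_smul _ _),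
      yExponent, Finsupp.smul_apply, smul_eq_mul]
    dsimp only
    by_cases hw : w = P.one
    · subst hw
      rw [if_pos rfl, Finsupp.smul_apply, smul_eq_mul]
      by_cases hi : t.1 = i
      · subst hi
        rw [dif_pos t.2, Finsupp.single_eq_same, Finsupp.single_eq_same, mul_one, mul_comm]
      · rw [Finsupp.single_eq_of_ne (by simpa using fun h => hi h.symm), mul_zero, mul_zero]
        split_ifs with h
        · rw [Finsupp.single_eq_of_ne, mul_zero]
          rintro ⟨⟩
          exact hi rfl
        · rfl
    · rw [if_neg hw, Finsupp.single_eq_of_ne (by simp), mul_zero]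
      split_ifs with h
      · rw [Finsupp.single_eq_of_ne, mul_zero]
        rintro ⟨⟩
        exact hw rfl
      · rfl

/-- The image of a basis monomial determines the monomial: the exponents of `x_t` and
`y_{t, 1} = x_t ^ N` are the remainder and the quotient modulo `N` of the exponent of `x_t`. -/
theorem eq_of_relExponent_eq {sm sm' : (ι →₀ ℕ) × (M.Trunc × P.W →₀ ℕ)}
    (h : sm ∈ M.relExponents P) (h' : sm' ∈ M.relExponents P)
    (he : M.relExponent P sm = M.relExponent P sm') (ho : M.oddPart sm.1 = M.oddPart sm'.1) :
    sm = sm' := by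
  classical
  obtain ⟨s, m⟩ := sm
  obtain ⟨s', m'⟩ := sm'
  have hs : ∀ i, (s i : ℕ∞) < M.height i := h.1
  have hs' : ∀ i, (s' i : ℕ∞) < M.height i := h'.1
  have hm (t : M.Trunc) (w : P.W) (hw : w ≠ P.one) : m (t, w) = m' (t, w) := by
    have h1 := DFunLike.congr_fun he (.inr (t, w))
    rw [relExponent, relExponent, Finsupp.add_apply, Finsupp.add_apply, sum_xExponent_apply,
      sum_xExponent_apply, sum_yExponent_inr M m t hw, sum_yExponent_inr M m' t hw] at h1
    simpa using h1
  have hi (i : ι) : s i = s' i ∧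
      ∀ hi, m (⟨i, hi⟩, P.one) = m' (⟨i, hi⟩, P.one) := by
    have h1 := DFunLike.congr_fun he (.inl i)
    have h2 := DFunLike.congr_fun ho i
    rw [relExponent, relExponent, Finsupp.add_apply, Finsupp.add_apply, sum_xExponent_apply,
      sum_xExponent_apply, sum_yExponent_inl M m i, sum_yExponent_inl M m' i] at h1
    simp only [Sum.elim_inl, oddPart, Finsupp.filter_apply] at h1 h2
    by_cases ht : (Even (M.deg i) ∨ p = 2) ∧ M.height i ≠ ⊤
    · rw [dif_pos ht, dif_pos ht, if_neg (not_not.mpr ht.1), if_neg (not_not.mpr ht.1),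
        Nat.sub_zero, Nat.sub_zero] at h1
      have h3 := hs i
      have h4 := hs' i
      have h5 := M.coe_bound ⟨i, ht⟩
      dsimp only at h5
      rw [← h5] at h3 h4
      replace h3 : s i < M.bound ⟨i, ht⟩ := by exact_mod_cast h3
      replace h4 : s' i < M.bound ⟨i, ht⟩ := by exact_mod_cast h4
      have h6 := congrArg (· % M.bound ⟨i, ht⟩) h1
      have h7 := congrArg (· / M.bound ⟨i, ht⟩) h1
      have hpos : 0 < M.bound ⟨i, ht⟩ := by lia
      simp only [Nat.add_mul_mod_self_left, Nat.mod_eq_of_lt h3, Nat.mod_eq_of_lt h4] at h6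
      simp only [Nat.add_mul_div_left _ _ hpos, Nat.div_eq_of_lt h3, Nat.div_eq_of_lt h4,
        zero_add] at h7
      exact ⟨h6, fun _ => h7⟩
    · rw [dif_neg ht, dif_neg ht] at h1
      refine ⟨?_, fun h => absurd h ht⟩
      split_ifs at h1 h2 <;> lia
  refine Prod.ext (Finsupp.ext fun i => (hi i).1) (Finsupp.ext fun tw => ?_)
  by_cases hw : tw.2 = P.one
  · obtain ⟨t, w⟩ := tw
    dsimp only at hw
    subst hw
    exact (hi t.1).2 t.2
  · exact hm _ _ hw

variable [Small.{u} ι] (P : Bipointed)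

/-- The `y_{t, w}` as elements of the center of `relAlg`. -/
noncomputable def yCentral (tw : M.Trunc × P.W) : Subalgebra.center (ZMod p) (M.relAlg P).carrier :=
  ⟨M.yGen P tw.1 tw.2, Subalgebra.mem_center_iff.mpr fun a =>
    (M.yGen_commute P tw.1 tw.2 a).eq.symm⟩

/-- The monomials in the `y_{t, w}`. -/
noncomputable def yMon (m : M.Trunc × P.W →₀ ℕ) : (M.relAlg P).carrier :=
  ((m.prod fun tw n => M.yCentral P tw ^ n : Subalgebra.center (ZMod p) (M.relAlg P).carrier) :
    (M.relAlg P).carrier)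

theorem yMon_zero : M.yMon P 0 = 1 := by
  rw [yMon, Finsupp.prod_zero_index]
  rfl

theorem yMon_add (m m' : M.Trunc × P.W →₀ ℕ) : M.yMon P (m + m') = M.yMon P m * M.yMon P m' := by
  rw [yMon, Finsupp.prod_add_index' (fun _ => pow_zero _) (fun _ _ _ => pow_add _ _ _)]
  rfl

theorem yMon_single (t : M.Trunc) (w : P.W) (n : ℕ) :
    M.yMon P (Finsupp.single (t, w) n) = M.yGen P t w ^ n := by
  rw [yMon, Finsupp.prod_single_index (h := fun tw n => M.yCentral P tw ^ n) (pow_zero _)]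
  rfl

/-- The degree of a monomial in the `y_{t, w}`. -/
noncomputable def yWeight : (M.Trunc × P.W →₀ ℕ) →+ ℕ :=
  (Finsupp.weight fun tw : M.Trunc × P.W => M.bound tw.1 * M.deg tw.1.1)

theorem yMon_mem (m : M.Trunc × P.W →₀ ℕ) :
    M.yMon P m ∈ (M.relAlg P).grading (M.yWeight P m) := by
  induction m using Finsupp.induction_linear with
  | zero =>
    rw [yMon_zero, map_zero]
    exact SetLike.GradedOne.one_mem
  | add m m' hm hm' =>
    rw [yMon_add, map_add]
    exact SetLike.mul_mem_graded hm hm'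
  | single tw n =>
    rw [yMon_single, yWeight, Finsupp.weight_single]
    exact SetLike.pow_mem_graded n (M.yGen_mem P tw.1 tw.2)

/-- The monomials in the `x_i` and the `y_{t, w}`. -/
noncomputable def relMonomial (sm : (ι →₀ ℕ) × (M.Trunc × P.W →₀ ℕ)) : (M.relAlg P).carrier :=
  orderedMonomial (M.xGen P) sm.1 * M.yMon P sm.2

variable {P}

theorem xGen_mul_relMonomial_mem (i : ι) {sm : (ι →₀ ℕ) × (M.Trunc × P.W →₀ ℕ)}
    (h : sm ∈ M.relExponents P) :
    M.xGen P i * M.relMonomial P sm ∈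
      Submodule.span (ZMod p) (M.relMonomial P '' M.relExponents P) := by
  classical
  obtain ⟨s, m⟩ := sm
  obtain ⟨hs, hm⟩ := h
  dsimp only at hs hm
  have hx := signCommuting (M.xGen_mem P)
  obtain ⟨c, hc⟩ := hx.monomial_mul (Finsupp.single i 1) s
  rw [orderedMonomial_single, pow_one] at hc
  rw [relMonomial, ← mul_assoc, hc, smul_mul_assoc]
  refine units_smul_mem _ c ?_
  dsimp only
  by_cases hi : Finsupp.single i 1 + s ∈ restricted M.height
  · exact Submodule.subset_span ⟨(_, m), ⟨hi, hm⟩, rfl⟩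
  -- otherwise the exponent of `x_i` has reached the height of `x_i`
  have hi' : ((s i : ℕ∞) + 1 : ℕ∞) = M.height i := by
    refine le_antisymm (Order.add_one_le_of_lt (hs i)) ?_
    by_contra! hlt
    refine hi fun j => ?_
    rw [Finsupp.add_apply]
    by_cases hj : i = j
    · subst hj
      rw [Finsupp.single_eq_same, add_comm]
      exact_mod_cast hlt
    · rw [Finsupp.single_eq_of_ne' hj, zero_add]
      exact hs j
  by_cases hev : Even (M.deg i) ∨ p = 2
  · let t : M.Trunc := ⟨i, hev, by rw [← hi']; exact ENat.natCast_ne_top (s i + 1)⟩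
    have hN : M.bound t = s i + 1 := by
      have h1 : (M.bound t : ℕ∞) = ((s i + 1 : ℕ) : ℕ∞) := (M.coe_bound t).trans hi'.symm
      exact_mod_cast h1
    have hdec : Finsupp.single i 1 + s = Finsupp.single i (M.bound t) + s.erase i := by
      rw [hN, add_comm (s i), Finsupp.single_add, add_assoc, Finsupp.single_add_erase]
    obtain ⟨c, hc⟩ := hx.monomial_add (Finsupp.single i (M.bound t)) (s.erase i)
    rw [hdec, hc, smul_mul_assoc]
    refine units_smul_mem _ c (Submodule.subset_span
      ⟨(s.erase i, Finsupp.single (t, P.one) 1 + m), ⟨fun j => ?_, fun t' => ?_⟩, ?_⟩)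
    · refine lt_of_le_of_lt ?_ (hs j)
      by_cases hj : j = i
      · subst hj
        simp
      · rw [Finsupp.erase_ne hj]
    · rw [Finsupp.add_apply, hm, Finsupp.single_eq_of_ne', add_zero]
      exact fun h => P.zero_ne_one (congrArg Prod.snd h).symm
    · have h1 := M.yGen_commute P t P.one (orderedMonomial (M.xGen P) (s.erase i))
      rw [yGen_one] at h1
      rw [relMonomial, yMon_add, yMon_single, yGen_one, pow_one, orderedMonomial_single]
      exact (mul_assoc _ _ _).symm.trans (congrArg (· * M.yMon P m) h1.eq.symm)
  · have h2 : M.height i = 2 := M.height_of_odd i hev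
    rw [h2] at hi'
    have hsi : s i + 1 = 2 := by exact_mod_cast hi'
    rw [orderedMonomial_eq_zero (i := i), zero_mul]
    · exact zero_mem _
    · rw [Finsupp.add_apply, Finsupp.single_eq_same, add_comm, hsi]
      exact sq_eq_zero_of_odd hev (M.xGen_mem P i)

theorem span_relMonomial :
    Submodule.span (ZMod p) (M.relMonomial P '' M.relExponents P) = ⊤ := by
  classical
  refine freeAlg_eq_top ?_ (M.relGen_cases (C := fun g => ∀ a ∈
    Submodule.span (ZMod p) (M.relMonomial P '' M.relExponents P),
      g * a ∈ Submodule.span (ZMod p) (M.relMonomial P '' M.relExponents P))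
      (fun i a ha => ?_) fun t w hw a ha => ?_)
  · refine Submodule.subset_span ⟨(0, 0), ⟨fun i => ?_, fun t => rfl⟩, ?_⟩
    · exact lt_of_lt_of_le (by simp) (M.two_le_height i)
    · rw [relMonomial, orderedMonomial_zero, yMon_zero, mul_one]
  · refine Submodule.span_induction (p := fun a _ => M.xGen P i * a ∈ _) ?_ ?_ ?_ ?_ ha
    · rintro _ ⟨sm, hsm, rfl⟩
      exact M.xGen_mul_relMonomial_mem i hsm
    · rw [mul_zero]
      exact zero_mem _
    · intro a b _ _ ha hb
      rw [mul_add]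
      exact add_mem ha hb
    · intro c a _ ha
      rw [mul_smul_comm]
      exact Submodule.smul_mem _ c ha
  · refine Submodule.span_induction (p := fun a _ => M.yGen P t w * a ∈ _) ?_ ?_ ?_ ?_ ha
    · rintro _ ⟨⟨s, m⟩, ⟨hs, hm⟩, rfl⟩
      refine Submodule.subset_span ⟨(s, m + Finsupp.single (t, w) 1), ⟨hs, fun t' => ?_⟩, ?_⟩
      · rw [Finsupp.add_apply, hm, Finsupp.single_eq_of_ne', add_zero]
        exact fun h => hw.1 (congrArg Prod.snd h)
      · rw [relMonomial, yMon_add, yMon_single, pow_one, ← mul_assoc]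
        exact (M.yGen_commute P t w _).eq.symm
    · rw [mul_zero]
      exact zero_mem _
    · intro a b _ _ ha hb
      rw [mul_add]
      exact add_mem ha hb
    · intro c a _ ha
      rw [mul_smul_comm]
      exact Submodule.smul_mem _ c ha

/-- An algebra map out of `relAlg`, to an algebra in which the images of the generators commute up
to the correct signs. -/
theorem exists_relAlg_algHom {S : Type*} [Semiring S] [Algebra (ZMod p) S] (a : ι → S)
    (b : M.Trunc → P.W → S)
    (haa : ∀ i j, a i * a j = (-1 : ZMod p) ^ (M.deg i * M.deg j) • (a j * a i))
    (hab : ∀ i t w, Commute (b t w) (a i)) (hbb : ∀ t w t' w', Commute (b t w) (b t' w')) :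
    ∃ F : (M.relAlg P).carrier →ₐ[ZMod p] S, (∀ i, F (M.xGen P i) = a i) ∧
      ∀ t w, w ≠ P.zero ∧ w ≠ P.one → F (M.yGen P t w) = b t w := by
  have hev (t : M.Trunc) (n : ℕ) : (-1 : ZMod p) ^ (M.bound t * M.deg t.1 * n) = 1 := by
    rcases t.2.1 with h | h
    · exact ((h.mul_left _).mul_right n).neg_one_pow
    · have h1 : (-1 : ZMod p) = 1 := by
        subst h
        rfl
      rw [h1, one_pow]
  obtain ⟨F, hF⟩ := exists_freeAlg_algHom (k := ZMod p) (deg := M.relDeg P)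
    (Sum.elim (fun j => a ((equivShrink ι).symm j))
      fun tw => b ((equivShrink M.Trunc).symm tw.1) tw.2) (by
    rintro (i | tw) (j | tw')
    · exact haa _ _
    · refine (hab _ _ _).eq.symm.trans ?_
      rw [mul_comm]
      exact ((congrArg (· • _) (hev ((equivShrink M.Trunc).symm tw'.1) _)).trans (one_smul _ _)).symm
    · refine (hab _ _ _).eq.trans ?_
      exact ((congrArg (· • _) (hev ((equivShrink M.Trunc).symm tw.1) _)).trans (one_smul _ _)).symm
    · refine (hbb _ _ _ _).eq.trans ?_
      exact ((congrArg (· • _) (hev ((equivShrink M.Trunc).symm tw.1) _)).trans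
        (one_smul _ _)).symm)
  refine ⟨F, fun i => ?_, fun t w h => ?_⟩
  · rw [xGen, hF, Sum.elim_inl, Equiv.symm_apply_apply]
  · rw [yGen_of_ne M P t h, hF, Sum.elim_inr, Equiv.symm_apply_apply]

/-- The map from `relAlg` to a polynomial ring over `A` that sends `x_i` of odd degree to the
corresponding element of `A` and all other generators to independent variables. -/
theorem exists_relAlg_toPolynomial (P : Bipointed) :
    ∃ F : (M.relAlg P).carrier →ₐ[ZMod p] AddMonoidAlgebra A.carrier (ι ⊕ M.Trunc × P.W →₀ ℕ),
      (∀ i, F (M.xGen P i) = AddMonoidAlgebra.single (M.xExponent P i) (M.xCoefficient i)) ∧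
      ∀ t w, w ≠ P.zero → F (M.yGen P t w) = AddMonoidAlgebra.single (M.yExponent P (t, w)) 1 := by
  have hev {n : ℕ} (h : Even n ∨ p = 2) (m : ℕ) : (-1 : ZMod p) ^ (n * m) = 1 := by
    rcases h with h | h
    · exact (h.mul_right m).neg_one_pow
    · have h1 : (-1 : ZMod p) = 1 := by
        subst h
        rfl
      rw [h1, one_pow]
  obtain ⟨F, hx, hy⟩ := M.exists_relAlg_algHom (P := P)
    (S := AddMonoidAlgebra A.carrier (ι ⊕ M.Trunc × P.W →₀ ℕ))
    (fun i => AddMonoidAlgebra.single (M.xExponent P i) (M.xCoefficient i))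
    (fun t w => AddMonoidAlgebra.single (M.yExponent P (t, w)) 1)
    (fun i j => by
      rw [AddMonoidAlgebra.single_mul_single, AddMonoidAlgebra.single_mul_single,
        AddMonoidAlgebra.smul_single, add_comm]
      congr 1
      by_cases hi : Even (M.deg i) ∨ p = 2
      · rw [xCoefficient, if_pos hi, one_mul, mul_one, hev hi, one_smul]
      by_cases hj : Even (M.deg j) ∨ p = 2
      · rw [mul_comm (M.deg i), hev hj, one_smul, xCoefficient, xCoefficient, if_neg hi, if_pos hj,
          one_mul, mul_one]
      · rw [xCoefficient, xCoefficient, if_neg hi, if_neg hj]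
        exact A.graded_comm (M.gen_mem i) (M.gen_mem j))
    (fun i t w => by
      rw [Commute, SemiconjBy, AddMonoidAlgebra.single_mul_single,
        AddMonoidAlgebra.single_mul_single, add_comm, one_mul, mul_one])
    (fun t w t' w' => by
      rw [Commute, SemiconjBy, AddMonoidAlgebra.single_mul_single,
        AddMonoidAlgebra.single_mul_single, add_comm])
  refine ⟨F, hx, fun t w hw => ?_⟩
  by_cases h1 : w = P.one
  · subst h1
    rw [yGen_one, map_pow, hx, AddMonoidAlgebra.single_pow, xExponent, xCoefficient,
      if_pos t.2.1, if_pos t.2.1, one_pow, yExponent, if_pos rfl]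
  · exact hy t w ⟨hw, h1⟩

theorem exists_map_relMonomial_eq
    {F : (M.relAlg P).carrier →ₐ[ZMod p] AddMonoidAlgebra A.carrier (ι ⊕ M.Trunc × P.W →₀ ℕ)}
    (hx : ∀ i, F (M.xGen P i) = AddMonoidAlgebra.single (M.xExponent P i) (M.xCoefficient i))
    (hy : ∀ t w, w ≠ P.zero →
      F (M.yGen P t w) = AddMonoidAlgebra.single (M.yExponent P (t, w)) 1)
    {sm : (ι →₀ ℕ) × (M.Trunc × P.W →₀ ℕ)} (h : sm ∈ M.relExponents P) :
    ∃ c : ℤˣ, F (M.relMonomial P sm) =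
      c • AddMonoidAlgebra.single (M.relExponent P sm) (orderedMonomial M.gen (M.oddPart sm.1)) := by
  obtain ⟨s, m⟩ := sm
  have hX : F (orderedMonomial (M.xGen P) s) = AddMonoidAlgebra.single
      (s.sum fun i n => n • M.xExponent P i) (orderedMonomial M.xCoefficient s) := by
    have hl (L : List ι) : (L.map fun i => F (M.xGen P i) ^ s i).prod = AddMonoidAlgebra.single
        (L.map fun i => s i • M.xExponent P i).sum (L.map fun i => M.xCoefficient i ^ s i).prod := by
      induction L with
      | nil => rfl
      | cons i L ih => rw [List.map_cons, List.prod_cons, ih, hx, AddMonoidAlgebra.single_pow,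
          AddMonoidAlgebra.single_mul_single, List.map_cons, List.sum_cons, List.map_cons,
          List.prod_cons]
    rw [orderedMonomial_map, orderedMonomial, hl, orderedMonomial]
    congr 1
    rw [Finsupp.sum, ← Finset.sum_map_toList]
    exact ((Finset.sort_perm_toList s.support (· ≤ ·)).map _).sum_eq
  have hY : F (M.yMon P m) = AddMonoidAlgebra.single (m.sum fun tw n => n • M.yExponent P tw) 1 := by
    have hm : ∀ t, m (t, P.zero) = 0 := h.2
    clear h
    induction m using Finsupp.induction_linear with
    | zero =>
      rw [yMon_zero, map_one, Finsupp.sum_zero_index]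
      rfl
    | add m m' ihm ihm' =>
      simp only [Finsupp.add_apply, Nat.add_eq_zero_iff] at hm
      rw [yMon_add, map_mul, ihm fun t => (hm t).1, ihm' fun t => (hm t).2,
        AddMonoidAlgebra.single_mul_single, mul_one,
        Finsupp.sum_add_index' (h := fun tw n => n • M.yExponent P tw)
          (fun _ => zero_smul _ _) fun _ _ _ => add_smul _ _ _]
    | single tw n =>
      obtain ⟨t, w⟩ := tw
      rw [Finsupp.sum_single_index (h := fun tw n => n • M.yExponent P tw) (zero_smul _ _),
        yMon_single, map_pow]
      by_cases hn : n = 0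
      · subst hn
        rw [pow_zero, zero_smul]
        rfl
      · rw [hy t w, AddMonoidAlgebra.single_pow, one_pow]
        rintro rfl
        have := hm t
        rw [Finsupp.single_eq_same] at this
        exact hn this
  obtain ⟨c, hc⟩ := M.orderedMonomial_xCoefficient s
  refine ⟨c, ?_⟩
  rw [relMonomial, map_mul, hX, hY, AddMonoidAlgebra.single_mul_single, mul_one, hc]
  have h2 (x : A.carrier) (e) : AddMonoidAlgebra.single e (c • x) =
      c • (AddMonoidAlgebra.single e x : AddMonoidAlgebra A.carrier (ι ⊕ M.Trunc × P.W →₀ ℕ)) := by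
    rcases Int.units_eq_one_or c with rfl | rfl
    · rw [one_smul, one_smul]
    · rw [Units.neg_smul, Units.neg_smul, one_smul, one_smul, AddMonoidAlgebra.single_neg]
  exact h2 _ _

theorem linearIndependent_relMonomial (P : Bipointed) :
    LinearIndependent (ZMod p) fun sm : M.relExponents P => M.relMonomial P sm.1 := by
  obtain ⟨F, hx, hy⟩ := M.exists_relAlg_toPolynomial P
  have h1 : LinearIndependent (ZMod p) fun e : Σ _ : ι ⊕ M.Trunc × P.W →₀ ℕ, restricted M.height =>
      Finsupp.single e.1 (orderedMonomial M.gen e.2.1) :=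
    Finsupp.linearIndependent_single (fun _ (s : restricted M.height) => orderedMonomial M.gen s.1)
      fun _ => M.linearIndependent
  have h2 : LinearIndependent (ZMod p) fun e : Σ _ : ι ⊕ M.Trunc × P.W →₀ ℕ, restricted M.height =>
      (AddMonoidAlgebra.single e.1 (orderedMonomial M.gen e.2.1) :
        AddMonoidAlgebra A.carrier (ι ⊕ M.Trunc × P.W →₀ ℕ)) :=
    h1.map' (AddMonoidAlgebra.coeffLinearEquiv (ZMod p)).symm.toLinearMap (LinearEquiv.ker _)
  have hodd (sm : M.relExponents P) : M.oddPart sm.1.1 ∈ restricted M.height := fun i => by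
    refine lt_of_le_of_lt ?_ (sm.2.1 i)
    rw [oddPart, Finsupp.filter_apply]
    split_ifs <;> simp
  have h3 : LinearIndependent (ZMod p) fun sm : M.relExponents P =>
      (AddMonoidAlgebra.single (M.relExponent P sm.1) (orderedMonomial M.gen (M.oddPart sm.1.1)) :
        AddMonoidAlgebra A.carrier (ι ⊕ M.Trunc × P.W →₀ ℕ)) :=
    h2.comp (fun sm : M.relExponents P => ⟨M.relExponent P sm.1, ⟨_, hodd sm⟩⟩)
      fun sm sm' h => Subtype.ext (M.eq_of_relExponent_eq sm.2 sm'.2 (congrArg Sigma.fst h)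
        (congrArg (fun e => e.2.1) h))
  have h4 : LinearIndependent (ZMod p) fun sm : M.relExponents P => F (M.relMonomial P sm.1) :=
    h3.of_eq_units_smul fun sm => M.exists_map_relMonomial_eq hx hy sm.2
  exact LinearIndependent.of_comp F.toLinearMap h4

/-- The basis of `relAlg` consisting of monomials. -/
noncomputable def relBasis (P : Bipointed) :
    Module.Basis (M.relExponents P) (ZMod p) (M.relAlg P).carrier :=
  Module.Basis.mk (M.linearIndependent_relMonomial P) (by
    rw [← Set.image_eq_range, span_relMonomial])

theorem relBasis_apply (sm : M.relExponents P) : M.relBasis P sm = M.relMonomial P sm.1 :=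
  Module.Basis.mk_apply _ _ sm

end MonogenicBasis

/-! ### The simplicial resolution of a monogenic basis -/

/-- The linear morphism with given values on a homogeneous basis. -/
noncomputable def LinHom.ofBasis {k : Type} [Field k] {A B : AugGrAlg.{u} k} {κ : Type*}
    (b : Module.Basis κ k A.carrier) {d : κ → ℕ} (hb : ∀ i, b i ∈ A.grading (d i))
    {c : κ → B.carrier} (hc : ∀ i, c i ∈ B.grading (d i)) (haug : ∀ i, B.aug (c i) = A.aug (b i)) :
    LinHom A B where
  toLin := b.constr k c
  map_mem n a ha := by
    have h := mem_span_of_mem_grading hb ha (T := Set.univ) (by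
      rw [Set.image_univ, b.span_eq]
      trivial)
    clear ha
    induction h using Submodule.span_induction with
    | mem x hx =>
      obtain ⟨i, hi, rfl⟩ := hx
      rw [Module.Basis.constr_basis, ← hi.2]
      exact hc i
    | zero =>
      rw [map_zero]
      exact zero_mem _
    | add x y _ _ hx hy =>
      rw [map_add]
      exact add_mem hx hy
    | smul r x _ hx =>
      rw [map_smul]
      exact Submodule.smul_mem _ r hx
  aug_comp a := by
    have h : B.aug.toLinearMap ∘ₗ b.constr k c = A.aug.toLinearMap :=
      b.ext fun i => by
        rw [LinearMap.comp_apply, Module.Basis.constr_basis]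
        exact haug i
    exact DFunLike.congr_fun h a

theorem LinHom.ofBasis_apply {k : Type} [Field k] {A B : AugGrAlg.{u} k} {κ : Type*}
    (b : Module.Basis κ k A.carrier) {d : κ → ℕ} (hb : ∀ i, b i ∈ A.grading (d i))
    {c : κ → B.carrier} (hc : ∀ i, c i ∈ B.grading (d i)) (haug : ∀ i, B.aug (c i) = A.aug (b i))
    (i : κ) : (LinHom.ofBasis b hb hc haug).toLin (b i) = c i :=
  b.constr_basis k c i

namespace MonogenicBasis

variable {p : ℕ} [Fact p.Prime] {A : AugGrAlg.{u} (ZMod p)} {ι : Type v} [LinearOrder ι]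
  (M : A.MonogenicBasis ι)

/-- The monomial basis of `A`. -/
noncomputable def monomialBasis : Module.Basis (restricted M.height) (ZMod p) A.carrier :=
  Module.Basis.mk M.linearIndependent M.span_eq_top.ge

theorem monomialBasis_apply (s : restricted M.height) :
    M.monomialBasis s = orderedMonomial M.gen s.1 :=
  Module.Basis.mk_apply _ _ s

theorem monomialBasis_mem (s : restricted M.height) :
    M.monomialBasis s ∈ A.grading (Finsupp.weight M.deg s.1) := by
  rw [monomialBasis_apply]
  exact orderedMonomial_mem M.gen_mem s.1

variable {P P' P'' : Bipointed}

theorem eq_zero_of_yWeight_eq_zero {m : M.Trunc × P.W →₀ ℕ} (h : M.yWeight P m = 0) : m = 0 :=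
  (weight_eq_zero_iff fun tw : M.Trunc × P.W =>
    Nat.mul_pos (by have := M.two_le_bound tw.1; lia) (M.deg_pos tw.1.1)).mp h

/-- The map on exponents induced by a map `φ` of bipointed sets. -/
noncomputable def mapExponents (φ : P.W → P'.W) (sm : (ι →₀ ℕ) × (M.Trunc × P.W →₀ ℕ)) :
    (ι →₀ ℕ) × (M.Trunc × P'.W →₀ ℕ) :=
  (sm.1, sm.2.mapDomain (Prod.map id φ))

theorem yWeight_mapDomain (φ : P.W → P'.W) (m : M.Trunc × P.W →₀ ℕ) :
    M.yWeight P' (m.mapDomain (Prod.map id φ)) = M.yWeight P m := by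
  induction m using Finsupp.induction_linear with
  | zero => rw [Finsupp.mapDomain_zero, map_zero, map_zero]
  | add m m' h h' => rw [Finsupp.mapDomain_add, map_add, map_add, h, h']
  | single tw n => rw [Finsupp.mapDomain_single, yWeight, yWeight, Finsupp.weight_single,
      Finsupp.weight_single, Prod.map_fst, id]

variable [Small.{u} ι]

theorem relMonomial_mem (P : Bipointed) (sm : (ι →₀ ℕ) × (M.Trunc × P.W →₀ ℕ)) :
    M.relMonomial P sm ∈ (M.relAlg P).grading (Finsupp.weight M.deg sm.1 + M.yWeight P sm.2) :=
  SetLike.mul_mem_graded (orderedMonomial_mem (M.xGen_mem P) sm.1) (M.yMon_mem P sm.2)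

theorem relMonomial_zero (P : Bipointed) : M.relMonomial P (0, 0) = 1 := by
  rw [relMonomial, orderedMonomial_zero, yMon_zero, mul_one]

theorem yMon_eq_mul {m : M.Trunc × P.W →₀ ℕ} {t : M.Trunc} {w : P.W} (h : m (t, w) ≠ 0) :
    M.yMon P m = M.yMon P (m - Finsupp.single (t, w) 1) * M.yGen P t w := by
  classical
  have h1 : m = m - Finsupp.single (t, w) 1 + Finsupp.single (t, w) 1 := by
    refine (tsub_add_cancel_of_le ?_).symm
    rw [Finsupp.single_le_iff]
    lia
  conv_lhs => rw [h1, yMon_add, yMon_single, pow_one]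

theorem relMonomial_eq_zero {sm : (ι →₀ ℕ) × (M.Trunc × P.W →₀ ℕ)} {t : M.Trunc}
    (h : sm.2 (t, P.zero) ≠ 0) : M.relMonomial P sm = 0 := by
  rw [relMonomial, yMon_eq_mul M h, yGen_zero, mul_zero, mul_zero]

/-- The linear map induced by a map of pointed sets, given by the map on the exponents of
monomials. It is an algebra map only if the second base points correspond as well. -/
noncomputable def relLin (φ : P.W → P'.W) : LinHom (M.relAlg P) (M.relAlg P') :=
  LinHom.ofBasis (M.relBasis P) (d := fun sm => Finsupp.weight M.deg sm.1.1 + M.yWeight P sm.1.2)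
    (fun sm => by
      rw [relBasis_apply]
      exact M.relMonomial_mem P sm.1)
    (c := fun sm => M.relMonomial P' (M.mapExponents φ sm.1))
    (fun sm => by
      have h := M.relMonomial_mem P' (M.mapExponents φ sm.1)
      rwa [mapExponents, yWeight_mapDomain] at h)
    (fun sm => by
      rw [relBasis_apply]
      obtain ⟨⟨s, m⟩, hsm⟩ := sm
      change (M.relAlg P').aug (M.relMonomial P' (M.mapExponents φ (s, m))) =
        (M.relAlg P).aug (M.relMonomial P (s, m))
      have h := M.relMonomial_mem P' (M.mapExponents φ (s, m))
      have h' := M.relMonomial_mem P (s, m)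
      rw [mapExponents, yWeight_mapDomain] at h
      by_cases hw : Finsupp.weight M.deg s + M.yWeight P m = 0
      · obtain ⟨h1, h2⟩ := Nat.add_eq_zero_iff.mp hw
        obtain rfl := (weight_eq_zero_iff M.deg_pos).mp h1
        obtain rfl := M.eq_zero_of_yWeight_eq_zero h2
        rw [mapExponents, Finsupp.mapDomain_zero, relMonomial_zero, relMonomial_zero, map_one,
          map_one]
      · exact ((M.relAlg P').aug_eq_zero hw h).trans ((M.relAlg P).aug_eq_zero hw h').symm)

theorem relLin_relMonomial {φ : P.W → P'.W} (h0 : φ P.zero = P'.zero)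
    {sm : (ι →₀ ℕ) × (M.Trunc × P.W →₀ ℕ)} (h : sm.1 ∈ restricted M.height) :
    (M.relLin φ).toLin (M.relMonomial P sm) = M.relMonomial P' (M.mapExponents φ sm) := by
  classical
  by_cases hm : ∀ t, sm.2 (t, P.zero) = 0
  · rw [← M.relBasis_apply ⟨sm, h, hm⟩, relLin]
    exact LinHom.ofBasis_apply _ _ _ _ (⟨sm, h, hm⟩ : M.relExponents P)
  · push Not at hm
    obtain ⟨t, ht⟩ := hm
    rw [relMonomial_eq_zero M ht, map_zero]
    refine (M.relMonomial_eq_zero (t := t) ?_).symm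
    rw [mapExponents, Finsupp.mapDomain, Finsupp.sum_apply, ← h0]
    refine ne_of_gt (lt_of_lt_of_le (Nat.pos_of_ne_zero ht) ?_)
    refine le_trans ?_ (Finset.single_le_sum (fun _ _ => Nat.zero_le _)
      (Finsupp.mem_support_iff.mpr ht))
    change _ ≤ Finsupp.single (t, φ P.zero) (sm.2 (t, P.zero)) (t, φ P.zero)
    rw [Finsupp.single_eq_same]

theorem relBasis_linHom_ext {B : AugGrAlg.{u} (ZMod p)} {f g : LinHom (M.relAlg P) B}
    (h : ∀ s ∈ restricted M.height, ∀ m,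
      f.toLin (M.relMonomial P (s, m)) = g.toLin (M.relMonomial P (s, m))) : f = g :=
  LinHom.ext ((M.relBasis P).ext fun sm => by
    rw [relBasis_apply]
    exact h _ sm.2.1 _)

theorem relLin_comp {φ : P.W → P'.W} (hφ : φ P.zero = P'.zero) {ψ : P'.W → P''.W}
    (hψ : ψ P'.zero = P''.zero) : (M.relLin φ).comp (M.relLin ψ) = M.relLin (ψ ∘ φ) := by
  refine M.relBasis_linHom_ext fun s hs m => ?_
  rw [relLin_relMonomial M ((congrArg ψ hφ).trans hψ) hs, LinHom.comp, LinearMap.comp_apply,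
    relLin_relMonomial M hφ hs, relLin_relMonomial M hψ hs, mapExponents, mapExponents,
    mapExponents, ← Finsupp.mapDomain_comp]
  rfl

theorem relMap_yMon {φ : P.W → P'.W} (h0 : φ P.zero = P'.zero) (h1 : φ P.one = P'.one)
    (m : M.Trunc × P.W →₀ ℕ) :
    (M.relMap φ).toAlgHom (M.yMon P m) = M.yMon P' (m.mapDomain (Prod.map id φ)) := by
  induction m using Finsupp.induction_linear with
  | zero => rw [yMon_zero, map_one, Finsupp.mapDomain_zero, yMon_zero]
  | add m m' h h' => rw [Finsupp.mapDomain_add, yMon_add, yMon_add, map_mul, h, h']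
  | single tw n =>
    rw [Finsupp.mapDomain_single, Prod.map, yMon_single, yMon_single, map_pow,
      relMap_yGen M φ h0 h1, id]

theorem toLinHom_relMap {φ : P.W → P'.W} (h0 : φ P.zero = P'.zero) (h1 : φ P.one = P'.one) :
    Hom.toLinHom (M.relMap φ) = M.relLin φ := by
  refine M.relBasis_linHom_ext fun s hs m => ?_
  rw [relLin_relMonomial M h0 hs]
  refine (map_mul (M.relMap φ).toAlgHom _ _).trans ?_
  rw [relMap_yMon M h0 h1, orderedMonomial_map, relMonomial, mapExponents]
  simp only [relMap_xGen]

theorem relMap_id (P : Bipointed) : M.relMap (id : P.W → P.W) = 𝟙 _ :=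
  M.relAlg_hom_ext (fun i => M.relMap_xGen _ i) fun t w _ => M.relMap_yGen _ rfl rfl t w

theorem relMap_comp {φ : P.W → P'.W} (h0 : φ P.zero = P'.zero) (h1 : φ P.one = P'.one)
    {ψ : P'.W → P''.W} (h0' : ψ P'.zero = P''.zero) (h1' : ψ P'.one = P''.one) :
    M.relMap φ ≫ M.relMap ψ = M.relMap (ψ ∘ φ) := by
  refine M.relAlg_hom_ext (fun i => ?_) fun t w _ => ?_
  · rw [comp_toAlgHom, AlgHom.comp_apply, relMap_xGen, relMap_xGen, relMap_xGen]
  · rw [comp_toAlgHom, AlgHom.comp_apply, relMap_yGen M φ h0 h1, relMap_yGen M ψ h0' h1',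
      relMap_yGen M (ψ ∘ φ) ((congrArg ψ h0).trans h0') ((congrArg ψ h1).trans h1')]
    rfl

/-- The linear section of `relAug`, sending a monomial in the generators to the same monomial in the
`x_i`. -/
noncomputable def relSection (P : Bipointed) : LinHom A (M.relAlg P) :=
  LinHom.ofBasis M.monomialBasis M.monomialBasis_mem
    (c := fun s => orderedMonomial (M.xGen P) s.1)
    (fun s => orderedMonomial_mem (M.xGen_mem P) s.1)
    (fun s => by
      have h := (M.relAug P).aug_comp (orderedMonomial (M.xGen P) s.1)
      rw [← h, orderedMonomial_map, monomialBasis_apply]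
      simp only [relAug_xGen])

theorem relSection_orderedMonomial (P : Bipointed) {s : ι →₀ ℕ} (hs : s ∈ restricted M.height) :
    (M.relSection P).toLin (orderedMonomial M.gen s) = orderedMonomial (M.xGen P) s := by
  rw [← M.monomialBasis_apply ⟨s, hs⟩, relSection, LinHom.ofBasis_apply]

theorem relSection_comp_relAug (P : Bipointed) :
    (M.relSection P).comp (Hom.toLinHom (M.relAug P)) = Hom.toLinHom (𝟙 A) := by
  refine LinHom.ext (M.monomialBasis.ext fun s => ?_)
  rw [monomialBasis_apply]
  refine (congrArg (M.relAug P).toAlgHom (M.relSection_orderedMonomial P s.2)).trans ?_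
  rw [orderedMonomial_map]
  simp only [relAug_xGen]
  rfl

/-- The section of `relAug` after `relAug` is the map that sends all `y_{t, w}` to `0`. -/
theorem relAug_comp_relSection (P P' : Bipointed) :
    (Hom.toLinHom (M.relAug P)).comp (M.relSection P') = M.relLin fun _ : P.W => P'.zero := by
  refine M.relBasis_linHom_ext fun s hs m => ?_
  rw [relLin_relMonomial M rfl hs]
  refine (congrArg (M.relSection P').toLin (map_mul (M.relAug P).toAlgHom _ _)).trans ?_
  by_cases hm : m = 0
  · subst hm
    rw [mapExponents, Finsupp.mapDomain_zero, relMonomial, yMon_zero, yMon_zero, map_one, mul_one,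
      mul_one, orderedMonomial_map]
    simp only [relAug_xGen]
    exact M.relSection_orderedMonomial P' hs
  · obtain ⟨⟨t, w⟩, htw⟩ := Finsupp.ne_iff.mp hm
    have h1 : (M.relAug P).toAlgHom (M.yMon P m) = 0 := by
      rw [yMon_eq_mul M htw, map_mul, relAug_yGen, mul_zero]
    have h2 : M.yMon P' (m.mapDomain (Prod.map id fun _ => P'.zero)) = 0 := by
      have h3 : m = m - Finsupp.single (t, w) 1 + Finsupp.single (t, w) 1 := by
        refine (tsub_add_cancel_of_le ?_).symm
        rw [Finsupp.single_le_iff]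
        exact Nat.one_le_iff_ne_zero.mpr htw
      rw [h3, Finsupp.mapDomain_add, yMon_add, Finsupp.mapDomain_single, Prod.map, yMon_single,
        yGen_zero, pow_one, mul_zero]
    rw [relMonomial, mapExponents, h2, mul_zero, h1, mul_zero, map_zero]

/-- The monotone maps `[n] → [1]`, with the two constant maps as base points. -/
def simplexPoints (n : ℕ) : Bipointed where
  W := Fin (n + 1) →o Fin 2
  zero := OrderHom.const _ 0
  one := OrderHom.const _ 1
  zero_ne_one h := by
    have h1 := DFunLike.congr_fun h 0
    exact absurd h1 (by simp)

/-- The map induced on points by precomposition. -/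
def simplexMap {m n : ℕ} (θ : Fin (m + 1) →o Fin (n + 1)) (f : (simplexPoints n).W) :
    (simplexPoints m).W :=
  OrderHom.comp f θ

/-- Extend a monotone map `[n] → [1]` to `[n + 1] → [1]` by the value `0` at the new least
element. -/
def simplexCons {n : ℕ} (f : (simplexPoints n).W) : (simplexPoints (n + 1)).W where
  toFun := Fin.cons 0 (OrderHom.toFun f)
  monotone' i j h := by
    induction i using Fin.cases with
    | zero => exact Fin.zero_le _
    | succ i =>
      induction j using Fin.cases with
      | zero => exact absurd (Fin.le_zero_iff.mp h) (Fin.succ_ne_zero i)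
      | succ j => exact OrderHom.monotone f (Fin.succ_le_succ_iff.mp h)

theorem simplexCons_zero (n : ℕ) :
    simplexCons (simplexPoints n).zero = (simplexPoints (n + 1)).zero := by
  refine OrderHom.ext _ _ (funext fun i => ?_)
  induction i using Fin.cases <;> rfl

theorem simplexMap_δ_zero_simplexCons {n : ℕ} (f : (simplexPoints n).W) :
    simplexMap (SimplexCategory.δ 0).toOrderHom (simplexCons f) = f :=
  OrderHom.ext _ _ rfl

theorem simplexMap_δ_succ_simplexCons {n : ℕ} (i : Fin (n + 2)) (f : (simplexPoints (n + 1)).W) :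
    simplexMap (SimplexCategory.δ i.succ).toOrderHom (simplexCons f) =
      simplexCons (simplexMap (SimplexCategory.δ i).toOrderHom f) := by
  refine OrderHom.ext _ _ (funext fun j => ?_)
  induction j using Fin.cases with
  | zero => rfl
  | succ j =>
    change (Fin.cons 0 (OrderHom.toFun f) : Fin (n + 3) → Fin 2) (i.succ.succAbove j.succ) = _
    rw [Fin.succ_succAbove_succ]
    rfl

theorem simplexMap_δ_one_simplexCons (f : (simplexPoints 0).W) :
    simplexMap (SimplexCategory.δ 1).toOrderHom (simplexCons f) = (simplexPoints 0).zero := by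
  refine OrderHom.ext _ _ (funext fun j => ?_)
  have hj : j = 0 := Fin.fin_one_eq_zero j
  subst hj
  rfl

/-- The simplicial algebra `[n] ↦ relAlg (Hom([n], [1]))`: up to isomorphism, it is the bar
construction of the algebra on the `x_i` over its subalgebra generated by the `x_t ^ N`. -/
noncomputable def resolution : SimplicialObject (AugGrAlg.{u} (ZMod p)) where
  obj x := M.relAlg (simplexPoints x.unop.len)
  map θ := M.relMap (simplexMap θ.unop.toOrderHom)
  map_id _ := M.relMap_id _
  map_comp θ θ' := (M.relMap_comp (φ := simplexMap θ.unop.toOrderHom)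
    (ψ := simplexMap θ'.unop.toOrderHom) rfl rfl rfl rfl).symm

theorem toLinHom_resolution_δ (n : ℕ) (i : Fin (n + 2)) :
    Hom.toLinHom (M.resolution.δ i) =
      M.relLin (simplexMap (SimplexCategory.δ i).toOrderHom) :=
  M.toLinHom_relMap rfl rfl

/-- The augmentation of the resolution has a linear contraction, because `A` and the algebras in
the resolution have bases of monomials. -/
noncomputable def contractibleOver : ContractibleOver M.resolution A where
  aug := M.relAug (simplexPoints 0)
  s n := M.relLin simplexCons
  sA := M.relSection (simplexPoints 0)
  δ_aug := M.relAlg_hom_ext (P := simplexPoints 1) (fun i => by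
      refine (congrArg (M.relAug _).toAlgHom (M.relMap_xGen _ i)).trans
        (congrArg (M.relAug _).toAlgHom (M.relMap_xGen _ i)).symm)
    fun t w _ => ((congrArg (M.relAug _).toAlgHom (M.relMap_yGen _ rfl rfl t w)).trans
      (M.relAug_yGen t _)).trans ((congrArg (M.relAug _).toAlgHom
        (M.relMap_yGen _ rfl rfl t w)).trans (M.relAug_yGen t _)).symm
  s_δ_zero n := by
    rw [toLinHom_resolution_δ]
    refine (M.relLin_comp (simplexCons_zero n) rfl).trans ?_
    rw [show simplexMap (SimplexCategory.δ 0).toOrderHom ∘ simplexCons = id from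
      funext fun f => simplexMap_δ_zero_simplexCons (n := n) f, ← M.toLinHom_relMap rfl rfl,
      relMap_id]
    rfl
  s_δ_succ n i := by
    rw [toLinHom_resolution_δ, toLinHom_resolution_δ]
    refine (M.relLin_comp (simplexCons_zero (n + 1)) rfl).trans
      (Eq.trans ?_ (M.relLin_comp rfl (simplexCons_zero n)).symm)
    exact congrArg M.relLin (funext fun f => simplexMap_δ_succ_simplexCons i f)
  s_δ_one := by
    rw [toLinHom_resolution_δ]
    refine (M.relLin_comp (simplexCons_zero 0) rfl).trans
      (Eq.trans ?_ (M.relAug_comp_relSection (simplexPoints 0) (simplexPoints 0)).symm)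
    exact congrArg M.relLin (funext fun f => simplexMap_δ_one_simplexCons f)
  sA_aug := M.relSection_comp_relAug _

end MonogenicBasis

end AugGrAlg

/-! ### The homology of the indecomposables of the resolution -/

section Splitting

variable {R : Type*} [Ring R] {B : ℕ → Type*} {E : Type*} [hB : ∀ n, AddCommGroup (B n)]
  [hB' : ∀ n, Module R (B n)] [AddCommGroup E] [Module R E] {δ : ∀ n, B (n + 1) →ₗ[R] B n}
  {s : ∀ n, B n →ₗ[R] B (n + 1)} {u : ∀ n, B n →ₗ[R] E} {v : ∀ n, E →ₗ[R] B n}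

/-- A complex that is homotopy equivalent in positive degrees to the complex
`⋯ E ⟶ E ⟶ E ⟶ E` with the differentials `-1` and `0` in turn, where the differential from degree
`2` to degree `1` is `0`, is exact in degrees at least `2`. -/
theorem exists_eq_of_splitting (hδ : ∀ n b, δ n (δ (n + 1) b) = 0)
    (hs : ∀ n b, δ (n + 1) (s (n + 1) b) = b - s n (δ n b) - v (n + 1) (u (n + 1) b))
    (hv : ∀ n e, δ n (v (n + 1) e) = if Even n then -v n e else 0)
    (huv : ∀ n e, u (n + 1) (v (n + 1) e) = e) {n : ℕ} (hn : n ≠ 0) {b : B (n + 1)}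
    (hb : δ n b = 0) : ∃ b', δ (n + 1) b' = b := by
  have h1 := hs n b
  rw [hb, map_zero, sub_zero] at h1
  by_cases he : Even n
  · have h2 := hδ n (s (n + 1) b)
    rw [h1, map_sub, hb, hv, if_pos he, zero_sub, neg_neg] at h2
    have h3 : u (n + 1) b = 0 := by
      obtain ⟨n, rfl⟩ := Nat.exists_eq_add_one_of_ne_zero hn
      rw [← huv n (u (n + 1 + 1) b), h2, map_zero]
    rw [h3, map_zero, sub_zero] at h1
    exact ⟨_, h1⟩
  · refine ⟨s (n + 1) b - v (n + 1 + 1) (u (n + 1) b), ?_⟩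
    rw [map_sub, h1, hv, if_pos (Nat.even_add_one.mpr he), sub_neg_eq_add, sub_add_cancel]

/-- The first homology of such a complex is `E`, if the differential from degree `1` to degree `0`
vanishes. -/
theorem splitting_eq_zero_iff (hδ : ∀ n b, δ n (δ (n + 1) b) = 0)
    (hs : ∀ n b, δ (n + 1) (s (n + 1) b) = b - s n (δ n b) - v (n + 1) (u (n + 1) b))
    (hv : ∀ n e, δ n (v (n + 1) e) = if Even n then -v n e else 0)
    (huv : ∀ n e, u (n + 1) (v (n + 1) e) = e) (hδ0 : ∀ b, δ 0 b = 0) (b : B 1) :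
    u 1 b = 0 ↔ ∃ b', δ 1 b' = b := by
  constructor
  · intro hb
    refine ⟨s 1 b, (hs 0 b).trans ?_⟩
    have hb' : u (0 + 1) b = 0 := hb
    rw [hδ0, map_zero, sub_zero, hb', map_zero, sub_zero]
  · rintro ⟨b, rfl⟩
    have h1 : δ 1 (b - s 1 (δ 1 b)) = 0 := by
      have h2 : b - s 1 (δ 1 b) = δ 2 (s 2 b) + v 2 (u 2 b) := by
        rw [hs 1 b]
        abel
      rw [h2, map_add, hδ, zero_add, hv 1, if_neg (by decide)]
    have h3 : δ 1 (s 1 (δ 1 b)) = δ 1 b - v 1 (u 1 (δ 1 b)) := by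
      refine (hs 0 (δ 1 b)).trans ?_
      rw [hδ0, map_zero, sub_zero]
    rw [map_sub, h3, sub_sub_cancel] at h1
    rw [← huv 0 (u 1 (δ 1 b))]
    exact (congrArg (u 1) h1).trans (map_zero _)

end Splitting

namespace AugGrAlg

namespace MonogenicBasis

/-- The monotone map `(0, 1, ⋯, 1)`. -/
def simplexJump : (n : ℕ) → (simplexPoints n).W
  | 0 => (simplexPoints 0).zero
  | n + 1 => simplexCons (simplexPoints n).one

theorem simplexPoints_apply_eq {n : ℕ} {f g : (simplexPoints n).W} (h : f = g) (i : Fin (n + 1)) :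
    OrderHom.toFun f i = OrderHom.toFun g i :=
  h ▸ rfl

theorem simplexJump_ne (n : ℕ) : simplexJump (n + 1) ≠ (simplexPoints (n + 1)).zero ∧
    simplexJump (n + 1) ≠ (simplexPoints (n + 1)).one := by
  refine ⟨fun h => ?_, fun h => ?_⟩
  · have h1 : (1 : Fin 2) = 0 := simplexPoints_apply_eq h (Fin.succ 0)
    exact absurd h1 (by decide)
  · have h1 : (0 : Fin 2) = 1 := simplexPoints_apply_eq h 0
    exact absurd h1 (by decide)

theorem simplexMap_δ_zero_simplexJump (n : ℕ) :
    simplexMap (SimplexCategory.δ 0).toOrderHom (simplexJump (n + 1)) = (simplexPoints n).one :=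
  simplexMap_δ_zero_simplexCons _

theorem simplexMap_δ_succ_simplexJump (n : ℕ) (i : Fin (n + 1)) :
    simplexMap (SimplexCategory.δ i.succ).toOrderHom (simplexJump (n + 1)) = simplexJump n := by
  cases n with
  | zero =>
    obtain rfl : i = 0 := Fin.fin_one_eq_zero i
    exact simplexMap_δ_one_simplexCons _
  | succ n => exact simplexMap_δ_succ_simplexCons i _

theorem simplexMap_δ_eq_one {n : ℕ} {f : (simplexPoints (n + 1)).W}
    (hf : f ≠ (simplexPoints (n + 1)).one) {i : Fin (n + 2)}
    (h : simplexMap (SimplexCategory.δ i).toOrderHom f = (simplexPoints n).one) :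
    i = 0 ∧ f = simplexJump (n + 1) := by
  have h0 : OrderHom.toFun f 0 = 0 := by
    by_contra h1
    refine hf (OrderHom.ext _ _ (funext fun j => ?_))
    have h2 : OrderHom.toFun f 0 ≤ OrderHom.toFun f j := OrderHom.monotone f (Fin.zero_le j)
    change OrderHom.toFun f j = 1
    lia
  have hi : i = 0 := by
    by_contra hi
    have h1 : OrderHom.toFun f (i.succAbove 0) = 1 := simplexPoints_apply_eq h 0
    rw [Fin.succAbove_ne_zero_zero hi, h0] at h1
    exact absurd h1 (by decide)
  subst hi
  refine ⟨rfl, OrderHom.ext _ _ (funext fun j => ?_)⟩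
  induction j using Fin.cases with
  | zero => exact h0
  | succ j => exact simplexPoints_apply_eq h j

variable {p : ℕ} [Fact p.Prime] {A : AugGrAlg.{u} (ZMod p)} {ι : Type v} [LinearOrder ι]
  (M : A.MonogenicBasis ι) [Small.{u} ι] (m : ℕ)

/-- The degree `N |x_t|` of the generators corresponding to `x_t ^ N`. -/
noncomputable def truncDeg (j : Shrink.{u} M.Trunc) : ℕ :=
  M.bound ((equivShrink M.Trunc).symm j) * M.deg ((equivShrink M.Trunc).symm j).1

/-- The free algebra on generators corresponding to the powers `x_t ^ N` that vanish in `A`. -/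
noncomputable abbrev truncAlg : AugGrAlg.{u} (ZMod p) := freeAlg (ZMod p) M.truncDeg

theorem relLift_yGen_of_ne {P : Bipointed} {B : AugGrAlg.{u} (ZMod p)} (a : ι → B.carrier)
    (b : M.Trunc → P.W → B.carrier) (ha : ∀ i, a i ∈ B.grading (M.deg i))
    (hb : ∀ t w, b t w ∈ B.grading (M.bound t * M.deg t.1)) (t : M.Trunc) {w : P.W}
    (h : w ≠ P.zero ∧ w ≠ P.one) : (M.relLift a b ha hb).toAlgHom (M.yGen P t w) = b t w := by
  rw [yGen_of_ne M P t h, relLift, freeLift_freeGen, Sum.elim_inr, Equiv.symm_apply_apply]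

theorem indecOf_yGen_zero (P : Bipointed) (t : M.Trunc) :
    (M.relAlg P).indecOf m (M.yGen P t P.zero) = 0 := by
  rw [yGen_zero, map_zero]

theorem indecOf_yGen_one (P : Bipointed) (t : M.Trunc) :
    (M.relAlg P).indecOf m (M.yGen P t P.one) = 0 := by
  rw [yGen_one, indecOf_pow (M.xGen_mem_augIdeal P t.1) (M.two_le_bound t)]

/-- The degree `m` part of the indecomposables of the resolution. -/
abbrev resIndec (n : ℕ) : Type u := (M.relAlg (simplexPoints n)).indecGrading m

/-- The class of `x_i`. -/
noncomputable def xClass (n : ℕ) (i : ι) : M.resIndec m n :=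
  (M.relAlg (simplexPoints n)).indecOf m (M.xGen _ i)

/-- The class of `y_{t, f}`. -/
noncomputable def yClass (n : ℕ) (t : M.Trunc) (f : (simplexPoints n).W) : M.resIndec m n :=
  (M.relAlg (simplexPoints n)).indecOf m (M.yGen _ t f)

variable {m} in
theorem resIndec_hom_ext {n : ℕ} {E : Type*} [AddCommGroup E] [Module (ZMod p) E]
    {g g' : M.resIndec m n →ₗ[ZMod p] E} (hx : ∀ i, g (M.xClass m n i) = g' (M.xClass m n i))
    (hy : ∀ t f, f ≠ (simplexPoints n).zero ∧ f ≠ (simplexPoints n).one →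
      g (M.yClass m n t f) = g' (M.yClass m n t f)) : g = g' :=
  M.indecGrading_relAlg_hom_ext hx hy

/-- The face maps on indecomposables. -/
noncomputable def resFace (n : ℕ) (i : Fin (n + 2)) :
    M.resIndec m (n + 1) →ₗ[ZMod p] M.resIndec m n :=
  indecLin m (M.relMap (P := simplexPoints (n + 1)) (P' := simplexPoints n)
    (simplexMap (SimplexCategory.δ i).toOrderHom))

theorem resFace_xClass (n : ℕ) (i : Fin (n + 2)) (j : ι) :
    M.resFace m n i (M.xClass m (n + 1) j) = M.xClass m n j := by
  rw [resFace, xClass, indecLin_indecOf, relMap_xGen, xClass]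

theorem resFace_yClass (n : ℕ) (i : Fin (n + 2)) (t : M.Trunc) (f : (simplexPoints (n + 1)).W) :
    M.resFace m n i (M.yClass m (n + 1) t f) =
      M.yClass m n t (simplexMap (SimplexCategory.δ i).toOrderHom f) := by
  rw [resFace, yClass, indecLin_indecOf, relMap_yGen M _ rfl rfl, yClass]

/-- The differential on indecomposables. -/
noncomputable def resD (n : ℕ) : M.resIndec m (n + 1) →ₗ[ZMod p] M.resIndec m n :=
  alternatingFaces M.resolution (indecFunctor (ZMod p) m) n

theorem resD_apply (n : ℕ) (b : M.resIndec m (n + 1)) :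
    M.resD m n b = ∑ i : Fin (n + 2), (-1 : ℤ) ^ (i : ℕ) • M.resFace m n i b :=
  alternatingFaces_apply M.resolution (indecFunctor (ZMod p) m) n b

theorem resD_resD (n : ℕ) (b : M.resIndec m (n + 2)) : M.resD m n (M.resD m (n + 1) b) = 0 :=
  alternatingFaces_alternatingFaces M.resolution (indecFunctor (ZMod p) m) n b

/-- The homotopy that extends `f` by the value `0`. It is induced by an algebra map, which does not
respect `y_{t, 1} = x_t ^ N`. -/
noncomputable def resS (n : ℕ) : M.resIndec m n →ₗ[ZMod p] M.resIndec m (n + 1) :=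
  indecLin m (M.relLift (P := simplexPoints n) (M.xGen (simplexPoints (n + 1)))
    (fun t f => M.yGen (simplexPoints (n + 1)) t (simplexCons f)) (M.xGen_mem _)
    fun t _ => M.yGen_mem _ t _)

theorem resS_xClass (n : ℕ) (i : ι) :
    M.resS m n (M.xClass m n i) = M.xClass m (n + 1) i := by
  rw [resS, xClass, indecLin_indecOf, relLift_xGen, xClass]

theorem yClass_zero (n : ℕ) (t : M.Trunc) : M.yClass m n t (simplexPoints n).zero = 0 :=
  M.indecOf_yGen_zero m _ t

theorem yClass_one (n : ℕ) (t : M.Trunc) : M.yClass m n t (simplexPoints n).one = 0 :=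
  M.indecOf_yGen_one m _ t

theorem resS_yClass (n : ℕ) (t : M.Trunc) {f : (simplexPoints n).W}
    (hf : f ≠ (simplexPoints n).one) :
    M.resS m n (M.yClass m n t f) = M.yClass m (n + 1) t (simplexCons f) := by
  by_cases h : f = (simplexPoints n).zero
  · subst h
    rw [yClass_zero, map_zero, simplexCons_zero, yClass_zero]
  · rw [resS, yClass, indecLin_indecOf, relLift_yGen_of_ne M _ _ _ _ t ⟨h, hf⟩, yClass]

open scoped Classical in
/-- The coefficients of the classes of `y_{t, f}`, for `f = (0, 1, ⋯, 1)`. -/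
noncomputable def resU (n : ℕ) : M.resIndec m n →ₗ[ZMod p] M.truncAlg.indecGrading m :=
  indecLin m (M.relLift (P := simplexPoints n) (fun _ => 0)
    (fun t f => if f = simplexJump n then
      freeGen (ZMod p) M.truncDeg (equivShrink M.Trunc t) else 0) (fun _ => zero_mem _)
    fun t f => by
      split_ifs
      · have h := freeGen_mem (k := ZMod p) (deg := M.truncDeg) (equivShrink M.Trunc t)
        have h' : M.truncDeg (equivShrink M.Trunc t) = M.bound t * M.deg t.1 :=
          congrArg (fun t => M.bound t * M.deg t.1) ((equivShrink M.Trunc).symm_apply_apply t)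
        rwa [h'] at h
      · exact zero_mem _)

theorem resU_xClass (n : ℕ) (i : ι) : M.resU m n (M.xClass m n i) = 0 := by
  rw [resU, xClass, indecLin_indecOf, relLift_xGen, map_zero]

theorem resU_yClass_jump (n : ℕ) (t : M.Trunc) :
    M.resU m (n + 1) (M.yClass m (n + 1) t (simplexJump (n + 1))) =
      M.truncAlg.indecOf m (freeGen (ZMod p) M.truncDeg (equivShrink M.Trunc t)) := by
  rw [resU, yClass, indecLin_indecOf, relLift_yGen_of_ne M _ _ _ _ t (simplexJump_ne n), if_pos rfl]

theorem resU_yClass (n : ℕ) (t : M.Trunc) {f : (simplexPoints n).W}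
    (h : f ≠ (simplexPoints n).zero ∧ f ≠ (simplexPoints n).one) (hf : f ≠ simplexJump n) :
    M.resU m n (M.yClass m n t f) = 0 := by
  rw [resU, yClass, indecLin_indecOf, relLift_yGen_of_ne M _ _ _ _ t h, if_neg hf, map_zero]

/-- The map with values the classes of `y_{t, f}`, for `f = (0, 1, ⋯, 1)`. -/
noncomputable def resV (n : ℕ) : M.truncAlg.indecGrading m →ₗ[ZMod p] M.resIndec m n :=
  indecLin m (freeLift (deg := M.truncDeg)
    (fun j => M.yGen (simplexPoints n) ((equivShrink M.Trunc).symm j) (simplexJump n))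
    (fun _ => M.yGen_mem _ _ _) fun _ => M.yGen_mem_augIdeal _ _ _)

theorem resV_indecOf (n : ℕ) (t : M.Trunc) :
    M.resV m n (M.truncAlg.indecOf m (freeGen (ZMod p) M.truncDeg (equivShrink M.Trunc t))) =
      M.yClass m n t (simplexJump n) := by
  refine (indecLin_indecOf _ _).trans (congrArg _ ((freeLift_freeGen _ _ _ _).trans ?_))
  rw [Equiv.symm_apply_apply]

variable {m} in
theorem truncAlg_hom_ext {E : Type*} [AddCommGroup E] [Module (ZMod p) E]
    {g g' : M.truncAlg.indecGrading m →ₗ[ZMod p] E}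
    (h : ∀ t, g (M.truncAlg.indecOf m (freeGen (ZMod p) M.truncDeg (equivShrink M.Trunc t))) =
      g' (M.truncAlg.indecOf m (freeGen (ZMod p) M.truncDeg (equivShrink M.Trunc t)))) : g = g' :=
  indecGrading_freeAlg_hom_ext fun j => by
    have h1 := h ((equivShrink M.Trunc).symm j)
    rwa [Equiv.apply_symm_apply] at h1

theorem resU_resV (n : ℕ) (e) : M.resU m (n + 1) (M.resV m (n + 1) e) = e := by
  have h : M.resU m (n + 1) ∘ₗ M.resV m (n + 1) = LinearMap.id :=
    M.truncAlg_hom_ext fun t => by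
      rw [LinearMap.comp_apply, resV_indecOf, resU_yClass_jump, LinearMap.id_apply]
  exact DFunLike.congr_fun h e

theorem resFace_zero_resV (n : ℕ) (e) : M.resFace m n 0 (M.resV m (n + 1) e) = 0 := by
  have h : M.resFace m n 0 ∘ₗ M.resV m (n + 1) = 0 :=
    M.truncAlg_hom_ext fun t => by
      rw [LinearMap.comp_apply, resV_indecOf, resFace_yClass, simplexMap_δ_zero_simplexJump,
        yClass_one, LinearMap.zero_apply]
  exact DFunLike.congr_fun h e

theorem resFace_succ_resV (n : ℕ) (i : Fin (n + 1)) (e) :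
    M.resFace m n i.succ (M.resV m (n + 1) e) = M.resV m n e := by
  have h : M.resFace m n i.succ ∘ₗ M.resV m (n + 1) = M.resV m n :=
    M.truncAlg_hom_ext fun t => by
      rw [LinearMap.comp_apply, resV_indecOf, resV_indecOf, resFace_yClass,
        simplexMap_δ_succ_simplexJump]
  exact DFunLike.congr_fun h e

theorem resD_resV (n : ℕ) (e) :
    M.resD m n (M.resV m (n + 1) e) = if Even n then -M.resV m n e else 0 := by
  rw [resD_apply, Fin.sum_univ_succ, resFace_zero_resV, smul_zero, zero_add]
  simp only [resFace_succ_resV, Fin.val_succ, ← Finset.sum_smul]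
  have h : ∑ i : Fin (n + 1), (-1 : ℤ) ^ ((i : ℕ) + 1) = if Even n then -1 else 0 := by
    simp only [pow_succ, ← Finset.sum_mul]
    rw [Fin.sum_univ_eq_sum_range (fun i => (-1 : ℤ) ^ i), neg_one_geom_sum]
    by_cases hn : Even n
    · simp [hn, Nat.even_add_one]
    · simp [hn, Nat.even_add_one]
  rw [h]
  split_ifs <;> simp

theorem resFace_zero_resS (n : ℕ) (b) : M.resFace m (n + 1) 0 (M.resS m (n + 1) b) = b := by
  have h : M.resFace m (n + 1) 0 ∘ₗ M.resS m (n + 1) = LinearMap.id :=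
    M.resIndec_hom_ext (fun i => by
      rw [LinearMap.comp_apply, resS_xClass, resFace_xClass, LinearMap.id_apply]) fun t f hf => by
      rw [LinearMap.comp_apply, resS_yClass _ _ _ _ hf.2, resFace_yClass,
        simplexMap_δ_zero_simplexCons, LinearMap.id_apply]
  exact DFunLike.congr_fun h b

/-- The failure of `resS` to be an additional degeneracy comes from the faces of `y_{t, f}` that
are the decomposable elements `x_t ^ N`, whereas `y_{t, g}` is indecomposable for the extension `g`
of the constant map by `0`. -/
theorem resFace_succ_resS (n : ℕ) (i : Fin (n + 2)) (b) :
    M.resFace m (n + 1) i.succ (M.resS m (n + 1) b) = M.resS m n (M.resFace m n i b) +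
      if i = 0 then M.resV m (n + 1) (M.resU m (n + 1) b) else 0 := by
  have h : M.resFace m (n + 1) i.succ ∘ₗ M.resS m (n + 1) = M.resS m n ∘ₗ M.resFace m n i +
      if i = 0 then M.resV m (n + 1) ∘ₗ M.resU m (n + 1) else 0 := by
    refine M.resIndec_hom_ext (fun j => ?_) fun t f hf => ?_
    · rw [LinearMap.comp_apply, resS_xClass, resFace_xClass, LinearMap.add_apply,
        LinearMap.comp_apply, resFace_xClass, resS_xClass]
      split_ifs
      · rw [LinearMap.comp_apply, resU_xClass, map_zero, add_zero]
      · rw [LinearMap.zero_apply, add_zero]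
    · rw [LinearMap.comp_apply, resS_yClass _ _ _ _ hf.2, resFace_yClass,
        simplexMap_δ_succ_simplexCons, LinearMap.add_apply, LinearMap.comp_apply, resFace_yClass]
      by_cases h1 : simplexMap (SimplexCategory.δ i).toOrderHom f = (simplexPoints n).one
      · obtain ⟨rfl, rfl⟩ := simplexMap_δ_eq_one hf.2 h1
        rw [h1, yClass_one, map_zero, zero_add, if_pos rfl, LinearMap.comp_apply,
          resU_yClass_jump, resV_indecOf]
        rfl
      · rw [resS_yClass _ _ _ _ h1]
        split_ifs with hi
        · subst hi
          rw [LinearMap.comp_apply, resU_yClass _ _ _ _ hf, map_zero, add_zero]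
          rintro rfl
          exact h1 (simplexMap_δ_zero_simplexJump n)
        · rw [LinearMap.zero_apply, add_zero]
  refine (DFunLike.congr_fun h b).trans ?_
  rw [LinearMap.add_apply, LinearMap.comp_apply]
  split_ifs <;> rfl

theorem resD_resS (n : ℕ) (b) :
    M.resD m (n + 1) (M.resS m (n + 1) b) =
      b - M.resS m n (M.resD m n b) - M.resV m (n + 1) (M.resU m (n + 1) b) := by
  have h : M.resS m n (M.resD m n b) =
      ∑ i : Fin (n + 2), (-1 : ℤ) ^ (i : ℕ) • M.resS m n (M.resFace m n i b) := by
    rw [resD_apply, map_sum]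
    simp only [map_zsmul]
  rw [h, resD_apply, Fin.sum_univ_succ, resFace_zero_resS]
  simp only [resFace_succ_resS, smul_add, Finset.sum_add_distrib, smul_ite, smul_zero,
    Finset.sum_ite_eq', Finset.mem_univ, if_true, Fin.val_zero, pow_zero, one_smul, Fin.val_succ,
    pow_succ, mul_neg, mul_one, neg_smul, Finset.sum_neg_distrib]
  abel

theorem resD_zero (b) : M.resD m 0 b = 0 := by
  have h : M.resFace m 0 0 = M.resFace m 0 1 := by
    refine M.resIndec_hom_ext (fun i => ?_) fun t f _ => ?_
    · rw [resFace_xClass, resFace_xClass]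
    · -- the set `Hom([0], [1])` consists of the base points
      have h0 (f : (simplexPoints 0).W) : M.yClass m 0 t f = 0 := by
        induction f using Bipointed.cases with
        | zero => exact M.yClass_zero m 0 t
        | one => exact M.yClass_one m 0 t
        | ne f hf =>
          exfalso
          have h1 (x : Fin 2) (hx : OrderHom.toFun f 0 = x) : f = OrderHom.const _ x :=
            OrderHom.ext _ _ (funext fun j => by
              obtain rfl : j = 0 := Fin.fin_one_eq_zero j
              exact hx)
          obtain hx | hx : OrderHom.toFun f 0 = 0 ∨ OrderHom.toFun f 0 = 1 := by lia
          · exact hf.1 (h1 0 hx)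
          · exact hf.2 (h1 1 hx)
      rw [resFace_yClass, resFace_yClass, h0, h0]
  rw [resD_apply, Fin.sum_univ_two, h]
  simp

theorem isBiresolution :
    IsBiresolution (R := ZMod p)
      (P := fun i n => (aqTerm (ZMod p) m n).obj (M.resolution.obj (.op (.mk i))))
      (B := fun i => (indecFunctor (ZMod p) m).obj (M.resolution.obj (.op (.mk i))))
      (Z := fun n => (aqTerm (ZMod p) m n).obj A)
      (fun i n => aqD (M.resolution.obj (.op (.mk i))) m n)
      (fun i n => alternatingFaces M.resolution (aqTerm (ZMod p) m n) i)
      (fun i => aqη (M.resolution.obj (.op (.mk i))) m)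
      (fun i => M.resD m i)
      (fun n => ((aqTerm (ZMod p) m n).map M.contractibleOver.aug).hom) (fun n => aqD A m n) :=
  M.contractibleOver.isBiresolution (fun _ => exists_section_counit _) m

/-- The André-Quillen homology in positive degrees in terms of cycles and boundaries. -/
theorem _root_.AugGrAlg.exists_aqHomology_map {k : Type} [Field k] (A : AugGrAlg.{u} k) (m n : ℕ) :
    ∃ q : LinearMap.ker (aqD A m n) →ₗ[k] A.aqHomology (n + 1) m, Function.Surjective q ∧
      ∀ z, q z = 0 ↔ ∃ z', aqD A m (n + 1) z' = z := by
  have hd (n : ℕ) : ((A.aqComplex m).d (n + 1) n).hom = aqD A m n :=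
    congrArg (fun f => f.hom)
      (Cotriple.complex_d (symFunctor k) (symCounit k) (indecFunctor k m) A n)
  have h (f : (aqTerm k m (n + 1)).obj A →ₗ[k] (aqTerm k m n).obj A)
      (f' : (aqTerm k m (n + 2)).obj A →ₗ[k] (aqTerm k m (n + 1)).obj A) (hf : f = aqD A m n)
      (hf' : f' = aqD A m (n + 1))
      (h : ∃ q : LinearMap.ker f →ₗ[k] A.aqHomology (n + 1) m, Function.Surjective q ∧
        ∀ z, q z = 0 ↔ ∃ z', f' z' = z) :
      ∃ q : LinearMap.ker (aqD A m n) →ₗ[k] A.aqHomology (n + 1) m, Function.Surjective q ∧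
        ∀ z, q z = 0 ↔ ∃ z', aqD A m (n + 1) z' = z := by
    subst hf hf'
    exact h
  exact h _ _ (hd n) (hd (n + 1)) ((A.aqComplex m).exists_homology_map n)

theorem exists_resD_eq {n : ℕ} (hn : n ≠ 0) {b : M.resIndec m (n + 1)} (hb : M.resD m n b = 0) :
    ∃ b', M.resD m (n + 1) b' = b :=
  exists_eq_of_splitting (R := ZMod p) (B := M.resIndec m) (E := M.truncAlg.indecGrading m)
    (hB := fun _ => inferInstance) (hB' := fun _ => inferInstance)
    (δ := M.resD m) (s := M.resS m) (u := M.resU m) (v := M.resV m) (M.resD_resD m)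
    (M.resD_resS m) (M.resD_resV m) (M.resU_resV m) hn hb

theorem resU_eq_zero_iff (b : M.resIndec m 1) : M.resU m 1 b = 0 ↔ ∃ b', M.resD m 1 b' = b :=
  splitting_eq_zero_iff (R := ZMod p) (B := M.resIndec m) (E := M.truncAlg.indecGrading m)
    (hB := fun _ => inferInstance) (hB' := fun _ => inferInstance)
    (δ := M.resD m) (s := M.resS m) (u := M.resU m) (v := M.resV m) (M.resD_resD m)
    (M.resD_resS m) (M.resD_resV m) (M.resU_resV m) (M.resD_zero m) b

include M in
theorem subsingleton_aqHomology (n : ℕ) (hn : 2 ≤ n) : Subsingleton (A.aqHomology n m) := by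
  obtain ⟨n, rfl⟩ := Nat.exists_eq_add_of_le' hn
  obtain ⟨q, hq, hqd⟩ := exists_aqHomology_map A m (n + 1)
  refine subsingleton_of_forall_eq 0 fun x => ?_
  obtain ⟨z, rfl⟩ := hq x
  have h := (M.isBiresolution m).exact_dZ (n + 1)
    (fun b hb => M.exists_resD_eq m (Nat.succ_ne_zero n) hb) z.1 z.2
  exact (hqd z).mpr h

/-- The first André-Quillen homology has one basis element for each truncated polynomial generator,
in the degree of its vanishing power. -/
theorem nonempty_aqHomology_one_equiv :
    Nonempty (A.aqHomology 1 m ≃ₗ[ZMod p]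
      ({t : M.Trunc // M.bound t * M.deg t.1 = m} →₀ ZMod p)) := by
  obtain ⟨q, hq, hqd⟩ := exists_aqHomology_map A m 0
  obtain ⟨e⟩ := (M.isBiresolution m).nonempty_homology_equiv (h := A.aqHomology 1 m)
    (M.resD_zero m) (M.resU m 1) (fun e => ⟨_, M.resU_resV m 0 e⟩) (M.resU_eq_zero_iff m) q hq hqd
  obtain ⟨e'⟩ := nonempty_indecGrading_freeAlg_equiv (k := ZMod p) M.truncDeg m
  exact ⟨e.trans (e'.trans (Finsupp.domLCongr
    ((equivShrink M.Trunc).symm.subtypeEquiv fun _ => Iff.rfl)))⟩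

end MonogenicBasis

/-! ### Borel decompositions as monomial bases -/

namespace MonogenicBasis

variable {p : ℕ} [Fact p.Prime] {A : AugGrAlg.{u} (ZMod p)} {ι : Type v} [LinearOrder ι]
  (M : A.MonogenicBasis ι)

/-- The augmentation ideal is spanned by the monomials other than `1`. -/
theorem augIdeal_le_span :
    A.augIdeal ≤ Submodule.span (ZMod p) (orderedMonomial M.gen '' {s | s ≠ 0}) := by
  intro a ha
  have hN : Submodule.span (ZMod p) (orderedMonomial M.gen '' {s | s ≠ 0}) ≤ A.augIdeal := by
    rw [Submodule.span_le]
    rintro _ ⟨s, hs, rfl⟩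
    exact A.aug_eq_zero (fun h => hs ((weight_eq_zero_iff M.deg_pos).mp h))
      (orderedMonomial_mem M.gen_mem s)
  have h : a ∈ Submodule.span (ZMod p) {(1 : A.carrier)} ⊔
      Submodule.span (ZMod p) (orderedMonomial M.gen '' {s | s ≠ 0}) := by
    refine (M.span_eq_top.ge.trans (Submodule.span_le.mpr ?_)) (Submodule.mem_top (x := a))
    rintro _ ⟨s, rfl⟩
    by_cases hs : s.1 = 0
    · refine Submodule.mem_sup_left (Submodule.subset_span ?_)
      change orderedMonomial M.gen s.1 = 1
      rw [hs, orderedMonomial_zero]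
    · exact Submodule.mem_sup_right (Submodule.subset_span ⟨_, hs, rfl⟩)
  obtain ⟨y, hy, z, hz, rfl⟩ := Submodule.mem_sup.mp h
  obtain ⟨c, rfl⟩ := Submodule.mem_span_singleton.mp hy
  have h1 : A.aug (c • 1 + z) = 0 := ha
  have h2 : A.aug z = 0 := hN hz
  rw [map_add, h2, add_zero, map_smul, map_one, smul_eq_mul, mul_one] at h1
  rw [h1, zero_smul, zero_add]
  exact hz

/-- The functional on `QA` that is dual to the generator `x_i`. -/
theorem exists_indec_dual (i : ι) : ∃ φ : A.Indec →ₗ[ZMod p] ZMod p,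
    φ (A.decomposables.mkQ ⟨M.gen i, M.gen_mem_augIdeal i⟩) = 1 ∧
    (∀ j, j ≠ i → φ (A.decomposables.mkQ ⟨M.gen j, M.gen_mem_augIdeal j⟩) = 0) ∧
    ∀ n, n ≠ M.deg i → ∀ x ∈ A.indecGrading n, φ x = 0 := by
  classical
  have hi : Finsupp.single i 1 ∈ restricted M.height := fun j => by
    refine lt_of_lt_of_le ?_ (M.two_le_height j)
    rw [Finsupp.single_apply]
    split_ifs <;> norm_num
  obtain ⟨ψ, hψ⟩ := exists_coordinate M.gen_mem M.pow_height hi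
    ((show LinearIndepOn (ZMod p) (orderedMonomial M.gen) (restricted M.height) from
      M.linearIndependent).mono fun s hs => hs.1)
  have hψ' (j : ι) : ψ (M.gen j) = if j = i then 1 else 0 := by
    have h := hψ (Finsupp.single j 1)
    rw [orderedMonomial_single, pow_one] at h
    rw [h]
    simp [Finsupp.single_left_inj]
  have hmul : A.augIdeal * A.augIdeal ≤ LinearMap.ker ψ := by
    refine (mul_le_mul' M.augIdeal_le_span M.augIdeal_le_span).trans ?_
    rw [Submodule.span_mul_span, Submodule.span_le]
    rintro _ ⟨_, ⟨s, hs, rfl⟩, _, ⟨s', hs', rfl⟩, rfl⟩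
    obtain ⟨c, hc⟩ := (signCommuting M.gen_mem).monomial_mul s s'
    change ψ (orderedMonomial M.gen s * orderedMonomial M.gen s') = 0
    rw [hc]
    refine LinearMap.mem_ker.mp (units_smul_mem _ c (LinearMap.mem_ker.mpr ?_))
    rw [hψ, if_neg]
    intro h
    have h1 := congrArg Finsupp.degree h
    rw [map_add, Finsupp.degree_single] at h1
    have h2 : Finsupp.degree s ≠ 0 := fun h => hs ((Finsupp.degree_eq_zero_iff s).mp h)
    have h3 : Finsupp.degree s' ≠ 0 := fun h => hs' ((Finsupp.degree_eq_zero_iff s').mp h)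
    lia
  refine ⟨A.decomposables.liftQ (ψ ∘ₗ A.augIdeal.subtype) fun x hx => hmul hx, ?_, fun j hj => ?_,
    ?_⟩
  · exact (hψ' i).trans (if_pos rfl)
  · exact (hψ' j).trans (if_neg hj)
  · rintro n hn _ ⟨a, ha, rfl⟩
    change ψ a = 0
    have h := mem_span_of_mem_grading (orderedMonomial_mem M.gen_mem)
      (show a.1 ∈ A.grading n from ha)
      (M.augIdeal_le_span a.2)
    refine LinearMap.mem_ker.mp (Submodule.span_le.mpr ?_ h)
    rintro _ ⟨s, ⟨-, hs⟩, rfl⟩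
    refine (hψ s).trans (if_neg ?_)
    rintro rfl
    rw [Finsupp.weight_single, one_smul] at hs
    exact hn hs.symm

end MonogenicBasis

namespace BorelDecomposition

variable {p : ℕ} [Fact p.Prime] {A : AugGrAlg.{u} (ZMod p)} {ι : Type v} [LinearOrder ι]
  (D : A.BorelDecomposition ι)

/-- The monomial basis of a Borel decomposition. -/
def toMonogenicBasis : A.MonogenicBasis ι where
  deg := D.deg
  gen := D.gen
  height i := (D.kind i).height p
  deg_pos := D.deg_pos
  gen_mem := D.gen_mem
  two_le_height i := by
    cases h : D.kind i with
    | polynomial => exact le_top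
    | truncated e =>
      have h1 := (Fact.out : p.Prime).two_le.trans
        (Nat.le_self_pow (D.pos_of_truncated i e h).ne' p)
      exact Nat.cast_le (α := ℕ∞).mpr h1
    | exterior => exact le_rfl
  height_of_odd i hi := by
    cases h : D.kind i with
    | polynomial =>
      exact absurd (or_iff_not_imp_right.mpr (D.even_of_polynomial i h)) hi
    | truncated e =>
      exact absurd (or_iff_not_imp_right.mpr (D.even_of_truncated i e h)) hi
    | exterior => rfl
  pow_height := D.pow_height
  linearIndependent := D.linearIndependent
  span_eq_top := D.span_eq_top

theorem gen_injective : Function.Injective D.gen := by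
  have h (i : ι) : Finsupp.single i 1 ∈ restricted D.toMonogenicBasis.height := fun j => by
    classical
    refine lt_of_lt_of_le ?_ (D.toMonogenicBasis.two_le_height j)
    rw [Finsupp.single_apply]
    split_ifs <;> norm_num
  intro i j hij
  have h1 := D.toMonogenicBasis.linearIndependent.injective
    (a₁ := ⟨_, h i⟩) (a₂ := ⟨_, h j⟩) (by
      simp only [orderedMonomial_single, pow_one]
      exact hij)
  exact (Finsupp.single_left_inj one_ne_zero).mp (congrArg Subtype.val h1)

include D in
theorem small : Small.{u} ι :=
  small_of_injective D.gen_injective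

theorem even_or_of_truncated (t : D.Truncated) : Even (D.deg t.1.1) ∨ p = 2 :=
  or_iff_not_imp_right.mpr (D.even_of_truncated _ _ t.2)

theorem truncated_ext {t t' : D.Truncated} (h : t.1.1 = t'.1.1) : t = t' := by
  obtain ⟨⟨i, e⟩, ht⟩ := t
  obtain ⟨⟨j, e'⟩, ht'⟩ := t'
  dsimp only at h ht ht'
  subst h
  obtain rfl : e = e' := GeneratorKind.truncated.inj (ht.symm.trans ht')
  rfl

/-- The truncated polynomial generators of a Borel decomposition, as generators of a monomial
basis. -/
theorem exists_truncatedEquiv : ∃ e : D.Truncated ≃ D.toMonogenicBasis.Trunc,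
    ∀ t, D.toMonogenicBasis.bound (e t) * D.toMonogenicBasis.deg (e t).1 = D.frobeniusDegree t := by
  have hh (t : D.Truncated) : D.toMonogenicBasis.height t.1.1 = ((p ^ t.1.2 : ℕ) : ℕ∞) :=
    congrArg (GeneratorKind.height p) t.2
  let f (t : D.Truncated) : D.toMonogenicBasis.Trunc :=
    ⟨t.1.1, D.even_or_of_truncated t, by
      rw [hh]
      exact ENat.natCast_ne_top _⟩
  have hf : Function.Bijective f := by
    refine ⟨fun t t' h => D.truncated_ext (congrArg Subtype.val h), fun ⟨i, hi, hi'⟩ => ?_⟩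
    cases h : D.kind i with
    | polynomial => exact absurd (congrArg (GeneratorKind.height p) h) hi'
    | truncated e => exact ⟨⟨(i, e), h⟩, rfl⟩
    | exterior =>
      obtain ⟨h1, h2⟩ := D.odd_of_exterior i h
      exact absurd hi (not_or.mpr ⟨Nat.not_even_iff_odd.mpr h2, h1⟩)
  refine ⟨Equiv.ofBijective f hf, fun t => congrArg (· * D.deg t.1.1) ?_⟩
  have h1 := (D.toMonogenicBasis.coe_bound (f t)).trans (hh t)
  exact_mod_cast h1

/-- The elements `ξ ^ e x_i` are linearly independent, since the functional on `QA` dual to `x_i`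
extends to an algebra map `S(QA) → 𝔽_p`, the degree of `x_i` being even or `p` being `2`. -/
theorem linearIndependent_frobeniusPower : LinearIndependent (ZMod p) D.frobeniusPower := by
  have h (t : D.Truncated) : ∃ F : GrSymAlg A.indecGrading →ₐ[ZMod p] ZMod p,
      F (D.frobeniusPower t) = 1 ∧ ∀ t', t ≠ t' → F (D.frobeniusPower t') = 0 := by
    obtain ⟨φ, h1, h0, hdeg⟩ := D.toMonogenicBasis.exists_indec_dual t.1.1
    let F : GrSymAlg A.indecGrading →ₐ[ZMod p] ZMod p := GrSymAlg.lift A.indecGrading φ (by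
      intro i j x y hx hy
      by_cases hi : i = D.deg t.1.1
      · have hs : (-1 : ZMod p) ^ (i * j) = 1 := by
          rcases D.even_or_of_truncated t with he | hp
          · rw [hi, (he.mul_right j).neg_one_pow]
          · subst hp
            rw [show (-1 : ZMod 2) = 1 from rfl, one_pow]
        rw [hs, one_smul, mul_comm]
      · rw [hdeg i hi x hx, zero_mul, mul_zero, smul_zero])
    have hF (t' : D.Truncated) : F (D.frobeniusPower t') = φ (D.genClass t'.1.1) ^ p ^ t'.1.2 :=
      (map_pow F _ _).trans (congrArg (· ^ p ^ t'.1.2) (GrSymAlg.lift_ι _ _ _ _))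
    refine ⟨F, ?_, fun t' ht => ?_⟩
    · rw [hF]
      exact (congrArg (· ^ p ^ t.1.2) h1).trans (one_pow _)
    · rw [hF]
      refine (congrArg (· ^ p ^ t'.1.2)
        (h0 t'.1.1 fun h => ht (D.truncated_ext h.symm))).trans (zero_pow ?_)
      exact pow_ne_zero _ (Fact.out : p.Prime).ne_zero
  choose F hF1 hF0 using h
  exact LinearIndependent.of_pairwise_dual_eq_zero_one _ (fun t => (F t).toLinearMap)
    (fun t t' h => hF0 t t' h) hF1

theorem nonempty_frobeniusSpan_equiv (m : ℕ) :
    Nonempty (D.frobeniusSpan m ≃ₗ[ZMod p] ({t // D.frobeniusDegree t = m} →₀ ZMod p)) := by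
  have h : D.frobeniusSpan m = Submodule.span (ZMod p)
      (Set.range fun t : {t // D.frobeniusDegree t = m} => D.frobeniusPower t.1) := by
    refine congrArg _ (Set.ext fun a => ⟨?_, ?_⟩)
    · rintro ⟨t, ht, rfl⟩
      exact ⟨⟨t, ht⟩, rfl⟩
    · rintro ⟨t, rfl⟩
      exact ⟨t.1, t.2, rfl⟩
  exact ⟨(LinearEquiv.ofEq _ _ h).trans (LinearIndependent.linearCombinationEquiv
    (D.linearIndependent_frobeniusPower.comp _ Subtype.val_injective)).symm⟩

theorem nonempty_aqHomology_one_equiv (m : ℕ) :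
    Nonempty (A.aqHomology 1 m ≃ₗ[ZMod p] D.frobeniusSpan m) := by
  have := D.small
  obtain ⟨e⟩ := D.toMonogenicBasis.nonempty_aqHomology_one_equiv m
  obtain ⟨f, hf⟩ := D.exists_truncatedEquiv
  obtain ⟨e'⟩ := D.nonempty_frobeniusSpan_equiv m
  have hf' (t : D.Truncated) : D.frobeniusDegree t = m ↔
      D.toMonogenicBasis.bound (f t) * D.toMonogenicBasis.deg (f t).1 = m := by
    rw [hf]
  exact ⟨e.trans ((Finsupp.domLCongr (f.subtypeEquiv hf').symm).trans e'.symm)⟩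

theorem subsingleton_aqHomology (D : A.BorelDecomposition ι) (n : ℕ) (hn : 2 ≤ n) (m : ℕ) :
    Subsingleton (A.aqHomology n m) :=
  have := D.small
  D.toMonogenicBasis.subsingleton_aqHomology m n hn

end BorelDecomposition

end AugGrAlg

theorem proposition1p3 (p : ℕ) [Fact p.Prime] (A : AugGrAlg.{u} (ZMod p))
    (hconn : A.Connected) (hfin : A.FiniteType) (hopf : A.HopfStructure) :
    (∃ (ι : Type) (_ : LinearOrder ι), Nonempty (A.BorelDecomposition ι)) ∧
    (∀ m : ℕ, ∃ e : A.aqHomology 0 m ≅ (AugGrAlg.indecFunctor (ZMod p) m).obj A,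
      (A.aqComplex m).homologyπ 0 ≫ e.hom =
        (A.aqComplex m).iCycles 0 ≫
          (AugGrAlg.indecFunctor (ZMod p) m).map ((AugGrAlg.symCounit (ZMod p)).app A)) ∧
    (∀ (ι : Type v) [LinearOrder ι] (D : A.BorelDecomposition ι),
      LinearIndependent (ZMod p) D.frobeniusPower ∧
        ∀ m : ℕ, Nonempty (A.aqHomology 1 m ≃ₗ[ZMod p] D.frobeniusSpan m)) ∧
    (∀ n : ℕ, 2 ≤ n → ∀ m : ℕ, Subsingleton (A.aqHomology n m)) := by
  obtain ⟨ι, hι, ⟨D⟩⟩ := AugGrAlg.exists_borelDecomposition hconn hfin hopf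
  exact ⟨⟨ι, hι, ⟨D⟩⟩, fun m => AugGrAlg.exists_aqHomology_zero_iso A m,
    fun ι _ D => ⟨D.linearIndependent_frobeniusPower, D.nonempty_aqHomology_one_equiv⟩,
    fun n hn m => D.subsingleton_aqHomology n hn m⟩
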